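/- **Index sets.** Let $m\ge 0$ be an integer and let $\mathfrak x\in\{\mathfrak a,\mathfrak b,\mathfrak b^\bullet,\mathfrak c,\mathfrak d\}$. Put $\widetilde{\mathbb I}^+=\{-m,\dots,-1,\tfrac12,1,\tfrac32,2,\dots\}$ (ordered as real numbers), let $\mathbb I^+\subset\widetilde{\mathbb I}^+$ be the subset of integers, and $\overline{\mathbb I}^+=\{-m,\dots,-1,\tfrac12,\tfrac32,\dots\}$. Let $\widetilde V$ be the complex superspace with basis $v_r, v_{\bar r}$ ($r\in\widetilde{\mathbb I}^+$) and $v_{\bar 0}$, where $|v_r|=|v_{\bar r}|\equiv 2r \pmod 2$, $v_{\bar0}$ is odd in types $\mathfrak b^\bullet,\mathfrak c$ and even otherwise. $E_{ij}$ denotes the elementary matrices, and $\mathrm{Str}$ the supertrace. **Lie superalgebras.** In type $\mathfrak a$, $\widetilde{\mathcal G}$ is the span of the $E_{rs}$, $r,s\in\widetilde{\mathbb I}^+$. In the other types let $(\cdot|\cdot)$ be the bilinear form with $(v_r|v_{\bar s})=\delta_{rs}=\pm(-1)^{|v_r||v_s|}(v_{\bar s}|v_r)$, $(v_{\bar0}|v_{\bar0})=1$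 and all other values on basis vectors $0$, the sign being $-$ in types $\mathfrak b^\bullet,\mathfrak c$ and $+$ in types $\mathfrak b,\mathfrak d$; then $\widetilde{\mathcal G}$ consists of the matrices with finitely many nonzero entries that preserve the form, on the span of all $v_r,v_{\bar r},v_{\bar 0}$ in types $\mathfrak b,\mathfrak b^\bullet$, and of all $v_r,v_{\bar r}$ in types $\mathfrak c,\mathfrak d$. The subalgebras $\mathcal G$ and $\overline{\mathcal G}$ are defined in the same way with $\widetilde{\mathbb I}^+$ replaced by $\mathbb I^+$ and $\overline{\mathbb I}^+$. Let $\widetilde{\mathfrak g}=\widetilde{\mathcal G}\oplus\mathbb CK$ be the central extension with cocycle $\tau(A,B)=\mathrm{Str}([J,A]B)$, $J=-\sum_{r\ge1/2}E_{rr}$, and let $\mathfrak g=\mathcal G\oplus\mathbb CK$, $\overline{\mathfrak g}=\overline{\mathcal G}\oplus\mathbb CK$ be the corresponding subalgebras. Put $E_r=E_{rr}$ in type $\mathfrak a$ and $E_r=E_{rr}-E_{\bar r\bar r}$ otherwise. The Cartan subalgebra $\widetilde{\mathfrak h}$ of $\widetilde{\mathfrak g}$ has basis $K$, $E_r$ ($r\in\widetilde{\mathbb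 I}^+$); let $\Lambda_0,\epsilon_r$ be the dual basis of its restricted dual $\widetilde{\mathfrak h}^*$. Likewise $\mathfrak h,\overline{\mathfrak h}$, with $\mathfrak h^*,\overline{\mathfrak h}^*\subset\widetilde{\mathfrak h}^*$ spanned by $\Lambda_0$ and the $\epsilon_r$ with $r\in\mathbb I^+$, resp. $r\in\overline{\mathbb I}^+$. **Roots.** The simple roots $\widetilde\Pi$ of $\widetilde{\mathfrak g}$ are the $\epsilon_r-\epsilon_s$ for $r<s$ consecutive in $\widetilde{\mathbb I}^+$, together with one more root if $\mathfrak x\ne\mathfrak a$: if $r$ is the least index and $s$ its successor, it is $-\epsilon_r$ in types $\mathfrak b,\mathfrak b^\bullet$; in type $\mathfrak c$ it is $-2\epsilon_r$ if $r$ is an integer and $-\epsilon_r-\epsilon_s$ otherwise; in type $\mathfrak d$ it is $-\epsilon_r-\epsilon_s$ if $r$ is an integer and $-2\epsilon_r$ otherwise. Positive roots $\widetilde\Phi^+$ are the roots that are sums of simple roots. $\widetilde{\mathfrak l}$ is the Levi subalgebra spanned by $\widetilde{\mathfrak h}$ and the root spaces of the roots that are integral combinations of the $\epsilon_r-\epsilon_s$,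 $0<r<s$ consecutive. Similarly for $\mathfrak g$ and $\overline{\mathfrak g}$, with index sets $\mathbb I^+$ and $\overline{\mathbb I}^+$. **The category $\widetilde{\mathcal O}$.** For a partition $\lambda^+$ put $\theta(\lambda^+)_{i-1/2}=\max\{(\lambda^+)'_i-i+1,0\}$ and $\theta(\lambda^+)_i=\max\{\lambda^+_i-i,0\}$ for $i\ge1$. $\widetilde P^+$ is the set of weights $d\Lambda_0+\sum_{i=-m}^{-1}\lambda_i\epsilon_i+\sum_{r>0}\theta(\lambda^+)_r\epsilon_r$ with $\lambda^+$ a partition, $d,\lambda_i\in\mathbb C$, and all $\lambda_i\in\mathbb Z$ in type $\mathfrak b^\bullet$. $\widetilde\Xi$ is the set of weights $d\Lambda_0+\sum_r\mu_r\epsilon_r\in\widetilde{\mathfrak h}^*$ with $\mu_r\in\mathbb Z_{\ge0}$ for all $r>0$ and, in type $\mathfrak b^\bullet$, $\mu_r\in\mathbb Z$ for all $r<0$; further $\Xi=\widetilde\Xi\cap\mathfrak h^*$, $\overline\Xi=\widetilde\Xi\cap\overline{\mathfrak h}^*$. $\widetilde{\mathcal O}$ is the category of $\widetilde{\mathfrak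 g}$-modules $M$ that are direct sums of finite-dimensional weight spaces $M_\gamma$, $\gamma\in\widetilde{\mathfrak h}^*$, such that (i) $M$ is a direct sum of irreducible highest weight $\widetilde{\mathfrak l}$-modules with highest weights in $\widetilde P^+$, and (ii) there is a finite subset $F\subset\widetilde P^+$ such that every weight $\gamma$ of $M$ satisfies $\lambda-\gamma\in\sum_{\alpha\in\widetilde\Pi}\mathbb Z_{\ge0}\alpha$ for some $\lambda\in F$; $M$ carries the $\mathbb Z/2$-grading for which a vector of weight $\mu\in\widetilde\Xi$ has the parity of $\sum_r\mu_r$, summed over the proper half-integers $r$ (in type $\mathfrak b^\bullet$: over the integers $r\in\mathbb I^+$). For $M\in\widetilde{\mathcal O}$, the $\mathfrak g$-module $T(M)=\bigoplus_{\gamma\in\mathfrak h^*}M_\gamma$ and the $\overline{\mathfrak g}$-module $\overline T(M)=\bigoplus_{\gamma\in\overline{\mathfrak h}^*}M_\gamma$ carry the restricted gradings. **KZ equations.** Let $\langle A,B\rangle=\mathrm{Str}(AB)$ in type $\mathfrak a$ and $\frac12\mathrm{Str}(AB)$ otherwise. Choose, for each $\beta\in\widetilde\Phi^+$, root vectors $E_\beta,E^\beta\in\widetilde{\mathcal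 G}$ of weights $\beta,-\beta$ with $\langle E_\beta,E^\beta\rangle=1$, and put $$\widetilde\Omega=\sum_{\beta\in\widetilde\Phi^+}\bigl(E^\beta\otimes E_\beta+(-1)^{|E_\beta|}E_\beta\otimes E^\beta\bigr)+\sum_{r\in\widetilde{\mathbb I}^+}(-1)^{2r}\bigl(E_r\otimes E_r-(-1)^{2r}\delta_r(K\otimes E_r+E_r\otimes K)\bigr),$$ where $\delta_r=1$ if $r>0$ and $\delta_r=0$ if $r<0$. $\Omega$ and $\overline\Omega$ are given by the same formula for $\mathfrak g$ and $\overline{\mathfrak g}$ (with their positive roots, index sets and root vectors so normalised). On a tensor product $N_1\otimes\cdots\otimes N_\ell$, $x^{(i)}$ is the action of $x$ on the $i$-th factor, with the usual sign rule, and $(\sum x\otimes y)^{(ij)}=\sum x^{(i)}y^{(j)}$. Fix $\kappa\in\mathbb C\setminus\{0\}$ and a non-empty open set $U$ of points $(z_1,\dots,z_\ell)\in\mathbb C^\ell$ with pairwise distinct coordinates; $\mathcal D(U,W)$ is the set of differentiable (holomorphic) functions from $U$ to a finite-dimensional complex vector space $W$. For $\widetilde M=\widetilde M_1\otimes\cdots\otimes\widetilde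 M_\ell$ with $\widetilde M_1,\dots,\widetilde M_\ell\in\widetilde{\mathcal O}$ and a weight $\mu$, let $\widetilde{\mathrm{KZ}}(\widetilde M_\mu)$ be the set of all $\psi\in\mathcal D(U,\widetilde M_\mu)$ with $$\kappa\,\frac{\partial\psi}{\partial z_i}=\sum_{j\ne i}\frac{\widetilde\Omega^{(ij)}\psi}{z_i-z_j},\qquad i=1,\dots,\ell .$$ Define $\mathrm{KZ}(T(\widetilde M)_\mu)$ and $\overline{\mathrm{KZ}}(\overline T(\widetilde M)_\mu)$ in the same way with $\Omega$, $\overline\Omega$ on $T(\widetilde M)=T(\widetilde M_1)\otimes\cdots\otimes T(\widetilde M_\ell)$ and $\overline T(\widetilde M)=\overline T(\widetilde M_1)\otimes\cdots\otimes\overline T(\widetilde M_\ell)$, regarded as subspaces of $\widetilde M$. Let $T\psi$, $\overline T\psi$ be the compositions of $\psi$ with the projections of $\widetilde M$ to $T(\widetilde M)$, $\overline T(\widetilde M)$ along the other weight spaces. **Theorem.** (i) Let $\mu\in\Xi$. Then $Tv=v$ and $\widetilde\Omega^{(ij)}v=\Omega^{(ij)}v$ for all $v\in\widetilde M_\mu$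 and $i\ne j$; and for $\psi\in\mathcal D(U,\widetilde M_\mu)$, $$\psi\in\widetilde{\mathrm{KZ}}(\widetilde M_\mu)\iff T\psi\in\mathrm{KZ}(T(\widetilde M)_\mu).$$ (ii) Let $\mu\in\overline\Xi$. Then $\overline Tv=v$ and $\widetilde\Omega^{(ij)}v=\overline\Omega^{(ij)}v$ for all $v\in\widetilde M_\mu$ and $i\ne j$; and for $\psi\in\mathcal D(U,\widetilde M_\mu)$, $$\psi\in\widetilde{\mathrm{KZ}}(\widetilde M_\mu)\iff\overline T\psi\in\overline{\mathrm{KZ}}(\overline T(\widetilde M)_\mu).$$ -/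

import Mathlib

open scoped TensorProduct

namespace SuperKZ

/-! ### Index sets -/

/-- The five types of Lie superalgebras. -/
inductive LieType
  | a
  | b
  | bBullet
  | c
  | d

/-- The three Lie superalgebras attached to a type: the big one (written with a tilde), the Lie
(super)algebra with integral tail indices (no decoration) and the one with half-integral tail
indices (written with a bar). -/
inductive Flavor
  | tilde
  | plain
  | bar

/-- The ordered index set `{-m, …, -1, 1/2, 1, 3/2, …}`. The half-integer `r` is encoded by the
integer `2 r`. -/
abbrev IPlus (m : ℕ) : Type :=
  {t : ℤ // (-(2 * (m : ℤ)) ≤ t ∧ t < 0 ∧ Even t) ∨ 0 < t}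

/-- The subset of `IPlus m` belonging to a flavor: everything, or the integers, or the negative
integers together with the positive proper half-integers. -/
def Flavor.idx {m : ℕ} : Flavor → Set (IPlus m)
  | .tilde => Set.univ
  | .plain => {r | Even r.1}
  | .bar => {r | r.1 < 0 ∨ Odd r.1}

/-- The full index set: `pos r` is the index `r`, `bar r` is the index `r` with a bar, and `zero`
is the index `0` with a bar. -/
inductive Idx (m : ℕ)
  | pos (r : IPlus m)
  | bar (r : IPlus m)
  | zero

/-- The sign `(-1)^p` of a parity. -/
noncomputable def sgn (p : ZMod 2) : ℂ := if p = 0 then 1 else -1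

/-- The parity `2 r mod 2` of an index `r`. -/
def ipar {m : ℕ} (r : IPlus m) : ZMod 2 := (r.1 : ZMod 2)

/-- The number `δ_r`, equal to `1` if `r ≥ 1/2` and to `0` if `r < 0`. -/
noncomputable def delta {m : ℕ} (r : IPlus m) : ℂ := if 0 < r.1 then 1 else 0

/-- The parity of the basis vector `v_i`. The parity of `v_zero` depends on the type. -/
def par {m : ℕ} (x : LieType) : Idx m → ZMod 2
  | .pos r => ipar r
  | .bar r => ipar r
  | .zero => match x with
    | .bBullet => 1
    | .c => 1
    | _ => 0

/-- The indices of the vectors spanning the natural module: only unbarred indices in type `a`,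
all indices in types `b` and `bBullet`, all indices but `zero` in types `c` and `d`. -/
def natIdx {m : ℕ} (x : LieType) (k : Flavor) : Set (Idx m)
  | .pos r => r ∈ k.idx
  | .bar r => x ≠ .a ∧ r ∈ k.idx
  | .zero => x = .b ∨ x = .bBullet

/-! ### Super linear algebra -/

/-- Homogeneous component of degree `p` of an operator on a super vector space. The grading of a
super vector space `W` is recorded by its parity involution `σ`, which is `(-1)^q` on the
component of degree `q`. -/
noncomputable def opPart {W : Type*} [AddCommGroup W] [Module ℂ W] (σ : Module.End ℂ W)
    (p : ZMod 2) (A : Module.End ℂ W) : Module.End ℂ W :=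
  (1 / 2 : ℂ) • (A + sgn p • (σ * A * σ))

/-- The supercommutator, `A B - (-1)^{|A||B|} B A` for homogeneous operators. -/
noncomputable def superBracket {W : Type*} [AddCommGroup W] [Module ℂ W] (σ : Module.End ℂ W)
    (A B : Module.End ℂ W) : Module.End ℂ W :=
  ∑ p : ZMod 2, ∑ q : ZMod 2,
    (opPart σ p A * opPart σ q B - sgn (p * q) • (opPart σ q B * opPart σ p A))

/-- The super space with basis `v_i`, `i` in the full index set. -/
def V (m : ℕ) : Type := Idx m →₀ ℂ

noncomputable instance (m : ℕ) : AddCommGroup (V m) :=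
  inferInstanceAs (AddCommGroup (Idx m →₀ ℂ))

noncomputable instance (m : ℕ) : Module ℂ (V m) :=
  inferInstanceAs (Module ℂ (Idx m →₀ ℂ))

/-- The basis `v_i` of `V m`. -/
noncomputable def vBasis (m : ℕ) : Module.Basis (Idx m) ℂ (V m) :=
  Module.Basis.ofRepr (LinearEquiv.refl ℂ (Idx m →₀ ℂ))

/-- The basis vector `v_i`. -/
noncomputable def vec {m : ℕ} (i : Idx m) : V m := vBasis m i

/-- The diagonal operator `v_i ↦ f i • v_i`. -/
noncomputable def diag {m : ℕ} (f : Idx m → ℂ) : Module.End ℂ (V m) :=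
  (vBasis m).constr ℂ (fun i => f i • vec i)

/-- The parity involution of the super space `V m`. -/
noncomputable def parOp {m : ℕ} (x : LieType) : Module.End ℂ (V m) := diag (fun i => sgn (par x i))

open Classical in
/-- The elementary matrix `E_{ij}`, sending `v_j` to `v_i` and the other `v_l` to `0`. -/
noncomputable def matUnit {m : ℕ} (i j : Idx m) : Module.End ℂ (V m) :=
  (vBasis m).constr ℂ (fun l => if l = j then vec i else 0)

/-- The supertrace (of a matrix with finitely many nonzero entries). -/
noncomputable def str {m : ℕ} (x : LieType) (A : Module.End ℂ (V m)) : ℂ :=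
  ∑ᶠ i : Idx m, sgn (par x i) * (vBasis m).repr (A (vec i)) i

/-- The matrices with finitely many nonzero entries, all of them at places in `S × S`. -/
noncomputable def gl {m : ℕ} (S : Set (Idx m)) : Submodule ℂ (Module.End ℂ (V m)) :=
  Submodule.span ℂ {A | ∃ i ∈ S, ∃ j ∈ S, A = matUnit i j}

/-! ### The Lie superalgebras -/

/-- The sign `ε` in `(v|w) = ε (-1)^{|v||w|} (w|v)`: the form is skew-supersymmetric in
types `bBullet` and `c`, and supersymmetric in types `b` and `d`. -/
noncomputable def formSign : LieType → ℂ
  | .bBullet => -1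
  | .c => -1
  | _ => 1

open Classical in
/-- Values of the bilinear form on basis vectors. -/
noncomputable def formBasis {m : ℕ} (x : LieType) : Idx m → Idx m → ℂ
  | .pos r, .bar s => if r = s then 1 else 0
  | .bar s, .pos r => if r = s then formSign x * sgn (ipar r * ipar s) else 0
  | .zero, .zero => 1
  | _, _ => 0

/-- The (skew-)supersymmetric bilinear form on `V m`. -/
noncomputable def form {m : ℕ} (x : LieType) : V m →ₗ[ℂ] V m →ₗ[ℂ] ℂ :=
  (vBasis m).constr ℂ (fun i => (vBasis m).constr ℂ (fun j => formBasis x i j))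

/-- An operator preserves the form if its homogeneous components `A` satisfy
`(A v|w) + (-1)^{|A||v|} (v|A w) = 0` for homogeneous `v`. -/
def PreservesForm {m : ℕ} (x : LieType) (A : Module.End ℂ (V m)) : Prop :=
  ∀ (p : ZMod 2) (i j : Idx m),
    form x (opPart (parOp x) p A (vec i)) (vec j)
      + sgn (p * par x i) * form x (vec i) (opPart (parOp x) p A (vec j)) = 0

theorem opPart_add {W : Type*} [AddCommGroup W] [Module ℂ W] (σ : Module.End ℂ W)
    (p : ZMod 2) (A B : Module.End ℂ W) :
    opPart σ p (A + B) = opPart σ p A + opPart σ p B := by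
  simp only [opPart, mul_add, add_mul, smul_add]
  abel

theorem opPart_smul {W : Type*} [AddCommGroup W] [Module ℂ W] (σ : Module.End ℂ W)
    (p : ZMod 2) (c : ℂ) (A : Module.End ℂ W) :
    opPart σ p (c • A) = c • opPart σ p A := by
  simp only [opPart, mul_smul_comm, smul_mul_assoc, smul_add, smul_smul]
  congr 2 <;> ring_nf

/-- The Lie superalgebra `𝒢` of type `x` and given flavor (infinite rank, without central
extension), as a space of operators on `V m`: in type `a` the full general linear
Lie superalgebra of the natural module, otherwise its subalgebra preserving the form. -/
noncomputable def algG (m : ℕ) (x : LieType) (k : Flavor) : Submodule ℂ (Module.End ℂ (V m)) where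
  carrier := {A | A ∈ gl (natIdx x k) ∧ (x ≠ .a → PreservesForm x A)}
  zero_mem' := by
    refine ⟨Submodule.zero_mem _, fun _ p i j => ?_⟩
    simp [opPart]
  add_mem' := by
    rintro A B ⟨hA, hA'⟩ ⟨hB, hB'⟩
    refine ⟨Submodule.add_mem _ hA hB, fun hx p i j => ?_⟩
    have h1 := hA' hx p i j
    have h2 := hB' hx p i j
    simp only [opPart_add, LinearMap.add_apply, map_add] at h1 h2 ⊢
    linear_combination h1 + h2
  smul_mem' := by
    rintro c A ⟨hA, hA'⟩
    refine ⟨Submodule.smul_mem _ c hA, fun hx p i j => ?_⟩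
    have h1 := hA' hx p i j
    simp only [opPart_smul, LinearMap.smul_apply, map_smul, smul_eq_mul] at h1 ⊢
    linear_combination c * h1

/-- The operator `J = - ∑_{r ≥ 1/2} E_{rr}`. -/
noncomputable def J (m : ℕ) : Module.End ℂ (V m) :=
  diag (fun i => match i with
    | .pos r => - delta r
    | _ => 0)

/-- The cocycle `τ(A, B) = Str([J, A] B)`. -/
noncomputable def cocycle {m : ℕ} (x : LieType) (A B : Module.End ℂ (V m)) : ℂ :=
  str x (superBracket (parOp x) (J m) A * B)

/-- The underlying space of the central extension `𝔤 = 𝒢 ⊕ ℂ K`; the pair `(A, c)` stands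
for `A + c K`. -/
noncomputable def algg (m : ℕ) (x : LieType) (k : Flavor) :
    Submodule ℂ (Module.End ℂ (V m) × ℂ) :=
  (algG m x k).prod ⊤

/-- The bracket `[A + a K, B + b K] = [A, B] + τ(A, B) K` of the central extension. -/
noncomputable def bracket {m : ℕ} (x : LieType) (X Y : Module.End ℂ (V m) × ℂ) :
    Module.End ℂ (V m) × ℂ :=
  (superBracket (parOp x) X.1 Y.1, cocycle x X.1 Y.1)

/-- `A + c K` is homogeneous of degree `p` (the central element `K` is even). -/
def IsHomog {m : ℕ} (x : LieType) (p : ZMod 2) (X : Module.End ℂ (V m) × ℂ) : Prop :=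
  parOp x * X.1 * parOp x = sgn p • X.1 ∧ X.2 = sgn p • X.2

/-- The Cartan element `E_r`: it is `E_{rr}` in type `a` and `E_{rr} - E_{r̄r̄}` otherwise. -/
noncomputable def cartanE {m : ℕ} (x : LieType) (r : IPlus m) : Module.End ℂ (V m) :=
  match x with
  | .a => matUnit (.pos r) (.pos r)
  | _ => matUnit (.pos r) (.pos r) - matUnit (.bar r) (.bar r)

theorem parity_cases (p : ZMod 2) : p = 0 ∨ p = 1 := by
  revert p; decide

theorem sgn_zero : sgn 0 = 1 := by simp [sgn]

theorem sgn_one : sgn 1 = -1 := by simp [sgn]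

theorem sgn_add (p q : ZMod 2) : sgn (p + q) = sgn p * sgn q := by
  have h : (1 + 1 : ZMod 2) = 0 := by decide
  rcases parity_cases p with rfl | rfl <;> rcases parity_cases q with rfl | rfl <;>
    simp [sgn_zero, sgn_one, h]

theorem sgn_sq (p : ZMod 2) : sgn p * sgn p = 1 := by
  rcases parity_cases p with rfl | rfl <;> simp [sgn_zero, sgn_one]

theorem ext_vec {m : ℕ} {A B : Module.End ℂ (V m)} (h : ∀ i, A (vec i) = B (vec i)) : A = B := by
  exact (vBasis m).ext h

theorem diag_vec {m : ℕ} (f : Idx m → ℂ) (i : Idx m) : diag f (vec i) = f i • vec i := by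
  simp [diag, vec, Module.Basis.constr_basis]

open Classical in
theorem matUnit_vec {m : ℕ} (i j l : Idx m) :
    matUnit i j (vec l) = if l = j then vec i else 0 := by
  simp [matUnit, vec, Module.Basis.constr_basis]

theorem parOp_sq {m : ℕ} (x : LieType) : parOp x * parOp x = (1 : Module.End ℂ (V m)) := by
  refine ext_vec fun i => ?_
  simp [parOp, diag_vec, smul_smul, sgn_sq]

theorem diag_mul_matUnit {m : ℕ} (f : Idx m → ℂ) (i j : Idx m) :
    diag f * matUnit i j = f i • matUnit i j := by
  refine ext_vec fun l => ?_
  by_cases h : l = j <;> simp [matUnit_vec, diag_vec, h]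

theorem matUnit_mul_diag {m : ℕ} (f : Idx m → ℂ) (i j : Idx m) :
    matUnit i j * diag f = f j • matUnit i j := by
  refine ext_vec fun l => ?_
  by_cases h : l = j <;> simp [matUnit_vec, diag_vec, h]

theorem matUnit_mul_matUnit {m : ℕ} (i j l n : Idx m) (A : Submodule ℂ (Module.End ℂ (V m)))
    (h : matUnit i n ∈ A) : matUnit i j * matUnit l n ∈ A := by
  by_cases hj : j = l
  · subst hj
    have : matUnit i j * matUnit j n = matUnit i n := by
      refine ext_vec fun s => ?_
      by_cases h : s = n <;> simp [matUnit_vec, h]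
    rwa [this]
  · have : matUnit i j * matUnit l n = 0 := by
      refine ext_vec fun s => ?_
      by_cases h : s = n
      · simp [matUnit_vec, h, Ne.symm hj]
      · simp [matUnit_vec, h]
    rw [this]; exact Submodule.zero_mem _

theorem gl_mul_mem {m : ℕ} {S : Set (Idx m)} {A B : Module.End ℂ (V m)} (hA : A ∈ gl S)
    (hB : B ∈ gl S) : A * B ∈ gl S := by
  refine Submodule.span_induction (p := fun A _ => A * B ∈ gl S) ?_ ?_ ?_ ?_ hA
  · rintro _ ⟨i, hi, j, hj, rfl⟩
    refine Submodule.span_induction (p := fun B _ => matUnit i j * B ∈ gl S) ?_ ?_ ?_ ?_ hB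
    · rintro _ ⟨l, hl, n, hn, rfl⟩
      exact matUnit_mul_matUnit i j l n _ (Submodule.subset_span ⟨i, hi, n, hn, rfl⟩)
    · simp
    · intro B C _ _ h1 h2
      rw [mul_add]; exact Submodule.add_mem _ h1 h2
    · intro c B _ h
      rw [mul_smul_comm]; exact Submodule.smul_mem _ c h
  · simp
  · intro B C _ _ h1 h2
    rw [add_mul]; exact Submodule.add_mem _ h1 h2
  · intro c B _ h
    rw [smul_mul_assoc]; exact Submodule.smul_mem _ c h

theorem gl_conj_mem {m : ℕ} (x : LieType) {S : Set (Idx m)} {A : Module.End ℂ (V m)}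
    (hA : A ∈ gl S) : parOp x * A * parOp x ∈ gl S := by
  refine Submodule.span_induction (p := fun A _ => parOp x * A * parOp x ∈ gl S) ?_ ?_ ?_ ?_ hA
  · rintro _ ⟨i, hi, j, hj, rfl⟩
    rw [parOp, diag_mul_matUnit, smul_mul_assoc, matUnit_mul_diag]
    exact Submodule.smul_mem _ _ (Submodule.smul_mem _ _
      (Submodule.subset_span ⟨i, hi, j, hj, rfl⟩))
  · simp
  · intro B C _ _ h1 h2
    rw [mul_add, add_mul]; exact Submodule.add_mem _ h1 h2
  · intro c B _ h
    rw [mul_smul_comm, smul_mul_assoc]; exact Submodule.smul_mem _ c h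

theorem conj_opPart {W : Type*} [AddCommGroup W] [Module ℂ W] {σ : Module.End ℂ W}
    (hσ : σ * σ = 1) (p : ZMod 2) (A : Module.End ℂ W) :
    σ * opPart σ p A * σ = sgn p • opPart σ p A := by
  have h : σ * (σ * A * σ) * σ = A := by
    rw [show σ * (σ * A * σ) * σ = (σ * σ) * A * (σ * σ) by simp only [mul_assoc], hσ]; simp
  rw [opPart, mul_smul_comm, smul_mul_assoc, mul_add, add_mul, mul_smul_comm, smul_mul_assoc, h,
    smul_comm (sgn p), smul_add (sgn p), smul_smul (sgn p), sgn_sq, one_smul, add_comm]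

theorem opPart_of_homog {W : Type*} [AddCommGroup W] [Module ℂ W] {σ : Module.End ℂ W}
    {r : ZMod 2} {C : Module.End ℂ W} (hC : σ * C * σ = sgn r • C) (s : ZMod 2) :
    opPart σ s C = if s = r then C else 0 := by
  rw [opPart, hC, smul_smul]
  have h2 : (2 : ℂ)⁻¹ • (C + C) = C := by
    rw [← two_smul ℂ C, smul_smul]; norm_num
  rcases parity_cases r with rfl | rfl <;> rcases parity_cases s with rfl | rfl <;>
    simp only [sgn_zero, sgn_one] <;> simp [h2, -smul_add]

/-- On homogeneous operators the supercommutator is given by the usual formula. -/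
theorem superBracket_of_homog {W : Type*} [AddCommGroup W] [Module ℂ W] {σ : Module.End ℂ W}
    {p q : ZMod 2} {A B : Module.End ℂ W}
    (hA : σ * A * σ = sgn p • A) (hB : σ * B * σ = sgn q • B) :
    superBracket σ A B = A * B - sgn (p * q) • (B * A) := by
  simp only [superBracket, opPart_of_homog hA, opPart_of_homog hB]
  rw [Finset.sum_eq_single p, Finset.sum_eq_single q]
  · simp
  · intro b _ hb; simp [hb]
  · simp
  · intro b _ hb; simp [hb]
  · simp

theorem opPart_add_opPart {W : Type*} [AddCommGroup W] [Module ℂ W] (σ : Module.End ℂ W)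
    (A : Module.End ℂ W) : ∑ p : ZMod 2, opPart σ p A = A := by
  have h : (∑ p : ZMod 2, opPart σ p A) = opPart σ 0 A + opPart σ 1 A := Fin.sum_univ_two _
  rw [h]
  simp only [opPart, sgn, ← smul_add]
  simp only [if_true, one_smul, one_ne_zero, if_false, neg_smul]
  rw [show A + σ * A * σ + (A + -(σ * A * σ)) = (2 : ℂ) • A by rw [two_smul]; abel, smul_smul]
  norm_num

theorem form_parOp {m : ℕ} (x : LieType) (A : Module.End ℂ (V m)) (p : ZMod 2)
    (h : ∀ i j, form x (A (vec i)) (vec j) + sgn (p * par x i) * form x (vec i) (A (vec j)) = 0)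
    (v w : V m) :
    form x (A v) w + form x (diag (fun i => sgn (p * par x i)) v) (A w) = 0 := by
  have : (form x ∘ₗ A) +
      (form x ∘ₗ diag (fun i => sgn (p * par x i))).compl₂ A = 0 := by
    refine (vBasis m).ext fun i => (vBasis m).ext fun j => ?_
    have h1 := h i j
    have h2 : diag (fun i => sgn (p * par x i)) (vBasis m i)
      = sgn (p * par x i) • vec i := diag_vec _ i
    simp only [LinearMap.comp_apply, LinearMap.add_apply, LinearMap.compl₂_apply,
      h2, map_smul, LinearMap.smul_apply, smul_eq_mul]
    exact h1
  have h3 := congrArg (fun f => f v w) this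
  simpa using h3

theorem conj_mul {W : Type*} [AddCommGroup W] [Module ℂ W] {σ : Module.End ℂ W}
    (hσ : σ * σ = 1) (A B : Module.End ℂ W) :
    σ * (A * B) * σ = (σ * A * σ) * (σ * B * σ) := by
  rw [show (σ * A * σ) * (σ * B * σ) = σ * A * (σ * σ) * B * σ by simp only [mul_assoc], hσ]
  simp [mul_assoc]

theorem preservesForm_iff_homog {m : ℕ} (x : LieType) {A : Module.End ℂ (V m)} {p : ZMod 2}
    (hA : parOp x * A * parOp x = sgn p • A) :
    PreservesForm x A ↔ ∀ i j,
      form x (A (vec i)) (vec j) + sgn (p * par x i) * form x (vec i) (A (vec j)) = 0 := by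
  have key := opPart_of_homog hA
  constructor
  · intro h i j
    simpa [key] using h p i j
  · intro h s i j
    by_cases hs : s = p
    · subst hs
      simpa [key] using h i j
    · simp [key, hs]

theorem opPart_mem_algG {m : ℕ} {x : LieType} {k : Flavor} {A : Module.End ℂ (V m)}
    (hA : A ∈ algG m x k) (p : ZMod 2) : opPart (parOp x) p A ∈ algG m x k := by
  refine ⟨Submodule.smul_mem _ _ (Submodule.add_mem _ hA.1
    (Submodule.smul_mem _ _ (gl_conj_mem x hA.1))), fun hx => ?_⟩
  rw [preservesForm_iff_homog x (conj_opPart (parOp_sq x) p A)]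
  exact hA.2 hx p

/-- The supercommutator of two elements of `𝒢` is in `𝒢`. -/
theorem superBracket_mem_algG {m : ℕ} {x : LieType} {k : Flavor} {A B : Module.End ℂ (V m)}
    (hA : A ∈ algG m x k) (hB : B ∈ algG m x k) :
    superBracket (parOp x) A B ∈ algG m x k := by
  refine Submodule.sum_mem _ fun p _ => Submodule.sum_mem _ fun q _ => ?_
  have hA' := opPart_mem_algG hA p
  have hB' := opPart_mem_algG hB q
  have cA := conj_opPart (parOp_sq x) p A
  have cB := conj_opPart (parOp_sq x) q B
  generalize opPart (parOp x) p A = A' at *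
  generalize opPart (parOp x) q B = B' at *
  have hgl : A' * B' - sgn (p * q) • (B' * A') ∈ gl (natIdx x k) :=

    Submodule.sub_mem _ (gl_mul_mem hA'.1 hB'.1)
      (Submodule.smul_mem _ _ (gl_mul_mem hB'.1 hA'.1))
  refine ⟨hgl, fun hx => ?_⟩
  have hAf := form_parOp x A' p ((preservesForm_iff_homog x cA).1 (hA'.2 hx))
  have hBf := form_parOp x B' q ((preservesForm_iff_homog x cB).1 (hB'.2 hx))
  have hc : parOp x * (A' * B' - sgn (p * q) • (B' * A')) * parOp x
      = sgn (p + q) • (A' * B' - sgn (p * q) • (B' * A')) := by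
    rw [mul_sub, sub_mul, mul_smul_comm, smul_mul_assoc, conj_mul (parOp_sq x),
      conj_mul (parOp_sq x), cA, cB, sgn_add]
    simp only [smul_mul_assoc, mul_smul_comm, smul_smul, smul_sub]
    congr 2
    · ring
    · ring
  rw [preservesForm_iff_homog x hc]
  intro i j
  -- moving a sign operator past a homogeneous operator
  have comm : ∀ (r s : ZMod 2) (C : Module.End ℂ (V m)), parOp x * C * parOp x = sgn s • C →
      diag (fun i => sgn (r * par x i)) (C (vec i))
        = (sgn (r * s) * sgn (r * par x i)) • C (vec i) := by
    intro r s C hC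
    have h0 : ∀ v : V m, parOp x (C v) = sgn s • C (parOp x v) := by
      intro v
      have := congrArg (fun F : Module.End ℂ (V m) => F (parOp x v)) hC
      have h1 : parOp x (parOp x v) = v :=
        congrArg (fun F : Module.End ℂ (V m) => F v) (parOp_sq x)
      simpa [h1] using this
    by_cases hr : r = 0
    · subst hr
      have : diag (fun i : Idx m => sgn (0 * par x i)) = 1 := by
        refine ext_vec fun l => ?_
        simp [diag_vec, sgn]
      rw [this]; simp [sgn]
    · have hr1 : r = 1 := by revert hr; revert r; decide
      subst hr1
      simp only [one_mul]
      have := h0 (vec i)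
      rw [parOp] at this
      rw [this, diag_vec, map_smul, smul_smul]
  have e1 := hAf (B' (vec i)) (vec j)
  have e2 := hBf (A' (vec i)) (vec j)
  have e3 := hBf (vec i) (A' (vec j))
  have e4 := hAf (vec i) (B' (vec j))
  rw [comm p q B' cB] at e1
  rw [comm q p A' cA] at e2
  rw [diag_vec] at e3 e4
  simp only [map_smul, LinearMap.smul_apply, smul_eq_mul, LinearMap.sub_apply, map_sub,
    Module.End.mul_apply, add_mul, sgn_add, mul_comm q p] at e1 e2 e3 e4 ⊢
  have s1 := sgn_sq (p * q)
  linear_combination e1 - sgn (p * q) * e2 - sgn (p * q) * sgn (p * par x i) * e3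
    + sgn (q * par x i) * e4
    + sgn (q * par x i) * form x (A' (vec i)) (B' (vec j)) * s1

theorem bracket_mem {m : ℕ} {x : LieType} {k : Flavor} {X Y : Module.End ℂ (V m) × ℂ}
    (hX : X ∈ algg m x k) (hY : Y ∈ algg m x k) : bracket x X Y ∈ algg m x k :=
  ⟨superBracket_mem_algG hX.1 hY.1, trivial⟩

theorem diag_mul_cartanE {m : ℕ} (x : LieType) (f : Idx m → ℂ) (r : IPlus m) :
    diag f * cartanE x r = cartanE x r * diag f := by
  cases x <;> simp [cartanE, mul_sub, sub_mul, diag_mul_matUnit, matUnit_mul_diag]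

theorem cartanE_even {m : ℕ} (x : LieType) (r : IPlus m) :
    parOp x * cartanE x r * parOp x = sgn 0 • cartanE x r := by
  rw [parOp, diag_mul_cartanE, mul_assoc, ← parOp, parOp_sq, mul_one, sgn_zero, one_smul]

theorem cartanE_mem {m : ℕ} (x : LieType) (k : Flavor) (r : IPlus m) (hr : r ∈ k.idx) :
    cartanE x r ∈ algG m x k := by
  refine ⟨?_, fun hx => ?_⟩
  · have h1 : matUnit (.pos r) (.pos r) ∈ gl (natIdx x k) :=
      Submodule.subset_span ⟨.pos r, hr, .pos r, hr, rfl⟩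
    have h2 : x ≠ .a → matUnit (.bar r) (.bar r) ∈ gl (natIdx x k) := fun hx =>
      Submodule.subset_span ⟨.bar r, ⟨hx, hr⟩, .bar r, ⟨hx, hr⟩, rfl⟩
    cases x
    · exact h1
    all_goals exact Submodule.sub_mem _ h1 (h2 (by simp))
  · rw [preservesForm_iff_homog x (cartanE_even x r)]
    have hc : cartanE x r = matUnit (.pos r) (.pos r) - matUnit (.bar r) (.bar r) := by
      cases x
      · exact absurd rfl hx
      all_goals rfl
    have hf : ∀ i j : Idx m, form x (vec i) (vec j) = formBasis x i j := by
      intro i j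
      simp [form, vec, Module.Basis.constr_basis]
    intro i j
    rw [hc]
    cases i with
    | pos s =>
      cases j with
      | pos t =>
        by_cases h : s = r <;> by_cases h' : t = r <;> simp [matUnit_vec, hf, formBasis, h, h']
      | bar t =>
        by_cases h : s = r <;> by_cases h' : t = r <;>
          simp [matUnit_vec, hf, formBasis, h, h', sgn_zero]
        exact fun h'' => h' h''.symm
      | zero =>
        by_cases h : s = r <;> simp [matUnit_vec, hf, formBasis, h]
    | bar s =>
      cases j with
      | pos t =>
        by_cases h : s = r <;> by_cases h' : t = r <;>
          simp [matUnit_vec, hf, formBasis, h, h', sgn_zero]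
        exact fun h'' => absurd h''.symm h
      | bar t =>
        by_cases h : s = r <;> by_cases h' : t = r <;> simp [matUnit_vec, hf, formBasis, h, h']
      | zero =>
        by_cases h : s = r <;> simp [matUnit_vec, hf, formBasis, h]
    | zero =>
      cases j with
      | pos t =>
        by_cases h' : t = r <;> simp [matUnit_vec, hf, formBasis, h']
      | bar t =>
        by_cases h' : t = r <;> simp [matUnit_vec, hf, formBasis, h']
      | zero =>
        simp [matUnit_vec]

/-- The inclusion of `𝒢` in the central extension `𝔤`, as vector spaces. -/
noncomputable def toAlgg {m : ℕ} {x : LieType} {k : Flavor} (A : algG m x k) : algg m x k :=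
  ⟨(A.1, 0), A.2, trivial⟩

/-- The central element `K`. -/
noncomputable def Kelt {m : ℕ} {x : LieType} {k : Flavor} : algg m x k :=
  ⟨(0, 1), Submodule.zero_mem _, trivial⟩

/-- The Cartan element `E_r` in `𝔤`. -/
noncomputable def Eelt {m : ℕ} {x : LieType} {k : Flavor} (r : IPlus m) (hr : r ∈ k.idx) :
    algg m x k :=
  toAlgg ⟨cartanE x r, cartanE_mem x k r hr⟩

theorem algG_le {m : ℕ} (x : LieType) (k : Flavor) : algG m x k ≤ algG m x .tilde := by
  rintro A ⟨hA, hA'⟩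
  refine ⟨Submodule.span_mono ?_ hA, hA'⟩
  have hle : natIdx x k ⊆ (natIdx x .tilde : Set (Idx m)) := by
    intro i hi
    cases i with
    | pos r => exact trivial
    | bar r => exact ⟨hi.1, trivial⟩
    | zero => exact hi
  rintro _ ⟨i, hi, j, hj, rfl⟩
  exact ⟨i, hle hi, j, hle hj, rfl⟩

/-- The inclusion of the Lie (super)algebra of flavor `k` in the one of flavor `tilde`. -/
noncomputable def inclTilde {m : ℕ} {x : LieType} (k : Flavor) :
    algg m x k →ₗ[ℂ] algg m x .tilde where
  toFun X := ⟨X.1, algG_le x k X.2.1, trivial⟩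
  map_add' _ _ := rfl
  map_smul' _ _ := rfl

theorem inclTilde_apply {m : ℕ} {x : LieType} {k : Flavor} (X : algg m x k) :
    inclTilde k X = ⟨X.1, algG_le x k X.2.1, trivial⟩ := rfl

theorem inclTilde_coe {m : ℕ} {x : LieType} {k : Flavor} (X : algg m x k) :
    (inclTilde k X).1 = X.1 :=
  congrArg Subtype.val (inclTilde_apply X)

theorem isHomog_inclTilde {m : ℕ} {x : LieType} {k : Flavor} {p : ZMod 2} {X : algg m x k}
    (hX : IsHomog x p X.1) : IsHomog x p (inclTilde k X).1 :=
  Eq.subst (motive := fun Z => IsHomog x p Z) (inclTilde_coe X).symm hX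

theorem inclTilde_bracket {m : ℕ} {x : LieType} {k : Flavor} (X Y : algg m x k) :
    inclTilde k ⟨bracket x X.1 Y.1, bracket_mem X.2 Y.2⟩
      = ⟨bracket x (inclTilde k X).1 (inclTilde k Y).1,
          bracket_mem (inclTilde k X).2 (inclTilde k Y).2⟩ :=
  Subtype.ext ((inclTilde_coe _).trans
    (congrArg₂ (bracket x) (inclTilde_coe X).symm (inclTilde_coe Y).symm))

/-! ### Roots and weights -/

/-- Elements of the (restricted) dual of the span of the `E_r`: finite linear combinations of
the `ε_r`. -/
abbrev RootWt (m : ℕ) : Type := IPlus m →₀ ℂ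

/-- The functional `ε_r`. -/
noncomputable def eps {m : ℕ} (r : IPlus m) : RootWt m := Finsupp.single r 1

/-- Weights: `(d, μ)` stands for `d Λ₀ + ∑ μ_r ε_r`, where the sum is finite. -/
abbrev Wt (m : ℕ) : Type := ℂ × RootWt m

/-- The coefficient vector is supported in the index set of flavor `k`; that is, it is
an element of the dual of the Cartan subalgebra of flavor `k`, regarded inside that of the
Cartan subalgebra of flavor `tilde`. -/
def SuppIn {m : ℕ} (k : Flavor) (α : RootWt m) : Prop := ∀ r, α r ≠ 0 → r ∈ k.idx

/-- `s` is the immediate successor of `r` in the index set of flavor `k`. -/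
def Consec {m : ℕ} (k : Flavor) (r s : IPlus m) : Prop :=
  r ∈ k.idx ∧ s ∈ k.idx ∧ r < s ∧ ∀ t ∈ k.idx, ¬ (r < t ∧ t < s)

/-- The simple roots of the Dynkin diagram: the chain of the `ε_r - ε_s` with `r`, `s`
consecutive, and, with `r` the least index and `s` its successor, the root `-ε_r` in
types `b` and `bBullet`, one of the roots `-2ε_r`, `-ε_r - ε_s` in types `c` and `d`. In type `c`
it is the first one if `v_r` is even (always so for `m > 0`) and the second one otherwise, and
in type `d` the other way round. -/
def simpleRoots (m : ℕ) (x : LieType) (k : Flavor) : Set (RootWt m) :=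
  {α | (∃ r s, Consec k r s ∧ α = eps r - eps s) ∨
    (∃ r s, IsLeast k.idx r ∧ Consec k r s ∧
      match x with
      | .a => False
      | .b => α = - eps r
      | .bBullet => α = - eps r
      | .c => if ipar r = 0 then α = - eps r - eps r else α = - eps r - eps s
      | .d => if ipar r = 0 then α = - eps r - eps s else α = - eps r - eps r)}

/-- The simple roots of the tail: the `ε_r - ε_s` with `0 < r < s` consecutive. -/
def tailRoots (m : ℕ) (k : Flavor) : Set (RootWt m) :=
  {α | ∃ r s, 0 < r.1 ∧ Consec k r s ∧ α = eps r - eps s}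

/-- `A` is in the weight space of weight `α` of `𝒢`. -/
def InRootSpace {m : ℕ} (x : LieType) (k : Flavor) (α : RootWt m) (A : Module.End ℂ (V m)) :
    Prop :=
  A ∈ algG m x k ∧ ∀ r ∈ k.idx, superBracket (parOp x) (cartanE x r) A = α r • A

/-- The set of roots. -/
def roots (m : ℕ) (x : LieType) (k : Flavor) : Set (RootWt m) :=
  {α | α ≠ 0 ∧ SuppIn k α ∧ ∃ A, A ≠ 0 ∧ InRootSpace x k α A}

/-- The set of positive roots. -/
def posRoots (m : ℕ) (x : LieType) (k : Flavor) : Set (RootWt m) :=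
  {α | α ∈ roots m x k ∧ α ∈ AddSubmonoid.closure (simpleRoots m x k)}

/-- The roots of the standard Levi subalgebra attached to the tail. -/
def leviRoots (m : ℕ) (x : LieType) (k : Flavor) : Set (RootWt m) :=
  {α | α ∈ roots m x k ∧ α ∈ AddSubgroup.closure (tailRoots m k)}

/-- The standard Levi subalgebra `𝔩` of `𝔤` attached to the tail: it is spanned by the Cartan
subalgebra and the root spaces of the roots that are integral combinations of `tailRoots`. -/
noncomputable def levi (m : ℕ) (x : LieType) (k : Flavor) : Submodule ℂ (algg m x k) :=
  Submodule.span ℂ {X | X = Kelt ∨ (∃ r, ∃ hr : r ∈ k.idx, X = Eelt r hr) ∨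
    ∃ α ∈ leviRoots m x k, InRootSpace x k α X.1.1 ∧ X.1.2 = 0}

/-- The invariant form `⟨A, B⟩`: it is `Str(A B)` in type `a` and `Str(A B) / 2` otherwise. -/
noncomputable def pairing {m : ℕ} (x : LieType) (A B : Module.End ℂ (V m)) : ℂ :=
  match x with
  | .a => str x (A * B)
  | _ => (1 / 2) * str x (A * B)

/-- A choice of root vectors `E_β` (`up β`) and `E^β` (`down β`) of weights `β` and `-β` with
`⟨E_β, E^β⟩ = 1`, for every positive root `β`. -/
structure RootVectors (m : ℕ) (x : LieType) (k : Flavor) where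
  /-- The root vector of weight `β`. -/
  up : posRoots m x k → algG m x k
  /-- The root vector of weight `-β`. -/
  down : posRoots m x k → algG m x k
  up_mem : ∀ β, InRootSpace x k β.1 (up β).1
  down_mem : ∀ β, InRootSpace x k (-β.1) (down β).1
  pairing_eq : ∀ β, pairing x (up β).1 (down β).1 = 1

open Classical in
/-- The parity of a nonzero homogeneous operator on `V m`. -/
noncomputable def parityOf {m : ℕ} (x : LieType) (A : Module.End ℂ (V m)) : ZMod 2 :=
  if parOp x * A * parOp x = A then 0 else 1

/-- The set `Ξ` of weights `d Λ₀ + ∑ μ_r ε_r` (of flavor `k`) whose coefficients `μ_r` with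
`r > 0` are non-negative integers; in type `bBullet` those with `r < 0` are integers. -/
def Xi (m : ℕ) (x : LieType) (k : Flavor) : Set (Wt m) :=
  {μ | SuppIn k μ.2 ∧ (∀ r : IPlus m, 0 < r.1 → ∃ n : ℕ, μ.2 r = n) ∧
    (x = .bBullet → ∀ r : IPlus m, r.1 < 0 → ∃ n : ℤ, μ.2 r = n)}

/-- The sum of coefficients that determines the parity of a weight: over the
proper half-integers, or over the integers in type `bBullet`. -/
noncomputable def paritySum {m : ℕ} (x : LieType) (α : RootWt m) : ℂ :=
  match x with
  | .bBullet => α.sum fun r c => if Even r.1 then c else 0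
  | _ => α.sum fun r c => if Odd r.1 then c else 0

/-- The subset `Ξ(p)` of the weights of parity `p`. -/
def XiPar (m : ℕ) (x : LieType) (k : Flavor) (p : ZMod 2) : Set (Wt m) :=
  {μ | μ ∈ Xi m x k ∧ ∃ n : ℤ, paritySum x μ.2 = n ∧ (n : ZMod 2) = p}

/-- The coefficient of `ε_r`, with `t = 2 r > 0`, in the dominant weight attached to
the partition `Y`: it is `Y_r` for integral `r` in flavor `plain`, the length `Y'_{r+1/2}` of a
column in flavor `bar`, and the modified Frobenius coordinate
`θ(Y)_{i-1/2} = max (Y'_i - i + 1, 0)`, `θ(Y)_i = max (Y_i - i, 0)` in flavor `tilde`. Rows and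
columns are numbered from `0` in `YoungDiagram`, and subtraction is truncated. -/
def domCoeff (k : Flavor) (Y : YoungDiagram) (t : ℕ) : ℕ :=
  match k with
  | .plain => Y.rowLen (t / 2 - 1)
  | .bar => Y.colLen ((t - 1) / 2)
  | .tilde => if Even t then Y.rowLen (t / 2 - 1) - t / 2 else Y.colLen ((t - 1) / 2) - (t - 1) / 2

/-- The set `P⁺` of dominant weights. -/
def domWeights (m : ℕ) (x : LieType) (k : Flavor) : Set (Wt m) :=
  {μ | SuppIn k μ.2 ∧ (x = .bBullet → ∀ r : IPlus m, r.1 < 0 → ∃ n : ℤ, μ.2 r = n) ∧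
    ∃ Y : YoungDiagram, ∀ r : IPlus m, r ∈ k.idx → 0 < r.1 →
      μ.2 r = (domCoeff k Y r.1.toNat : ℂ)}

/-! ### Modules -/

/-- A module over the Lie superalgebra `𝔤` of type `x` and flavor `k`. The `ℤ/2`-grading of `M`
is recorded by the parity involution `σ`, the component of degree `p` being the
eigenspace of `σ` for the eigenvalue `(-1)^p`. -/
structure SuperRep (m : ℕ) (x : LieType) (k : Flavor) (M : Type*) [AddCommGroup M]
    [Module ℂ M] where
  /-- The parity involution. -/
  σ : Module.End ℂ M
  σ_sq : σ * σ = 1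
  /-- The action. -/
  act : algg m x k →ₗ[ℂ] Module.End ℂ M
  act_parity : ∀ (p : ZMod 2) (X : algg m x k), IsHomog x p X.1 →
    σ * act X * σ = sgn p • act X
  act_bracket : ∀ (p q : ZMod 2) (X Y : algg m x k), IsHomog x p X.1 → IsHomog x q Y.1 →
    act ⟨bracket x X.1 Y.1, bracket_mem X.2 Y.2⟩
      = act X * act Y - sgn (p * q) • (act Y * act X)

namespace SuperRep

variable {m : ℕ} {x : LieType} {k : Flavor} {M : Type*} [AddCommGroup M] [Module ℂ M]

/-- The weight space of weight `γ`. -/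
def weightSpace (R : SuperRep m x k M) (γ : Wt m) : Submodule ℂ M where
  carrier := {v | R.act Kelt v = γ.1 • v ∧ ∀ r, ∀ hr : r ∈ k.idx, R.act (Eelt r hr) v = γ.2 r • v}
  zero_mem' := by simp
  add_mem' := by
    rintro v w ⟨h1, h2⟩ ⟨h3, h4⟩
    exact ⟨by rw [map_add, h1, h3, smul_add], fun r hr => by
      rw [map_add, h2 r hr, h4 r hr, smul_add]⟩
  smul_mem' := by
    rintro c v ⟨h1, h2⟩
    exact ⟨by rw [map_smul, h1, smul_comm], fun r hr => by rw [map_smul, h2 r hr, smul_comm]⟩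

/-- The subspace `N` is stable under the Levi subalgebra. -/
def LeviStable (R : SuperRep m x k M) (N : Submodule ℂ M) : Prop :=
  ∀ X ∈ levi m x k, ∀ v ∈ N, R.act X v ∈ N

/-- The subspace `N` is an irreducible highest weight module of highest weight `μ` over
the Levi subalgebra. -/
def IsLeviIrreducible (R : SuperRep m x k M) (μ : Wt m) (N : Submodule ℂ M) : Prop :=
  R.LeviStable N ∧ (∀ N' ≤ N, R.LeviStable N' → N' = ⊥ ∨ N' = N) ∧
    ∃ v ∈ N, v ≠ 0 ∧ v ∈ R.weightSpace μ ∧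
      ∀ α ∈ leviRoots m x k, α ∈ posRoots m x k →
        ∀ A : algG m x k, InRootSpace x k α A.1 → R.act (toAlgg A) v = 0

end SuperRep

/-- An object of the parabolic category `𝒪` of modules over `𝔤` of type `x` and flavor `k`. -/
structure ModO (m : ℕ) (x : LieType) (k : Flavor) (M : Type*) [AddCommGroup M] [Module ℂ M]
    extends SuperRep m x k M where
  semisimple : ⨆ γ : {γ : Wt m // SuppIn k γ.2}, toSuperRep.weightSpace γ.1 = ⊤
  finite_dim : ∀ γ : Wt m, SuppIn k γ.2 → FiniteDimensional ℂ (toSuperRep.weightSpace γ)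
  /-- The module is a direct sum of irreducible modules over the Levi subalgebra, with dominant
  highest weights. -/
  levi_decomp : ∃ S : Set (Submodule ℂ M), sSupIndep S ∧ sSup S = ⊤ ∧
    ∀ N ∈ S, ∃ μ ∈ domWeights m x k, toSuperRep.IsLeviIrreducible μ N
  /-- The weights are bounded by finitely many dominant weights. -/
  bounded : ∃ F : Finset (Wt m), (∀ μ ∈ F, μ ∈ domWeights m x k) ∧
    ∀ γ : Wt m, SuppIn k γ.2 → toSuperRep.weightSpace γ ≠ ⊥ →
      ∃ μ ∈ F, μ.1 = γ.1 ∧ μ.2 - γ.2 ∈ AddSubmonoid.closure (simpleRoots m x k)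
  /-- The grading is the one determined by the weights. -/
  parity : ∀ p : ZMod 2, ∀ γ ∈ XiPar m x k p, ∀ v ∈ toSuperRep.weightSpace γ,
    toSuperRep.σ v = sgn p • v

/-! ### The functors `T` -/

theorem opPart_cartan_comm {m : ℕ} {x : LieType} (r : IPlus m) {A : Module.End ℂ (V m)}
    (hA : cartanE x r * A = A * cartanE x r) (q : ZMod 2) :
    cartanE x r * opPart (parOp x) q A = opPart (parOp x) q A * cartanE x r := by
  have h3 : cartanE x r * parOp x = parOp x * cartanE x r := (diag_mul_cartanE x _ r).symm
  have h4 : cartanE x r * (parOp x * A * parOp x) = parOp x * A * parOp x * cartanE x r := by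
    rw [mul_assoc (parOp x * A), ← h3, ← mul_assoc, ← mul_assoc, h3,
      mul_assoc (parOp x) (cartanE x r), hA]
    simp only [mul_assoc, h3]
  rw [opPart, mul_smul_comm, smul_mul_assoc, mul_add, add_mul, mul_smul_comm,
    smul_mul_assoc, hA, h4]

theorem cartan_bracket_zero {m : ℕ} {x : LieType} (r : IPlus m)
    (hr : r ∈ Flavor.tilde.idx) (X : algg m x .tilde)
    (hX : cartanE x r * X.1.1 = X.1.1 * cartanE x r) :
    superBracket (parOp x) (cartanE x r) X.1.1 = 0 ∧
      bracket x (Eelt (k := .tilde) (x := x) r hr).1 X.1 = 0 := by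
  have h1 : superBracket (parOp x) (cartanE x r) X.1.1 = 0 := by
    have h0 : ∀ p : ZMod 2, opPart (parOp x) p (cartanE x r) = if p = 0 then cartanE x r else 0 :=
      fun p => opPart_of_homog (cartanE_even x r) p
    have h2 := opPart_cartan_comm r hX
    refine Finset.sum_eq_zero fun p _ => Finset.sum_eq_zero fun q _ => ?_
    rw [h0]
    by_cases hp : p = 0
    · subst hp
      simp [sgn_zero, h2]
    · simp [hp]
  have h5 : superBracket (parOp x) (J m) (cartanE x r) = 0 := by
    have hJ : parOp x * J m * parOp x = sgn 0 • J m := by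
      have : parOp x * J m = J m * parOp x := by
        refine ext_vec fun i => ?_
        simp [J, parOp, diag_vec, smul_smul, mul_comm]
      rw [this, mul_assoc, parOp_sq, mul_one, sgn_zero, one_smul]
    rw [superBracket_of_homog hJ (cartanE_even x r), J, diag_mul_cartanE]
    simp [sgn_zero]
  refine ⟨h1, ?_⟩
  refine Prod.ext h1 ?_
  have h6 : cocycle x (cartanE x r) X.1.1 = 0 := by
    rw [cocycle, h5]
    simp [str]
  exact h6

namespace SuperRep

variable {m : ℕ} {x : LieType} {M : Type*} [AddCommGroup M] [Module ℂ M]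

theorem isHomog_part (p : ZMod 2) {k : Flavor} (X : algg m x k) :
    ∃ Y : algg m x k, IsHomog x p Y.1 ∧ Y.1.1 = opPart (parOp x) p X.1.1 ∧
      Y.1.2 = (1 / 2 : ℂ) * (X.1.2 + sgn p * X.1.2) := by
  refine ⟨⟨(opPart (parOp x) p X.1.1, (1 / 2 : ℂ) * (X.1.2 + sgn p * X.1.2)),
    opPart_mem_algG X.2.1 p, trivial⟩, ⟨conj_opPart (parOp_sq x) p _, ?_⟩, rfl, rfl⟩
  have := sgn_sq p
  simp only [smul_eq_mul]
  linear_combination (-(1 / 2 : ℂ) * X.1.2) * this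

/-- An element that commutes with `E_r` acts by an operator that commutes with that of `E_r`. -/
theorem act_comm (R : SuperRep m x .tilde M) (r : IPlus m) (hr : r ∈ Flavor.tilde.idx)
    (X : algg m x .tilde) (hX : cartanE x r * X.1.1 = X.1.1 * cartanE x r) :
    R.act (Eelt r hr) * R.act X = R.act X * R.act (Eelt r hr) := by
  have hE : IsHomog x 0 (Eelt (k := .tilde) (x := x) r hr).1 :=
    ⟨cartanE_even x r, by simp [sgn_zero]⟩
  have hom : ∀ p : ZMod 2, ∀ Y : algg m x .tilde, IsHomog x p Y.1 →
      cartanE x r * Y.1.1 = Y.1.1 * cartanE x r →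
      R.act (Eelt r hr) * R.act Y = R.act Y * R.act (Eelt r hr) := by
    intro p Y hY hc
    have h := R.act_bracket 0 p (Eelt r hr) Y hE hY
    have h0 := (cartan_bracket_zero r hr Y hc).2
    have h1 : (⟨bracket x (Eelt (k := .tilde) (x := x) r hr).1 Y.1,
        bracket_mem (Eelt r hr).2 Y.2⟩ : algg m x .tilde) = 0 := Subtype.ext h0
    rw [h1, map_zero, zero_mul, sgn_zero, one_smul] at h
    exact (sub_eq_zero.1 h.symm)
  obtain ⟨Y0, hY0, e0, f0⟩ := isHomog_part 0 X
  obtain ⟨Y1, hY1, e1, f1⟩ := isHomog_part 1 X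
  have hsum : X = Y0 + Y1 := by
    refine Subtype.ext (Prod.ext ?_ ?_)
    · have h : (∑ p : ZMod 2, opPart (parOp x) p X.1.1)
        = opPart (parOp x) 0 X.1.1 + opPart (parOp x) 1 X.1.1 := Fin.sum_univ_two _
      change X.1.1 = Y0.1.1 + Y1.1.1
      rw [e0, e1, ← h, opPart_add_opPart]
    · change X.1.2 = Y0.1.2 + Y1.1.2
      rw [f0, f1, sgn_zero, sgn_one]
      ring
  have comm := opPart_cartan_comm r hX
  rw [hsum, map_add, mul_add, add_mul, hom 0 Y0 hY0 (by rw [e0, comm]),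
    hom 1 Y1 hY1 (by rw [e1, comm])]

theorem act_σ_comm (R : SuperRep m x .tilde M) (r : IPlus m) (hr : r ∈ Flavor.tilde.idx) :
    R.act (Eelt r hr) * R.σ = R.σ * R.act (Eelt r hr) := by
  have hE : IsHomog x 0 (Eelt (k := .tilde) (x := x) r hr).1 :=
    ⟨cartanE_even x r, by simp [sgn_zero]⟩
  have h := R.act_parity 0 (Eelt r hr) hE
  rw [sgn_zero, one_smul] at h
  calc R.act (Eelt r hr) * R.σ = (R.σ * R.σ) * (R.act (Eelt r hr) * R.σ) := by
        rw [R.σ_sq, one_mul]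
    _ = R.σ * (R.σ * R.act (Eelt r hr) * R.σ) := by simp only [mul_assoc]
    _ = R.σ * R.act (Eelt r hr) := by rw [h]

theorem cartan_comm (R : SuperRep m x .tilde M) (r s : IPlus m) (hr : r ∈ Flavor.tilde.idx)
    (hs : s ∈ Flavor.tilde.idx) :
    R.act (Eelt r hr) * R.act (Eelt s hs) = R.act (Eelt s hs) * R.act (Eelt r hr) := by
  refine R.act_comm r hr (Eelt s hs) ?_
  have hd : ∀ t : IPlus m, ∃ f : Idx m → ℂ, cartanE x t = diag f := by
    classical
    intro t
    refine ⟨fun i => match i with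
      | .pos u => if u = t then 1 else 0
      | .bar u => if x = .a then 0 else if u = t then -1 else 0
      | .zero => 0, ext_vec fun i => ?_⟩
    cases x <;> cases i with
    | pos u => by_cases h : u = t <;> simp [cartanE, matUnit_vec, diag_vec, h]
    | bar u => by_cases h : u = t <;> simp [cartanE, matUnit_vec, diag_vec, h]
    | zero => simp [cartanE, matUnit_vec, diag_vec]
  obtain ⟨f, hf⟩ := hd r
  change cartanE x r * cartanE x s = cartanE x s * cartanE x r
  rw [hf, diag_mul_cartanE]

/-- Weight spaces of different weights are independent. -/
theorem weightSpace_indep (R : SuperRep m x .tilde M) : iSupIndep R.weightSpace := by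
  let f : Option (IPlus m) → Module.End ℂ M := fun o => match o with
    | none => R.act Kelt
    | some r => R.act (Eelt r trivial)
  have hK : ∀ r, R.act (Eelt r trivial) * R.act Kelt = R.act Kelt * R.act (Eelt r trivial) := by
    intro r
    refine R.act_comm r trivial Kelt ?_
    simp [Kelt]
  have hcomm : ∀ i j, Commute (f i) (f j) := by
    intro i j
    cases i <;> cases j
    · exact Commute.refl _
    · exact (hK _).symm
    · exact hK _
    · exact R.cartan_comm _ _ _ _
  have h := Module.End.independent_iInf_maxGenEigenspace_of_forall_mapsTo f
    (fun i j φ => Module.End.mapsTo_maxGenEigenspace_of_comm (hcomm j i) φ)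
  let g : Wt m → Option (IPlus m) → ℂ := fun γ o => match o with
    | none => γ.1
    | some r => γ.2 r
  have hg : Function.Injective g := by
    intro γ δ hγ
    refine Prod.ext (congrFun hγ none) (Finsupp.ext fun r => congrFun hγ (some r))
  refine (h.comp hg).mono ?_
  intro γ v hv
  simp only [Function.comp_apply, Submodule.mem_iInf]
  intro o
  have hv' : v ∈ (f o).eigenspace (g γ o) := by
    rw [Module.End.mem_eigenspace_iff]
    cases o with
    | none => exact hv.1
    | some r => exact hv.2 r trivial
  exact (Module.End.genEigenspace (f o) (g γ o)).mono le_top hv'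

end SuperRep

namespace ModO

variable {m : ℕ} {x : LieType} {M : Type*} [AddCommGroup M] [Module ℂ M]

/-- The sum of the weight spaces whose weights are in the dual of the Cartan
subalgebra of flavor `k`: the underlying space of `T(M)` for `k = plain`, and of the
analogue of `T(M)` with a bar for `k = bar`. -/
def tPart (R : ModO m x .tilde M) (k : Flavor) : Submodule ℂ M :=
  ⨆ γ ∈ {γ : Wt m | SuppIn k γ.2}, R.weightSpace γ

/-- The sum of the other weight spaces. -/
def tRest (R : ModO m x .tilde M) (k : Flavor) : Submodule ℂ M :=
  ⨆ γ ∈ {γ : Wt m | SuppIn k γ.2}ᶜ, R.weightSpace γ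

theorem iSup_weightSpace (R : ModO m x .tilde M) : ⨆ γ : Wt m, R.weightSpace γ = ⊤ := by
  refine top_le_iff.1 (R.semisimple ▸ iSup_le fun γ => ?_)
  exact le_iSup (fun γ => R.weightSpace γ) γ.1

theorem isCompl_tPart (R : ModO m x .tilde M) (k : Flavor) : IsCompl (R.tPart k) (R.tRest k) := by
  refine ⟨R.weightSpace_indep.disjoint_biSup_biSup disjoint_compl_right, ?_⟩
  rw [codisjoint_iff_le_sup, ← R.iSup_weightSpace]
  refine iSup_le fun γ => ?_
  by_cases hγ : SuppIn k γ.2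
  · exact le_sup_of_le_left (le_biSup (fun γ => R.weightSpace γ) hγ)
  · exact le_sup_of_le_right (le_biSup (fun γ => R.weightSpace γ)
      (i := γ) (s := {γ : Wt m | SuppIn k γ.2}ᶜ) hγ)

theorem mem_tPart_iff (R : ModO m x .tilde M) (k : Flavor) (v : M) :
    v ∈ R.tPart k ↔ ∀ r, r ∉ k.idx → R.act (Eelt r trivial) v = 0 := by
  classical
  constructor
  · intro hv r hr
    have hle : R.tPart k ≤ LinearMap.ker (R.act (Eelt r trivial)) := by
      refine iSup₂_le fun γ hγ v hv => ?_
      rw [LinearMap.mem_ker, hv.2 r trivial]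
      have : γ.2 r = 0 := by
        by_contra h
        exact hr (hγ r h)
      rw [this, zero_smul]
    exact hle hv
  · intro hv
    have hmem : v ∈ ⨆ γ : Wt m, R.weightSpace γ := by rw [R.iSup_weightSpace]; trivial
    obtain ⟨f, hf⟩ := (Submodule.mem_iSup_iff_exists_dfinsupp _ _).1 hmem
    have hinj := R.weightSpace_indep.dfinsupp_lsum_injective
    have hzero : ∀ γ : Wt m, ¬ SuppIn k γ.2 → f γ = 0 := by
      intro γ hγ
      simp only [SuppIn, not_forall] at hγ
      obtain ⟨r, hr0, hr⟩ := hγ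
      let g : Π₀ γ : Wt m, R.weightSpace γ :=
        DFinsupp.mapRange (fun γ (v : R.weightSpace γ) => γ.2 r • v) (fun γ => smul_zero _) f
      have hg : DFinsupp.lsum ℕ (fun γ => (R.weightSpace γ).subtype) g = 0 := by
        rw [← hv r hr, ← hf]
        simp only [g]
        rw [DFinsupp.lsum_apply_apply, DFinsupp.lsum_apply_apply,
          DFinsupp.sumAddHom_apply, DFinsupp.sumAddHom_apply]
        rw [DFinsupp.sum_mapRange_index (by simp)]
        simp only [DFinsupp.sum, map_sum]
        refine Finset.sum_congr rfl fun δ _ => ?_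
        have := (f δ).2.2 r trivial
        simpa using this.symm
      have h0 : g = 0 := hinj (by rw [hg, map_zero])
      have h1 : γ.2 r • f γ = 0 := by
        have := DFunLike.congr_fun h0 γ
        simpa [g] using this
      exact (smul_eq_zero.1 h1).resolve_left hr0
    rw [← hf, DFinsupp.lsum_apply_apply, DFinsupp.sumAddHom_apply]
    refine Submodule.sum_mem _ fun γ hγ => ?_
    have hs : SuppIn k γ.2 := by
      by_contra h
      exact (DFinsupp.mem_support_iff.1 hγ) (hzero γ h)
    exact (le_biSup (fun γ => R.weightSpace γ) (s := {γ : Wt m | SuppIn k γ.2}) hs) (f γ).2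

theorem cartan_mul_eq_zero {k : Flavor} {A : Module.End ℂ (V m)} (hA : A ∈ gl (natIdx x k))
    (r : IPlus m) (hr : r ∉ k.idx) : cartanE x r * A = 0 ∧ A * cartanE x r = 0 := by
  have key : ∀ i ∈ (natIdx x k : Set (Idx m)), cartanE x r (vec i) = 0 := by
    intro i hi
    cases i with
    | pos s =>
      have h : s ≠ r := fun h => hr (h ▸ hi)
      cases x <;> simp [cartanE, matUnit_vec, h]
    | bar s =>
      have h : s ≠ r := fun h => hr (h ▸ hi.2)
      cases x <;> simp [cartanE, matUnit_vec, h]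
    | zero => cases x <;> simp [cartanE, matUnit_vec]
  refine ⟨?_, ?_⟩
  · refine Submodule.span_induction (p := fun A _ => cartanE x r * A = 0) ?_ ?_ ?_ ?_ hA
    · rintro _ ⟨i, hi, j, hj, rfl⟩
      refine ext_vec fun l => ?_
      by_cases h : l = j <;> simp [matUnit_vec, h, key i hi]
    · simp
    · intro A B _ _ h1 h2
      rw [mul_add, h1, h2, add_zero]
    · intro c A _ h
      rw [mul_smul_comm, h, smul_zero]
  · refine Submodule.span_induction (p := fun A _ => A * cartanE x r = 0) ?_ ?_ ?_ ?_ hA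
    · rintro _ ⟨i, hi, j, hj, rfl⟩
      have h0 : (Idx.pos r) ≠ j := by
        rintro rfl
        exact hr hj
      have h1 : x ≠ .a → (Idx.bar r) ≠ j := by
        rintro hx rfl
        exact hr hj.2
      refine ext_vec fun l => ?_
      have e0 : matUnit i j (vec (Idx.pos r)) = 0 := by simp [matUnit_vec, h0]
      have e1 : x ≠ .a → matUnit i j (vec (Idx.bar r)) = 0 := fun hx => by
        simp [matUnit_vec, h1 hx]
      have e2 : ∀ s : Idx m, matUnit i j (matUnit (Idx.pos r) s (vec l)) = 0 := by
        intro s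
        by_cases h : l = s <;> simp [matUnit_vec (Idx.pos r), h, e0]
      have e3 : x ≠ .a → ∀ s : Idx m, matUnit i j (matUnit (Idx.bar r) s (vec l)) = 0 := by
        intro hx s
        by_cases h : l = s <;> simp [matUnit_vec (Idx.bar r), h, e1 hx]
      cases x
      · simp [cartanE, e2]
      all_goals
        simp [cartanE, e2, e3]
    · simp
    · intro A B _ _ h1 h2
      rw [add_mul, h1, h2, add_zero]
    · intro c A _ h
      rw [smul_mul_assoc, h, smul_zero]

theorem act_mem_tPart (R : ModO m x .tilde M) (k : Flavor) (X : algg m x k) (v : M)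
    (hv : v ∈ R.tPart k) : R.act (inclTilde k X) v ∈ R.tPart k := by
  rw [mem_tPart_iff] at hv ⊢
  intro r hr
  have h := R.act_comm r trivial (inclTilde k X) (by
    have := cartan_mul_eq_zero (x := x) X.2.1.1 r hr
    rw [inclTilde_coe, this.1, this.2])
  have h1 := congrArg (fun F : Module.End ℂ M => F v) h
  simp only [Module.End.mul_apply] at h1
  rw [h1, hv r hr, map_zero]

theorem σ_mem_tPart (R : ModO m x .tilde M) (k : Flavor) (v : M)
    (hv : v ∈ R.tPart k) : R.σ v ∈ R.tPart k := by
  rw [mem_tPart_iff] at hv ⊢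
  intro r hr
  have h1 := congrArg (fun F : Module.End ℂ M => F v) (R.act_σ_comm r trivial)
  simp only [Module.End.mul_apply] at h1
  rw [h1, hv r hr, map_zero]

theorem restrict_conj {W : Type*} [AddCommGroup W] [Module ℂ W] {N : Submodule ℂ W}
    {S A : Module.End ℂ W} (hS : ∀ v ∈ N, S v ∈ N) (hA : ∀ v ∈ N, A v ∈ N) (s : ℂ)
    (h : S * A * S = s • A) :
    S.restrict hS * A.restrict hA * S.restrict hS = s • A.restrict hA := by
  refine LinearMap.ext fun v => Subtype.ext ?_
  have := congrArg (fun F : Module.End ℂ W => F v) h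
  simpa using this

theorem restrict_bracket {W : Type*} [AddCommGroup W] [Module ℂ W] {N : Submodule ℂ W}
    {A B C : Module.End ℂ W} (hA : ∀ v ∈ N, A v ∈ N) (hB : ∀ v ∈ N, B v ∈ N)
    (hC : ∀ v ∈ N, C v ∈ N) (s : ℂ) (h : C = A * B - s • (B * A)) :
    C.restrict hC = A.restrict hA * B.restrict hB - s • (B.restrict hB * A.restrict hA) := by
  refine LinearMap.ext fun v => Subtype.ext ?_
  have := congrArg (fun F : Module.End ℂ W => F v) h
  simpa using this

theorem restrict_sq {W : Type*} [AddCommGroup W] [Module ℂ W] {N : Submodule ℂ W}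
    {S : Module.End ℂ W} (hS : ∀ v ∈ N, S v ∈ N) (h : S * S = 1) :
    S.restrict hS * S.restrict hS = 1 := by
  refine LinearMap.ext fun v => Subtype.ext ?_
  have := congrArg (fun F : Module.End ℂ W => F v) h
  simpa using this

theorem T_bracket (R : ModO m x .tilde M) (k : Flavor) (p q : ZMod 2) (X Y : algg m x k)
    (hX : IsHomog x p X.1) (hY : IsHomog x q Y.1) :
    R.act (inclTilde k ⟨bracket x X.1 Y.1, bracket_mem X.2 Y.2⟩)
      = R.act (inclTilde k X) * R.act (inclTilde k Y)
        - sgn (p * q) • (R.act (inclTilde k Y) * R.act (inclTilde k X)) := by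
  rw [inclTilde_bracket]
  exact R.act_bracket p q (inclTilde k X) (inclTilde k Y) (isHomog_inclTilde hX)
    (isHomog_inclTilde hY)

/-- The module `T(M)` (for `k = plain`, or its analogue for `k = bar`): the sum of the weight
spaces whose weights are in the dual of the Cartan subalgebra of flavor `k`, with the
restricted action of the subalgebra of flavor `k` and the restricted grading. -/
noncomputable def T (R : ModO m x .tilde M) (k : Flavor) : SuperRep m x k (R.tPart k) where
  σ := R.σ.restrict (R.σ_mem_tPart k)
  σ_sq := restrict_sq _ R.σ_sq
  act :=
    { toFun := fun X => (R.act (inclTilde k X)).restrict (R.act_mem_tPart k X)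
      map_add' := fun X Y => by
        refine LinearMap.ext fun v => Subtype.ext ?_
        simp [LinearMap.restrict_apply]
      map_smul' := fun c X => by
        refine LinearMap.ext fun v => Subtype.ext ?_
        simp [LinearMap.restrict_apply] }
  act_parity := fun p X hX =>
    restrict_conj (R.σ_mem_tPart k) (R.act_mem_tPart k X) _ (R.act_parity p (inclTilde k X)
      (isHomog_inclTilde hX))
  act_bracket := fun p q X Y hX hY =>
    restrict_bracket (R.act_mem_tPart k X) (R.act_mem_tPart k Y) (R.act_mem_tPart k _) _ (R.T_bracket k p q X Y hX hY)

/-- The projection of `M` to `T(M)` along the other weight spaces. -/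
noncomputable def proj (R : ModO m x .tilde M) (k : Flavor) : M →ₗ[ℂ] R.tPart k :=
  (R.tPart k).projectionOnto (R.tRest k) (R.isCompl_tPart k)

end ModO

/-! ### Tensor products and Casimir tensors -/

section Tensor

variable {m : ℕ} {x : LieType} {k : Flavor} {ℓ : ℕ} {M : Fin ℓ → Type*}
  [∀ i, AddCommGroup (M i)] [∀ i, Module ℂ (M i)]

/-- The operator `A^{(i)} = 1 ⊗ ⋯ ⊗ A ⊗ ⋯ ⊗ 1` on a tensor product of super vector
spaces with parity involutions `σ`. For homogeneous `A` the sign rule gives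
`A^{(i)} (v_1 ⊗ ⋯ ⊗ v_ℓ) = (-1)^{|A| (|v_1| + ⋯ + |v_{i-1}|)} v_1 ⊗ ⋯ ⊗ A v_i ⊗ ⋯ ⊗ v_ℓ`. -/
noncomputable def factorOp (σ : ∀ i, Module.End ℂ (M i)) (i : Fin ℓ) (A : Module.End ℂ (M i)) :
    Module.End ℂ (⨂[ℂ] i, M i) :=
  ∑ p : ZMod 2, PiTensorProduct.map
    (Function.update (fun j => if j < i then σ j ^ p.val else 1) i (opPart (σ i) p A))

/-- The operator `X^{(i)}` on the tensor product, for `X` in `𝔤`. -/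
noncomputable def actAt (R : ∀ i, SuperRep m x k (M i)) (i : Fin ℓ) (X : algg m x k) :
    Module.End ℂ (⨂[ℂ] i, M i) :=
  factorOp (fun j => (R j).σ) i ((R i).act X)

/-- The weight space of weight `γ` in the tensor product. -/
def tensorWeightSpace (R : ∀ i, SuperRep m x k (M i)) (γ : Wt m) :
    Set (⨂[ℂ] i, M i) :=
  {v | (∑ i, actAt R i Kelt v) = γ.1 • v ∧
    ∀ r, ∀ hr : r ∈ k.idx, (∑ i, actAt R i (Eelt r hr) v) = γ.2 r • v}

/-- The operator `Ω^{(ij)}` given by the Casimir symmetric tensor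
`∑_β (E^β ⊗ E_β + (-1)^{|E_β|} E_β ⊗ E^β)
  + ∑_r (-1)^{2r} (E_r ⊗ E_r - (-1)^{2r} δ_r (K ⊗ E_r + E_r ⊗ K))`.
On each vector only finitely many terms of the two sums are nonzero. -/
noncomputable def casimir (B : RootVectors m x k) (R : ∀ i, SuperRep m x k (M i))
    (i j : Fin ℓ) (v : ⨂[ℂ] i, M i) : ⨂[ℂ] i, M i :=
  (∑ᶠ β : posRoots m x k,
    (actAt R i (toAlgg (B.down β)) (actAt R j (toAlgg (B.up β)) v)
      + sgn (parityOf x (B.up β).1) •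
        actAt R i (toAlgg (B.up β)) (actAt R j (toAlgg (B.down β)) v)))
  + ∑ᶠ r : (k.idx : Set (IPlus m)),
    sgn (ipar r.1) • (actAt R i (Eelt r.1 r.2) (actAt R j (Eelt r.1 r.2) v)
      - (sgn (ipar r.1) * delta r.1) •
        (actAt R i Kelt (actAt R j (Eelt r.1 r.2) v)
          + actAt R i (Eelt r.1 r.2) (actAt R j Kelt v)))

/-! ### The (super) KZ equations -/

/-- The configuration space of `ℓ` distinct points in `ℂ`. -/
def config (ℓ : ℕ) : Set (Fin ℓ → ℂ) := {z | Function.Injective z}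

/-- The set `𝒟(U, W)` of (holomorphic) differentiable functions on `U` with values in
a finite-dimensional subspace `W` of a vector space; differentiability is
tested on linear functionals. Only the values on `U` matter. -/
def diffFun {N : Type*} [AddCommGroup N] [Module ℂ N] (U : Set (Fin ℓ → ℂ)) (W : Set N) :
    Set ((Fin ℓ → ℂ) → N) :=
  {ψ | (∀ z ∈ U, ψ z ∈ W) ∧
    ∀ φ : Module.Dual ℂ N, DifferentiableOn ℂ (fun z => φ (ψ z)) U}

/-- `w` is the partial derivative `∂ψ/∂z_i` at `z`. -/
def IsPartialDeriv {N : Type*} [AddCommGroup N] [Module ℂ N] (ψ : (Fin ℓ → ℂ) → N) (i : Fin ℓ)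
    (z : Fin ℓ → ℂ) (w : N) : Prop :=
  ∀ φ : Module.Dual ℂ N, HasDerivAt (fun t : ℂ => φ (ψ (Function.update z i t))) (φ w) (z i)

/-- The Gaudin Hamiltonian `∑_{j ≠ i} Ω^{(ij)} / (z_i - z_j)` at the point `z`. -/
noncomputable def gaudin (B : RootVectors m x k) (R : ∀ i, SuperRep m x k (M i)) (i : Fin ℓ)
    (z : Fin ℓ → ℂ) (v : ⨂[ℂ] i, M i) : ⨂[ℂ] i, M i :=
  ∑ j ∈ Finset.univ.erase i, (z i - z j)⁻¹ • casimir B R i j v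

/-- The set of solutions on `U`, of weight `μ`, of the (super) KZ equations
`κ ∂ψ/∂z_i = ∑_{j ≠ i} Ω^{(ij)} ψ / (z_i - z_j)`, `i = 1, …, ℓ`. -/
def KZ (κ : ℂ) (U : Set (Fin ℓ → ℂ)) (B : RootVectors m x k) (R : ∀ i, SuperRep m x k (M i))
    (μ : Wt m) : Set ((Fin ℓ → ℂ) → ⨂[ℂ] i, M i) :=
  {ψ | ψ ∈ diffFun U (tensorWeightSpace R μ) ∧
    ∀ i, ∀ z ∈ U, ∃ w, IsPartialDeriv ψ i z w ∧ κ • w = gaudin B R i z (ψ z)}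

/-- The modules underlying a family of objects of `𝒪`. -/
def reps (R : ∀ i, ModO m x k (M i)) : ∀ i, SuperRep m x k (M i) :=
  fun i => (R i).toSuperRep

/-- The modules obtained from a family of objects of `𝒪` of flavor `tilde` by `T`. -/
noncomputable def repsT (k : Flavor) (R : ∀ i, ModO m x .tilde (M i)) :
    ∀ i, SuperRep m x k ((R i).tPart k) :=
  fun i => (R i).T k

/-- The map `T` from the tensor product of the `M_i` to the tensor product of the `T(M_i)`, which
is `T` of the former: it is the projection along the weight spaces of the other weights. -/
noncomputable def tensorT (k : Flavor) (R : ∀ i, ModO m x .tilde (M i)) :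
    (⨂[ℂ] i, M i) →ₗ[ℂ] ⨂[ℂ] i, (R i).tPart k :=
  PiTensorProduct.map fun i => (R i).proj k

/-- The inclusion of the tensor product of the `T(M_i)` in the tensor product of the `M_i`. -/
noncomputable def tensorIncl (k : Flavor) (R : ∀ i, ModO m x .tilde (M i)) :
    (⨂[ℂ] i, (R i).tPart k) →ₗ[ℂ] ⨂[ℂ] i, M i :=
  PiTensorProduct.map fun i => ((R i).tPart k).subtype

/-- The function `Tψ`. -/
noncomputable def funT (k : Flavor) (R : ∀ i, ModO m x .tilde (M i))
    (ψ : (Fin ℓ → ℂ) → ⨂[ℂ] i, M i) : (Fin ℓ → ℂ) → ⨂[ℂ] i, (R i).tPart k :=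
  fun z => tensorT k R (ψ z)

end Tensor

end SuperKZ

open SuperKZ

namespace SuperKZ

/-! ### Actions of matrix units -/

/-! The mechanism is that every `E_r` with `r > 0` acts on an object of the big category
diagonalizably with eigenvalues in the natural numbers (`ModO.iSup_eigenspace_eq_top`). Everything
else follows from this positivity.

Let `r` be a positive index missing from the subalgebra. If a tensor has weight `μ` with `μ_r = 0`,
then the coefficients at `r` of its factors are natural numbers with sum zero, so each of them
vanishes; hence the tensor lies in the tensor product of the truncated modules
(`tensorIncl_tensorT`). If a positive root `β` involves such an `r`, one of `E_β`, `E^β` lowers the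
coefficient at `r`. On a truncated module this coefficient is zero, so that root vector acts by zero
(`ModO.act_tPart_eq_zero`), and both terms of the Casimir tensor at `β` vanish. The Cartan terms at
`r` vanish as well. The remaining positive roots are exactly those of the subalgebra
(`mem_posRoots_iff_tilde`), and since root spaces are lines and the pairings are normalised, their
terms do not depend on the chosen root vectors (`RootVectors.exists_smul`). So the two Casimir
operators agree (`casimir_tensorIncl`), and the KZ equations are carried into each other by the
mutually inverse maps `tensorT` and `tensorIncl`.

Positivity is a statement about irreducible highest weight modules of the tail, a general linear
superalgebra of type `(∞|∞)` whose two families of indices alternate. The highest weight comes from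
a partition in modified Frobenius coordinates. Odd reflections change the order of the indices; each
one moves a single cell of the diagram from a row coordinate to a column coordinate, or does
nothing. After finitely many reflections the nonzero columns stand in front, and every index of the
row family has weight zero (`GLAction.exists_shuffle_front`). The resulting extremal vector is
annihilated by the whole column `r` of matrix units, the other matrix units generate the module from
it, and none of those lowers the eigenvalue of `E_r` (`GLAction.le_iSup_eigenspace_of_column`). -/

/-- Operators `e a b` on a vector space which satisfy the supercommutation relations of the matrix
units of a general linear Lie superalgebra with basis indexed by `T`. -/
structure GLAction (T W : Type*) [DecidableEq T] [AddCommGroup W] [Module ℂ W] where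
  /-- The parity of an index. -/
  par : T → ZMod 2
  /-- The operator given by a matrix unit. -/
  e : T → T → Module.End ℂ W
  comm : ∀ a b c d u, e a b (e c d u) =
    sgn ((par a + par b) * (par c + par d)) • e c d (e a b u) + (if b = c then e a d u else 0)
      - (if a = d then sgn ((par a + par b) * (par c + par d)) • e c b u else 0)

namespace GLAction

variable {T W : Type*} [DecidableEq T] [AddCommGroup W] [Module ℂ W] (X : GLAction T W)

/-- The subspace `D` is stable under all matrix units. -/
def Stable (D : Submodule ℂ W) : Prop := ∀ a b, ∀ u ∈ D, X.e a b u ∈ D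

/-- The subspace generated by `w` under the matrix units indexed by `G`. -/
def genSpan (G : T → T → Prop) (w : W) : Submodule ℂ W :=
  sInf {D | w ∈ D ∧ ∀ c d, G c d → ∀ u ∈ D, X.e c d u ∈ D}

theorem genSpan_le {G : T → T → Prop} {w : W} {D : Submodule ℂ W} (hw : w ∈ D)
    (hD : ∀ c d, G c d → ∀ u ∈ D, X.e c d u ∈ D) : X.genSpan G w ≤ D :=
  sInf_le ⟨hw, hD⟩

theorem mem_genSpan (G : T → T → Prop) (w : W) : w ∈ X.genSpan G w :=
  Submodule.mem_sInf.2 fun _ hD => hD.1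

theorem e_mem_genSpan {G : T → T → Prop} {w : W} {c d : T} (h : G c d) {u : W}
    (hu : u ∈ X.genSpan G w) : X.e c d u ∈ X.genSpan G w :=
  Submodule.mem_sInf.2 fun D hD => hD.2 c d h u (Submodule.mem_sInf.1 hu D hD)

/-- The vectors of the span that all matrix units map back into it form a subspace. It contains `w`
by hypothesis, and the commutation relations show that it is closed under the units in `G`, so it is
everything. -/
theorem stable_genSpan {G : T → T → Prop} {w : W}
    (h : ∀ a b, X.e a b w ∈ X.genSpan G w) : X.Stable (X.genSpan G w) := by
  have hle : X.genSpan G w ≤ X.genSpan G w ⊓ ⨅ a, ⨅ b, (X.genSpan G w).comap (X.e a b) := by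
    refine X.genSpan_le ⟨X.mem_genSpan G w, ?_⟩ ?_
    · simpa [Submodule.mem_iInf] using h
    · rintro c d hcd u ⟨hu, hu'⟩
      refine ⟨X.e_mem_genSpan hcd hu, ?_⟩
      simp only [Submodule.coe_iInf, Submodule.comap_coe, Set.mem_iInter, Set.mem_preimage,
        SetLike.mem_coe] at hu' ⊢
      intro a b
      rw [X.comm]
      refine Submodule.sub_mem _ (Submodule.add_mem _ (Submodule.smul_mem _ _
        (X.e_mem_genSpan hcd (hu' a b))) ?_) ?_
      · split_ifs
        exacts [hu' a d, Submodule.zero_mem _]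
      · split_ifs
        exacts [Submodule.smul_mem _ _ (hu' c b), Submodule.zero_mem _]
  intro a b u hu
  have := (hle hu).2
  simp only [Submodule.coe_iInf, Submodule.comap_coe, Set.mem_iInter, Set.mem_preimage,
    SetLike.mem_coe] at this
  exact this a b

/-- If the matrix units in `G` shift the eigenvalues of `H` by multiples of `s`, so does every
vector generated by an eigenvector. -/
theorem genSpan_le_iSup_eigenspace {G : T → T → Prop} {w : W} (H : Module.End ℂ W) (h s : ℂ)
    (hw : H w = h • w)
    (hG : ∀ c d, G c d → ∃ n : ℕ, ∀ u, H (X.e c d u) = X.e c d (H u) + (s * n) • X.e c d u) :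
    X.genSpan G w ≤ ⨆ k : ℕ, H.eigenspace (h + s * k) := by
  refine X.genSpan_le ?_ ?_
  · refine Submodule.mem_iSup_of_mem 0 ?_
    simpa [Module.End.mem_eigenspace_iff] using hw
  · intro c d hcd u hu
    obtain ⟨n, hn⟩ := hG c d hcd
    have : (⨆ k : ℕ, H.eigenspace (h + s * k))
        ≤ (⨆ k : ℕ, H.eigenspace (h + s * k)).comap (X.e c d) := by
      refine iSup_le fun k v hv => ?_
      refine Submodule.mem_iSup_of_mem (k + n) ?_
      rw [Module.End.mem_eigenspace_iff] at hv ⊢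
      rw [hn, hv, map_smul, ← add_smul]
      push_cast
      ring_nf
    exact this hu

/-- Eigenspaces for different eigenvalues are independent. This is how a forbidden eigenvalue is
turned into the vanishing of a vector. -/
theorem eq_zero_of_mem_iSup_eigenspace {H : Module.End ℂ W} {ι : Type*} {f : ι → ℂ} {v : W}
    (hv : v ∈ ⨆ k, H.eigenspace (f k)) {h : ℂ} (hh : H v = h • v) (hne : ∀ k, f k ≠ h) : v = 0 := by
  have hd := (Module.End.eigenspaces_iSupIndep H) h
  refine (Submodule.disjoint_def.1 hd) v (Module.End.mem_eigenspace_iff.2 hh) ?_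
  exact (iSup_le fun k => le_iSup₂_of_le (f k) (hne k) le_rfl :
    (⨆ k, H.eigenspace (f k)) ≤ ⨆ j, ⨆ _ : j ≠ h, H.eigenspace j) hv

theorem sgn_double (p q : ZMod 2) : sgn ((p + p) * q) = 1 := by
  rw [CharTwo.add_self_eq_zero, zero_mul, sgn_zero]

theorem e_diag_comm (t c d : T) (u : W) : X.e t t (X.e c d u) = X.e c d (X.e t t u)
    + (((if t = c then 1 else 0) - (if t = d then 1 else 0) : ℂ)) • X.e c d u := by
  rw [X.comm, sgn_double, one_smul]
  by_cases h1 : t = c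
  · subst h1
    by_cases h2 : t = d
    · subst h2; simp
    · simp [h2]
  · by_cases h2 : t = d
    · subst h2; simp [h1, sub_eq_add_neg]
    · simp [h1, h2]

/-- The sum of the diagonal matrix units indexed by `P`. -/
noncomputable def diagSum (P : Finset T) : Module.End ℂ W := ∑ t ∈ P, X.e t t

theorem diagSum_comm (P : Finset T) (c d : T) (u : W) :
    X.diagSum P (X.e c d u) = X.e c d (X.diagSum P u)
    + (((if c ∈ P then 1 else 0) - (if d ∈ P then 1 else 0) : ℂ)) • X.e c d u := by
  simp only [diagSum, LinearMap.sum_apply, X.e_diag_comm, Finset.sum_add_distrib, map_sum,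
    ← Finset.sum_smul, Finset.sum_sub_distrib, Finset.sum_ite_eq']

/-- The subspace `N` is stable and irreducible. -/
def Irred (N : Submodule ℂ W) : Prop :=
  X.Stable N ∧ ∀ D ≤ N, X.Stable D → D = ⊥ ∨ D = N

/-- A vector that is singular for the order `pos`, of weight `l`. -/
def Singular (pos : T → T → Prop) (l : T → ℂ) (v : W) : Prop :=
  (∀ a b, pos a b → X.e a b v = 0) ∧ ∀ a, X.e a a v = l a • v

theorem diagSum_singular {pos : T → T → Prop} {l : T → ℂ} {v : W} (hv : X.Singular pos l v)
    (P : Finset T) : X.diagSum P v = (∑ t ∈ P, l t) • v := by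
  simp only [diagSum, LinearMap.sum_apply, hv.2, Finset.sum_smul]

/-- A strict total order with finite initial segments. -/
structure IsOrder (pos : T → T → Prop) : Prop where
  irrefl : ∀ a, ¬ pos a a
  trans : ∀ {a b c}, pos a b → pos b c → pos a c
  total : ∀ a b, a ≠ b → pos a b ∨ pos b a
  finite : ∀ a, {z | pos z a}.Finite

/-- The index `y` is the successor of `x`. -/
def Adjacent (pos : T → T → Prop) (x y : T) : Prop := pos x y ∧ ∀ z, ¬ (pos x z ∧ pos z y)

/-! ### Singular vectors and odd reflections in irreducible modules. -/

variable {X}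

/-- Lowering a vector by a simple root in an irreducible module cannot give a nonzero
vector annihilated by all positive matrix units. -/
theorem lower_eq_zero {N : Submodule ℂ W} (hN : X.Irred N) {pos : T → T → Prop} (ho : IsOrder pos)
    {l : T → ℂ} {v : W} (hvN : v ∈ N) (hv : X.Singular pos l v) {x y : T}
    (hxy : pos x y) (hw : ∀ a b, pos a b → X.e a b (X.e y x v) = 0) : X.e y x v = 0 := by
  by_contra hne
  set w := X.e y x v with hwdef
  -- The positive units annihilate `w`, so if `w` is nonzero, the non-positive ones already generate
  -- `N` from it.
  set G : T → T → Prop := fun c d => ¬ pos c d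
  have hst : X.Stable (X.genSpan G w) := by
    refine X.stable_genSpan fun a b => ?_
    by_cases h : pos a b
    · rw [hw a b h]; exact Submodule.zero_mem _
    · exact X.e_mem_genSpan h (X.mem_genSpan G w)
  have hwN : w ∈ N := hN.1 _ _ _ hvN
  have hle : X.genSpan G w ≤ N := X.genSpan_le hwN fun c d _ u hu => hN.1 c d u hu
  have heq : X.genSpan G w = N := by
    refine (hN.2 _ hle hst).resolve_left fun h => hne ?_
    have := X.mem_genSpan G w
    rwa [h, Submodule.mem_bot] at this
  have hvD : v ∈ X.genSpan G w := heq ▸ hvN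
  -- `P` is the initial segment ending at `x`, finite by `ho.finite`. Passing from `v` to `w` takes
  -- one unit of weight out of `P`, and no non-positive matrix unit brings weight back in; hence `v`
  -- cannot be regenerated from `w`.
  set P : Finset T := insert x (ho.finite x).toFinset with hP
  have memP : ∀ z, z ∈ P ↔ z = x ∨ pos z x := by simp [hP]
  have hHv := X.diagSum_singular hv P
  set h := ∑ t ∈ P, l t
  have hyP : y ∉ P := by
    rw [memP]
    rintro (rfl | h')
    · exact ho.irrefl _ hxy
    · exact ho.irrefl _ (ho.trans hxy h')
  have hHw : X.diagSum P w = (h - 1) • w := by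
    rw [hwdef, X.diagSum_comm, hHv, map_smul, ← add_smul]
    simp [hyP, memP, sub_eq_add_neg]
  have hmem := X.genSpan_le_iSup_eigenspace (G := G) (X.diagSum P) (h - 1) (-1) hHw (by
    intro c d hcd
    by_cases hc : c ∈ P
    · have hd : d ∈ P := by
        rw [memP] at hc ⊢
        by_cases hcd' : c = d
        · exact hcd' ▸ hc
        · have hdc := (ho.total c d hcd').resolve_left hcd
          rcases hc with rfl | hc
          · exact Or.inr hdc
          · exact Or.inr (ho.trans hdc hc)
      exact ⟨0, fun u => by rw [X.diagSum_comm]; simp [hc, hd]⟩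
    · by_cases hd : d ∈ P
      · exact ⟨1, fun u => by rw [X.diagSum_comm]; simp [hc, hd]⟩
      · exact ⟨0, fun u => by rw [X.diagSum_comm]; simp [hc, hd]⟩) hvD
  have hv0 : v = 0 := eq_zero_of_mem_iSup_eigenspace hmem hHv (by
    intro k hk
    have h0 : (k : ℂ) + 1 = 0 := by linear_combination -hk
    exact Nat.cast_add_one_ne_zero k h0)
  exact hne (by rw [hwdef, hv0, map_zero])

/-- The supercommutator of `e a b` with `e y x` leaves at most a multiple of `e a x` or of `e y b`.
Since nothing lies between `x` and `y`, these are again positive units and annihilate `v`. -/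
theorem e_lower_adjacent {pos : T → T → Prop} (ho : IsOrder pos)
    {l : T → ℂ} {v : W} (hv : X.Singular pos l v) {x y : T} (hxy : Adjacent pos x y)
    {a b : T} (hab : pos a b) (hne : ¬ (a = x ∧ b = y)) : X.e a b (X.e y x v) = 0 := by
  rw [X.comm, hv.1 a b hab, map_zero, smul_zero, zero_add]
  have h1 : (if b = y then X.e a x v else 0) = 0 := by
    split_ifs with h
    · subst h
      have hax : a ≠ x := fun h => hne ⟨h, rfl⟩
      refine hv.1 a x ((ho.total a x hax).resolve_right fun h' => hxy.2 a ⟨h', hab⟩)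
    · rfl
  have h2 : (if a = x then sgn ((X.par a + X.par b) * (X.par y + X.par x)) • X.e y b v else 0)
      = 0 := by
    split_ifs with h
    · subst h
      have hby : y ≠ b := fun h => hne ⟨rfl, h.symm⟩
      rw [hv.1 y b ((ho.total y b hby).resolve_right fun h' => hxy.2 b ⟨hab, h'⟩), smul_zero]
    · rfl
  rw [h1, h2, sub_zero]

theorem e_raise_lower {pos : T → T → Prop}
    {l : T → ℂ} {v : W} (hv : X.Singular pos l v) {x y : T} (hxy : pos x y) :
    X.e x y (X.e y x v) = (l x - sgn (X.par x + X.par y) * l y) • v := by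
  have hp : (X.par x + X.par y) * (X.par y + X.par x) = X.par x + X.par y := by
    generalize X.par x = p
    generalize X.par y = q
    revert p q; decide
  rw [X.comm, hv.1 x y hxy, map_zero, smul_zero, zero_add, if_pos rfl, if_pos rfl, hv.2, hv.2, hp,
    smul_smul, sub_smul]

/-- For adjacent indices the only positive unit that might not annihilate `e y x v` is `e x y`, and
there `e_raise_lower` produces exactly the scalar assumed to vanish. -/
theorem lower_eq_zero_of_adjacent {N : Submodule ℂ W} (hN : X.Irred N) {pos : T → T → Prop}
    (ho : IsOrder pos) {l : T → ℂ} {v : W} (hvN : v ∈ N) (hv : X.Singular pos l v) {x y : T}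
    (hxy : Adjacent pos x y) (hl : l x - sgn (X.par x + X.par y) * l y = 0) : X.e y x v = 0 := by
  refine lower_eq_zero hN ho hvN hv hxy.1 fun a b hab => ?_
  by_cases h : a = x ∧ b = y
  · obtain ⟨rfl, rfl⟩ := h
    rw [e_raise_lower hv hab, hl, zero_smul]
  · exact e_lower_adjacent ho hv hxy hab h

/-- The odd reflection at two adjacent indices of opposite parity. -/
theorem exists_odd_reflection {N : Submodule ℂ W} (hN : X.Irred N) {pos pos' : T → T → Prop}
    (ho : IsOrder pos) {l l' : T → ℂ} {v : W} (hvN : v ∈ N) (hv0 : v ≠ 0)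
    (hv : X.Singular pos l v) {x y : T} (hxy : Adjacent pos x y) (hpar : X.par x ≠ X.par y)
    (hpos' : ∀ a b, pos' a b → (pos a b ∧ ¬ (a = x ∧ b = y)) ∨ (a = y ∧ b = x))
    (hl0 : l x + l y = 0 → l' = l)
    (hl1 : l x + l y ≠ 0 → ∀ t, l' t = l t + (if t = y then 1 else 0) - (if t = x then 1 else 0)) :
    ∃ v' ∈ N, v' ≠ 0 ∧ X.Singular pos' l' v' := by
  -- For opposite parities the scalar of `e_raise_lower` is the sum `l x + l y`, not the difference;
  -- it decides whether the reflection changes the vector.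
  have hs : sgn (X.par x + X.par y) = -1 := by
    have : X.par x + X.par y = 1 := by
      revert hpar
      generalize X.par x = p
      generalize X.par y = q
      revert p q; decide
    rw [this, sgn_one]
  by_cases hl : l x + l y = 0
  · have h0 := lower_eq_zero_of_adjacent hN ho hvN hv hxy (by rw [hs]; linear_combination hl)
    rw [hl0 hl]
    refine ⟨v, hvN, hv0, fun a b hab => ?_, hv.2⟩
    rcases hpos' a b hab with h | ⟨rfl, rfl⟩
    exacts [hv.1 a b h.1, h0]
  · refine ⟨X.e y x v, hN.1 _ _ _ hvN, fun h => ?_, fun a b hab => ?_, fun t => ?_⟩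
    · have h1 := e_raise_lower hv hxy.1
      rw [h, map_zero, hs] at h1
      refine (smul_ne_zero (fun h2 => hl ?_) hv0) h1.symm
      linear_combination h2
    · rcases hpos' a b hab with h | ⟨rfl, rfl⟩
      · exact e_lower_adjacent ho hv hxy h.1 h.2
      -- The reversed unit is the only new positive one. It is odd, so the relation says that its
      -- square equals minus itself.
      · have h1 := X.comm a b a b v
        have hne : a ≠ b := fun h => hpar (by rw [h])
        have hp : (X.par a + X.par b) * (X.par a + X.par b) = X.par b + X.par a := by
          generalize X.par a = p
          generalize X.par b = q
          revert p q; decide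
        rw [if_neg hne.symm, if_neg hne, hp, hs, neg_smul, one_smul, add_zero, sub_zero] at h1
        have h2 : (2 : ℂ) • X.e a b (X.e a b v) = 0 := by
          rw [two_smul]
          nth_rewrite 1 [h1]
          exact neg_add_cancel _
        exact (smul_eq_zero.1 h2).resolve_left two_ne_zero
    · rw [X.e_diag_comm, hv.2, map_smul, ← add_smul, hl1 hl t, add_sub_assoc]

/-- If all weights from the index `s` on vanish, then the matrix units `e t s` with `t` after `s`
annihilate the singular vector. -/
theorem e_eq_zero_of_tail {N : Submodule ℂ W} (hN : X.Irred N) {pos : T → T → Prop}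
    (ho : IsOrder pos) {l : T → ℂ} {v : W} (hvN : v ∈ N) (hv : X.Singular pos l v) :
    ∀ (n : ℕ) (s t : T), {z | pos s z ∧ pos z t}.ncard = n → l s = 0 →
      (∀ z, pos s z → l z = 0) → pos s t → X.e t s v = 0 := by
  intro n
  induction n using Nat.strong_induction_on with
  | _ n ih =>
    intro s t hn hs hz hst
    by_cases hadj : ∀ z, ¬ (pos s z ∧ pos z t)
    · exact lower_eq_zero_of_adjacent hN ho hvN hv ⟨hst, hadj⟩ (by rw [hs, hz t hst]; simp)
    · push Not at hadj
      obtain ⟨z, hsz, hzt⟩ := hadj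
      have hfin : {z | pos s z ∧ pos z t}.Finite := (ho.finite t).subset fun z hz => hz.2
      have h1 : X.e z s v = 0 := by
        refine ih _ ?_ s z rfl hs hz hsz
        rw [← hn]
        refine Set.ncard_lt_ncard ⟨fun y hy => ⟨hy.1, ho.trans hy.2 hzt⟩, fun h => ?_⟩ hfin
        exact ho.irrefl z (h ⟨hsz, hzt⟩).2
      have h2 : X.e t z v = 0 := by
        refine ih _ ?_ z t rfl (hz z hsz) (fun y hy => hz y (ho.trans hsz hy)) hzt
        rw [← hn]
        refine Set.ncard_lt_ncard ⟨fun y hy => ⟨ho.trans hsz hy.1, hy.2⟩, fun h => ?_⟩ hfin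
        exact ho.irrefl z (h ⟨hsz, hzt⟩).1
      -- The unit `e t s` is the supercommutator of `e t z` and `e z s`, both of which annihilate
      -- `v` by induction.
      have h3 := X.comm t z z s v
      have hts : t ≠ s := fun h => ho.irrefl s (h ▸ hst)
      rw [h1, h2, map_zero, map_zero, smul_zero, if_pos rfl, if_neg hts, zero_add, sub_zero] at h3
      exact h3.symm

/-- If a nonzero vector of an irreducible module is annihilated by the matrix units in the column
`r`, then `e r r` has eigenvalues in the natural numbers. -/
theorem le_iSup_eigenspace_of_column {N : Submodule ℂ W} (hN : X.Irred N) {v : W} (hvN : v ∈ N)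
    (hv0 : v ≠ 0) {r : T} (hr : ∀ t, X.e t r v = 0) :
    N ≤ ⨆ k : ℕ, (X.e r r).eigenspace (k : ℂ) := by
  -- The units of column `r` annihilate `v`, so the others generate `N`. A unit `e c d` with `d ≠ r`
  -- raises the eigenvalue of `e r r` by one if `c = r` and preserves it otherwise; the eigenvalue
  -- on `v` is zero.
  set G : T → T → Prop := fun _ d => d ≠ r
  have hst : X.Stable (X.genSpan G v) := by
    refine X.stable_genSpan fun a b => ?_
    by_cases h : b = r
    · rw [h, hr]; exact Submodule.zero_mem _
    · exact X.e_mem_genSpan h (X.mem_genSpan G v)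
  have hle : X.genSpan G v ≤ N := X.genSpan_le hvN fun c d _ u hu => hN.1 c d u hu
  have heq : X.genSpan G v = N := by
    refine (hN.2 _ hle hst).resolve_left fun h => hv0 ?_
    have := X.mem_genSpan G v
    rwa [h, Submodule.mem_bot] at this
  have := X.genSpan_le_iSup_eigenspace (G := G) (w := v) (X.e r r) 0 1 (by rw [hr, zero_smul]) (by
    intro c d hd
    by_cases hc : r = c
    · exact ⟨1, fun u => by rw [X.e_diag_comm]; simp [hc, show ¬ c = d from fun h => hd (by rw [hc, h])]⟩
    · exact ⟨0, fun u => by rw [X.e_diag_comm]; simp [hc, show ¬ r = d from fun h => hd h.symm]⟩)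
  rw [heq] at this
  simpa using this

end GLAction

end SuperKZ

namespace SuperKZ

/-! ### Odd reflections for hook partitions -/

namespace GLAction

/-- The order on two families of indices in which `inl a` precedes `inr b` if `a < p b`. -/
def shuffle (p : ℕ → ℕ) : ℕ ⊕ ℕ → ℕ ⊕ ℕ → Prop
  | .inl a, .inl a' => a < a'
  | .inr b, .inr b' => b < b'
  | .inl a, .inr b => a < p b
  | .inr b, .inl a => p b ≤ a

/-- The extremal weight attached to a shuffle and to the row lengths `al` and
column lengths `be` of a partition. -/
def shuffleWt (al be p q : ℕ → ℕ) : ℕ ⊕ ℕ → ℂ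
  | .inl a => ((al a - q a : ℕ) : ℂ)
  | .inr b => ((be b - p b : ℕ) : ℂ)

/-- Here `p b` counts the indices `inl` in front of `inr b`, and `q a` counts the indices `inr` in
front of `inl a`. The hypothesis relates the two counts; it forces `p` to be monotone, which gives
transitivity, and makes initial segments finite. -/
theorem isOrder_shuffle {p q : ℕ → ℕ} (hpq : ∀ a b, p b ≤ a ↔ b < q a) : IsOrder (shuffle p) where
  irrefl := by
    rintro (a | b) <;> simp [shuffle]
  trans := by
    have hmono : Monotone p := by
      intro b b' h
      exact (hpq _ _).2 (lt_of_le_of_lt h ((hpq _ _).1 le_rfl))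
    rintro (a | b) (a' | b') (a'' | b'') h1 h2 <;> simp only [shuffle] at h1 h2 ⊢
    · omega
    · omega
    · omega
    · exact lt_of_lt_of_le h1 (hmono h2.le)
    · omega
    · by_contra h
      have := hmono (not_lt.1 h)
      omega
    · have := hmono h1.le
      omega
    · omega
  total := by
    rintro (a | b) (a' | b') h <;> simp only [shuffle, ne_eq, Sum.inl.injEq, Sum.inr.injEq] at h ⊢ <;>
      omega
  finite := by
    rintro (a | b)
    · refine (((Finset.range a).disjSum (Finset.range (q a))).finite_toSet).subset ?_
      rintro (a' | b') h <;> simp only [shuffle, Set.mem_ofPred_eq] at h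
      · simpa using h
      · simpa using (hpq _ _).1 h
    · refine (((Finset.range (p b)).disjSum (Finset.range b)).finite_toSet).subset ?_
      rintro (a' | b') h <;> simp only [shuffle, Set.mem_ofPred_eq] at h
      · simpa using h
      · simpa using h

variable {W : Type*} [AddCommGroup W] [Module ℂ W] {X : GLAction (ℕ ⊕ ℕ) W}

/-- The hypotheses on `p b` and `q a` make `inl a` the immediate predecessor of `inr b`, and the odd
reflection exchanges them. If the cell `(a, b)` is in the diagram, it stops being counted in row `a`
and starts being counted in column `b`; otherwise both weights are zero and nothing changes. -/
theorem exists_shuffle_move {N : Submodule ℂ W} (hN : X.Irred N)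
    (hpar : ∀ a b, X.par (.inl a) ≠ X.par (.inr b)) {al be : ℕ → ℕ}
    (hpart : ∀ a b, b < al a ↔ a < be b) {p q : ℕ → ℕ} (hpq : ∀ a b, p b ≤ a ↔ b < q a)
    {v : W} (hvN : v ∈ N) (hv0 : v ≠ 0) (hv : X.Singular (shuffle p) (shuffleWt al be p q) v)
    {a b : ℕ} (hpb : p b = a + 1) (hqa : q a = b) :
    (∀ a' b', Function.update p b a b' ≤ a' ↔ b' < Function.update q a (b + 1) a') ∧
    ∃ v' ∈ N, v' ≠ 0 ∧ X.Singular (shuffle (Function.update p b a))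
      (shuffleWt al be (Function.update p b a) (Function.update q a (b + 1))) v' := by
  refine ⟨fun a' b' => ?_, ?_⟩
  · have h1 := hpq a' b'
    by_cases ha : a' = a <;> by_cases hb : b' = b
    · subst ha hb; simp
    · subst ha; simp only [ne_eq, hb, not_false_eq_true, Function.update_of_ne,
        Function.update_self]; omega
    · subst hb; simp only [ne_eq, ha, not_false_eq_true, Function.update_of_ne,
        Function.update_self]; omega
    · simpa [ha, hb] using h1
  · refine exists_odd_reflection hN (isOrder_shuffle hpq) hvN hv0 hv (x := .inl a) (y := .inr b)
      ⟨by simp [shuffle, hpb], ?_⟩ (hpar a b) ?_ ?_ ?_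
    · rintro (z | z) <;> simp only [shuffle]
      · omega
      · have := hpq a z
        omega
    · rintro (a' | b') (a'' | b'') h <;> simp only [shuffle] at h ⊢
      · simpa using h
      · by_cases hb : b'' = b
        · subst hb
          simp only [Function.update_self] at h
          left
          simp only [Sum.inl.injEq, and_true]
          omega
        · simp only [ne_eq, hb, not_false_eq_true, Function.update_of_ne] at h
          left
          simpa [hb] using h
      · by_cases hb : b' = b
        · subst hb
          simp only [Function.update_self] at h
          by_cases ha : a'' = a
          · right; simp [ha]
          · left
            simp only [reduceCtorEq, and_self, not_false_eq_true, and_true]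
            omega
        · simp only [ne_eq, hb, not_false_eq_true, Function.update_of_ne] at h
          left
          simpa using h
      · simpa using h
    · intro h
      -- Both weights are natural numbers, so a zero sum forces both to vanish. Then the cell `(a,
      -- b)` is outside the diagram, and the truncated differences for the new order are zero too.
      have hz : al a - b = 0 ∧ be b - (a + 1) = 0 := by
        simp only [shuffleWt, hqa, hpb] at h
        have h' : (al a - b) + (be b - (a + 1)) = 0 := by exact_mod_cast h
        omega
      have := hpart a b
      funext t
      rcases t with t | t <;> simp only [shuffleWt]
      · by_cases ht : t = a
        · subst ht; rw [Function.update_self, hqa]; congr 1; omega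
        · rw [Function.update_of_ne ht]
      · by_cases ht : t = b
        · subst ht; rw [Function.update_self, hpb]; congr 1; omega
        · rw [Function.update_of_ne ht]
    · intro h
      -- A nonzero sum means that the cell `(a, b)` is in the diagram, so the subtractions below are
      -- genuine and change by exactly one.
      have hlt : b < al a := by
        by_contra hlt
        refine h ?_
        have := hpart a b
        simp only [shuffleWt, hqa, hpb]
        rw [show al a - b = 0 by omega, show be b - (a + 1) = 0 by omega]
        simp
      have hlt' := (hpart a b).1 hlt
      rintro (t | t) <;> simp only [shuffleWt]
      · by_cases ht : t = a
        · subst ht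
          rw [Function.update_self, hqa, show al t - b = (al t - (b + 1)) + 1 by omega]
          simp
        · rw [Function.update_of_ne ht]; simp [ht]
      · by_cases ht : t = b
        · subst ht
          rw [Function.update_self, hpb, show be t - a = (be t - (a + 1)) + 1 by omega]
          simp
        · rw [Function.update_of_ne ht]; simp [ht]

/-- Odd reflections move the first `n` indices `inr b` to the front. -/
theorem exists_shuffle_front {N : Submodule ℂ W} (hN : X.Irred N)
    (hpar : ∀ a b, X.par (.inl a) ≠ X.par (.inr b)) {al be : ℕ → ℕ}
    (hpart : ∀ a b, b < al a ↔ a < be b) {p q : ℕ → ℕ} (hpq : ∀ a b, p b ≤ a ↔ b < q a)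
    {v : W} (hvN : v ∈ N) (hv0 : v ≠ 0) (hv : X.Singular (shuffle p) (shuffleWt al be p q) v)
    (n : ℕ) : ∃ p' q' : ℕ → ℕ, (∀ a b, p' b ≤ a ↔ b < q' a) ∧ (∀ b < n, p' b = 0) ∧
      ∃ v' ∈ N, v' ≠ 0 ∧ X.Singular (shuffle p') (shuffleWt al be p' q') v' := by
  induction n with
  | zero => exact ⟨p, q, hpq, by simp, v, hvN, hv0, hv⟩
  | succ n ih =>
    obtain ⟨p, q, hpq, hp0, hex⟩ := ih
    -- The inner induction is on the number of indices `inl` that `inr n` still has to pass.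
    have key : ∀ k : ℕ, ∀ p q : ℕ → ℕ, (∀ a b, p b ≤ a ↔ b < q a) → (∀ b < n, p b = 0) → p n = k →
        (∃ v' ∈ N, v' ≠ 0 ∧ X.Singular (shuffle p) (shuffleWt al be p q) v') →
        ∃ p' q' : ℕ → ℕ, (∀ a b, p' b ≤ a ↔ b < q' a) ∧ (∀ b < n + 1, p' b = 0) ∧
          ∃ v' ∈ N, v' ≠ 0 ∧ X.Singular (shuffle p') (shuffleWt al be p' q') v' := by
      intro k
      induction k with
      | zero =>
        intro p q hpq hp0 hpn hex
        refine ⟨p, q, hpq, fun b hb => ?_, hex⟩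
        rcases Nat.lt_succ_iff_lt_or_eq.1 hb with h | rfl
        exacts [hp0 b h, hpn]
      | succ a ih =>
        rintro p q hpq hp0 hpn ⟨v, hvN, hv0, hv⟩
        -- The indices `inr` in front of `inl a` are precisely the `n` already moved, so `inl a` and
        -- `inr n` are neighbours.
        have hqa : q a = n := by
          have h1 := hpq a n
          rcases Nat.eq_zero_or_pos n with h0 | h0
          · omega
          · have h2 := hpq a (n - 1)
            have h3 := hp0 (n - 1) (by omega)
            omega
        obtain ⟨h1, h2⟩ := exists_shuffle_move hN hpar hpart hpq hvN hv0 hv hpn hqa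
        refine ih _ _ h1 (fun b hb => ?_) (by simp) h2
        rw [Function.update_of_ne hb.ne, hp0 b hb]
    exact key _ p q hpq hp0 rfl hex

/-- In an irreducible module with a singular vector whose weight is given by a partition, the
diagonal matrix units have eigenvalues in the natural numbers. -/
theorem le_iSup_eigenspace_of_partition {N : Submodule ℂ W} (hN : X.Irred N)
    (hpar : ∀ a b, X.par (.inl a) ≠ X.par (.inr b)) {al be : ℕ → ℕ}
    (hpart : ∀ a b, b < al a ↔ a < be b) {p q : ℕ → ℕ} (hpq : ∀ a b, p b ≤ a ↔ b < q a)
    {v : W} (hvN : v ∈ N) (hv0 : v ≠ 0) (hv : X.Singular (shuffle p) (shuffleWt al be p q) v)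
    (a : ℕ) : N ≤ ⨆ k : ℕ, (X.e (.inl a) (.inl a)).eigenspace (k : ℂ) := by
  -- The first row length `al 0` is the number of nonzero columns. Once these columns are in front,
  -- each row weight is truncated to zero, and the columns further back have length zero.
  obtain ⟨p, q, hpq, hp0, v, hvN, hv0, hv⟩ :=
    exists_shuffle_front hN hpar hpart hpq hvN hv0 hv (al 0)
  have hal : ∀ a, al a ≤ al 0 := by
    intro a
    by_contra h
    have h1 := (hpart a (al 0)).1 (not_le.1 h)
    have h2 := hpart 0 (al 0)
    omega
  have hA : ∀ a, shuffleWt al be p q (.inl a) = 0 := by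
    intro a
    have h1 : al 0 ≤ q a := by
      by_contra h
      have h2 := (hpq a (q a))
      have h3 := hp0 (q a) (not_le.1 h)
      omega
    have h2 := hal a
    simp only [shuffleWt]
    rw [show al a - q a = 0 by omega, Nat.cast_zero]
  have ho := isOrder_shuffle hpq
  refine le_iSup_eigenspace_of_column hN hvN hv0 fun t => ?_
  -- The column of `inl a` splits into three kinds of units: the diagonal one acts by the weight
  -- zero, those with `t` in front are positive, and those with `t` behind are handled by
  -- `e_eq_zero_of_tail`, all later weights being zero.
  by_cases ht : t = .inl a
  · rw [ht, hv.2, hA, zero_smul]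
  · rcases ho.total _ _ ht with h | h
    · exact hv.1 _ _ h
    · refine e_eq_zero_of_tail hN ho hvN hv _ (.inl a) t rfl (hA a) ?_ h
      rintro (z | b) hz
      · exact hA z
      · simp only [shuffle] at hz
        have h1 : al 0 ≤ b := by
          by_contra h'
          have := hp0 b (not_le.1 h')
          omega
        have h2 := hpart 0 b
        simp only [shuffleWt]
        rw [show be b - p b = 0 by omega, Nat.cast_zero]

end GLAction

end SuperKZ

namespace SuperKZ

/-! ### Matrix entries -/

section Entries

variable {m : ℕ} {x : LieType} {k : Flavor}

/-- The entry of a matrix at the place `(i, j)`. -/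
noncomputable def entry (A : Module.End ℂ (V m)) (i j : Idx m) : ℂ := (vBasis m).repr (A (vec j)) i

theorem entry_ext {A B : Module.End ℂ (V m)} (h : ∀ i j, entry A i j = entry B i j) : A = B :=
  ext_vec fun j => (vBasis m).repr.injective (Finsupp.ext fun i => h i j)

theorem entry_add (A B : Module.End ℂ (V m)) (i j : Idx m) :
    entry (A + B) i j = entry A i j + entry B i j := by simp [entry]

theorem entry_sub (A B : Module.End ℂ (V m)) (i j : Idx m) :
    entry (A - B) i j = entry A i j - entry B i j := by simp [entry]

theorem entry_smul (c : ℂ) (A : Module.End ℂ (V m)) (i j : Idx m) :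
    entry (c • A) i j = c * entry A i j := by simp [entry]

theorem entry_zero (i j : Idx m) : entry (0 : Module.End ℂ (V m)) i j = 0 := by simp [entry]

theorem repr_diag (f : Idx m → ℂ) (v : V m) (i : Idx m) :
    (vBasis m).repr (diag f v) i = f i * (vBasis m).repr v i := by
  classical
  have : (vBasis m).coord i ∘ₗ diag f = f i • (vBasis m).coord i := by
    refine (vBasis m).ext fun j => ?_
    have h1 : diag f (vBasis m j) = f j • vBasis m j := diag_vec f j
    simp only [LinearMap.comp_apply, LinearMap.smul_apply, h1, map_smul, smul_eq_mul,
      Module.Basis.coord_apply, Module.Basis.repr_self, Finsupp.single_apply]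
    by_cases h : j = i <;> simp [h]
  exact congrArg (fun F => F v) this

theorem entry_diag_mul (f : Idx m → ℂ) (A : Module.End ℂ (V m)) (i j : Idx m) :
    entry (diag f * A) i j = f i * entry A i j := repr_diag f _ i

theorem entry_mul_diag (f : Idx m → ℂ) (A : Module.End ℂ (V m)) (i j : Idx m) :
    entry (A * diag f) i j = f j * entry A i j := by
  simp [entry, diag_vec]

open Classical in
theorem entry_matUnit (a b i j : Idx m) :
    entry (matUnit a b) i j = if i = a ∧ j = b then 1 else 0 := by
  by_cases hj : j = b
  · subst hj
    rw [entry, matUnit_vec, if_pos rfl, vec, Module.Basis.repr_self, Finsupp.single_apply]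
    simp [eq_comm]
  · simp [entry, matUnit_vec, hj]

theorem mem_of_entry_ne_zero {S : Set (Idx m)} {A : Module.End ℂ (V m)} (hA : A ∈ gl S)
    {i j : Idx m} (h : entry A i j ≠ 0) : i ∈ S ∧ j ∈ S := by
  classical
  by_contra hn
  refine h ?_
  refine Submodule.span_induction (p := fun A _ => entry A i j = 0) ?_ ?_ ?_ ?_ hA
  · rintro _ ⟨a, ha, b, hb, rfl⟩
    rw [entry_matUnit, if_neg]
    rintro ⟨rfl, rfl⟩
    exact hn ⟨ha, hb⟩
  · exact entry_zero i j
  · intro A B _ _ h1 h2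
    rw [entry_add, h1, h2, add_zero]
  · intro c A _ h1
    rw [entry_smul, h1, mul_zero]

/-- Compression by the diagonal idempotent of `S` fixes `A` and sends each matrix unit into `gl S`.
-/
theorem mem_gl_of_entry {S S' : Set (Idx m)} {A : Module.End ℂ (V m)} (hA : A ∈ gl S')
    (h : ∀ i j, entry A i j ≠ 0 → i ∈ S ∧ j ∈ S) : A ∈ gl S := by
  classical
  set P : Module.End ℂ (V m) := diag fun i => if i ∈ S then 1 else 0 with hP
  have h1 : P * A * P = A := by
    refine entry_ext fun i j => ?_
    rw [hP, entry_mul_diag, entry_diag_mul]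
    by_cases h0 : entry A i j = 0
    · simp [h0]
    · simp [h i j h0]
  rw [← h1]
  refine Submodule.span_induction (p := fun A _ => P * A * P ∈ gl S) ?_ ?_ ?_ ?_ hA
  · rintro _ ⟨a, ha, b, hb, rfl⟩
    rw [hP, diag_mul_matUnit, smul_mul_assoc, matUnit_mul_diag]
    by_cases ha : a ∈ S
    · by_cases hb : b ∈ S
      · exact Submodule.smul_mem _ _ (Submodule.smul_mem _ _
          (Submodule.subset_span ⟨a, ha, b, hb, rfl⟩))
      · simp [hb]
    · simp [ha]
  · simp
  · intro B C _ _ h1 h2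
    rw [mul_add, add_mul]; exact Submodule.add_mem _ h1 h2
  · intro c B _ h
    rw [mul_smul_comm, smul_mul_assoc]; exact Submodule.smul_mem _ c h

theorem natIdx_le_tilde : natIdx x k ⊆ (natIdx x .tilde : Set (Idx m)) := by
  intro i hi
  cases i with
  | pos r => exact trivial
  | bar r => exact ⟨hi.1, trivial⟩
  | zero => exact hi

/-! ### Preservation of the form in terms of entries -/

/-- The index of the dual basis vector. -/
def Idx.dual : Idx m → Idx m
  | .pos r => .bar r
  | .bar r => .pos r
  | .zero => .zero

theorem Idx.dual_dual (i : Idx m) : i.dual.dual = i := by cases i <;> rfl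

theorem par_dual (i : Idx m) : par x i.dual = par x i := by cases i <;> rfl

theorem form_vec_left (i : Idx m) (v : V m) :
    form x (vec i) v = formBasis x i i.dual * (vBasis m).repr v i.dual := by
  classical
  have : form x (vec i) = formBasis x i i.dual • (vBasis m).coord i.dual := by
    refine (vBasis m).ext fun j => ?_
    simp only [form, vec, Module.Basis.constr_basis, LinearMap.smul_apply, Module.Basis.coord_apply,
      Module.Basis.repr_self, Finsupp.single_apply, smul_eq_mul]
    cases i <;> cases j <;> simp [formBasis, Idx.dual, eq_comm]
    split_ifs with h
    exacts [h ▸ rfl, rfl]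
  rw [this]; rfl

theorem form_vec_right (j : Idx m) (v : V m) :
    form x v (vec j) = formBasis x j.dual j * (vBasis m).repr v j.dual := by
  classical
  have : (form x).flip (vec j) = formBasis x j.dual j • (vBasis m).coord j.dual := by
    refine (vBasis m).ext fun i => ?_
    simp only [form, vec, Module.Basis.constr_basis, LinearMap.smul_apply, Module.Basis.coord_apply,
      Module.Basis.repr_self, Finsupp.single_apply, smul_eq_mul, LinearMap.flip_apply]
    cases i <;> cases j <;> simp [formBasis, Idx.dual]
    rename_i r s
    by_cases h : r = s
    · simp [h]
    · simp [h, Ne.symm h]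
  exact congrArg (fun F => F v) this

theorem sgn_ne_zero (p : ZMod 2) : sgn p ≠ 0 := by
  rcases parity_cases p with rfl | rfl <;> simp [sgn_zero, sgn_one]

theorem formSign_ne_zero : formSign x ≠ 0 := by cases x <;> simp [formSign]

theorem formBasis_dual_ne_zero (i : Idx m) : formBasis x i i.dual ≠ 0 := by
  cases i <;> simp [formBasis, Idx.dual, formSign_ne_zero, sgn_ne_zero]

theorem entry_opPart (p : ZMod 2) (A : Module.End ℂ (V m)) (i j : Idx m) :
    entry (opPart (parOp x) p A) i j = if p = par x i + par x j then entry A i j else 0 := by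
  rw [opPart, entry_smul, entry_add, entry_smul, parOp, entry_mul_diag, entry_diag_mul]
  generalize par x i = a
  generalize par x j = b
  have h : (1 + 1 : ZMod 2) = 0 := by decide
  rcases parity_cases a with rfl | rfl <;> rcases parity_cases b with rfl | rfl <;>
    rcases parity_cases p with rfl | rfl <;> simp [sgn_zero, sgn_one, h] <;> ring

/-- A basis vector pairs nontrivially only with its dual, so each condition involves just two
entries. The parities of the indices determine the degree of these entries, and therefore `p`
disappears. -/
theorem preservesForm_iff_entry {A : Module.End ℂ (V m)} :
    PreservesForm x A ↔ ∀ i j : Idx m, formBasis x j.dual j * entry A j.dual i +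
      sgn ((par x i + par x j) * par x i) * (formBasis x i i.dual * entry A i.dual j) = 0 := by
  have key : ∀ p i j, form x (opPart (parOp x) p A (vec i)) (vec j)
      + sgn (p * par x i) * form x (vec i) (opPart (parOp x) p A (vec j)) =
      if p = par x i + par x j then formBasis x j.dual j * entry A j.dual i +
      sgn ((par x i + par x j) * par x i) * (formBasis x i i.dual * entry A i.dual j) else 0 := by
    intro p i j
    rw [form_vec_left, form_vec_right]
    change _ * entry _ _ _ + _ * (_ * entry _ _ _) = _
    rw [entry_opPart, entry_opPart, par_dual, par_dual, add_comm (par x j)]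
    split_ifs with h
    · rw [h]
    · simp
  constructor
  · intro h i j
    have := h (par x i + par x j) i j
    rwa [key, if_pos rfl] at this
  · intro h p i j
    rw [key, h i j, ite_self]

theorem entry_dual_ne_zero {A : Module.End ℂ (V m)} (hA : PreservesForm x A) {i j : Idx m}
    (h : entry A i j ≠ 0) : entry A j.dual i.dual ≠ 0 := by
  intro h0
  have h1 := preservesForm_iff_entry.1 hA i.dual j
  rw [h0, mul_zero, zero_add, Idx.dual_dual] at h1
  have h2 := formBasis_dual_ne_zero (x := x) i.dual
  rw [Idx.dual_dual] at h2
  exact mul_ne_zero (sgn_ne_zero _) (mul_ne_zero h2 h) h1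

/-! ### Root spaces -/

/-- The weight of the basis vector `v_i`. -/
noncomputable def wt : Idx m → RootWt m
  | .pos r => eps r
  | .bar r => -eps r
  | .zero => 0

/-- The restriction to `natIdx` matters in type `a`: barred vectors are then outside the natural
module, and `E_r` annihilates them although `wt` assigns them a nonzero weight. -/
theorem cartanE_eq_diag (r : IPlus m) : ∃ f : Idx m → ℂ, cartanE x r = diag f ∧
    ∀ i ∈ (natIdx x .tilde : Set (Idx m)), f i = wt i r := by
  classical
  refine ⟨fun i => match i with
    | .pos u => if u = r then 1 else 0
    | .bar u => if x = .a then 0 else if u = r then -1 else 0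
    | .zero => 0, ext_vec fun i => ?_, ?_⟩
  · cases x <;> cases i with
    | pos u => by_cases h : u = r <;> simp [cartanE, matUnit_vec, diag_vec, h]
    | bar u => by_cases h : u = r <;> simp [cartanE, matUnit_vec, diag_vec, h]
    | zero => simp [cartanE, matUnit_vec, diag_vec]
  · rintro (u | u | _) hi
    · by_cases h : u = r <;> simp [wt, eps, h]
    · by_cases h : u = r <;> simp [wt, eps, h, hi.1]
    · simp [wt]

theorem superBracket_cartanE (r : IPlus m) (A : Module.End ℂ (V m)) :
    superBracket (parOp x) (cartanE x r) A = cartanE x r * A - A * cartanE x r := by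
  have h1 : ∀ p : ZMod 2, opPart (parOp x) p (cartanE x r) = if p = 0 then cartanE x r else 0 :=
    fun p => opPart_of_homog (cartanE_even x r) p
  rw [superBracket, Finset.sum_eq_single 0]
  · simp only [h1, if_true, zero_mul, sgn_zero, one_smul]
    rw [Finset.sum_sub_distrib, ← Finset.mul_sum, ← Finset.sum_mul, opPart_add_opPart]
  · intro p _ hp
    simp [h1, hp]
  · simp

/-- Bracketing with the diagonal `E_r` multiplies the entry at `(i, j)` by the difference of the two
weights at `r`. This replaces brackets by the combinatorics of weights of basis vectors. -/
theorem inRootSpace_iff {α : RootWt m} (hα : SuppIn k α) {A : Module.End ℂ (V m)} :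
    InRootSpace x k α A ↔ A ∈ algG m x k ∧ ∀ i j, entry A i j ≠ 0 → wt i - wt j = α := by
  refine and_congr_right fun hA => ?_
  have key : ∀ r i j, entry (superBracket (parOp x) (cartanE x r) A - α r • A) i j
      = (wt i r - wt j r - α r) * entry A i j := by
    intro r i j
    obtain ⟨f, hf, hf'⟩ := cartanE_eq_diag (x := x) r
    rw [superBracket_cartanE, hf, entry_sub, entry_sub, entry_smul, entry_diag_mul, entry_mul_diag]
    by_cases h : entry A i j = 0
    · simp [h]
    · have h1 := mem_of_entry_ne_zero hA.1 h
      rw [hf' i (natIdx_le_tilde h1.1), hf' j (natIdx_le_tilde h1.2)]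
      ring
  constructor
  · intro h i j hij
    ext r
    by_cases hr : r ∈ k.idx
    · have h1 := key r i j
      rw [h r hr, sub_self, entry_zero] at h1
      have h2 := (mul_eq_zero.1 h1.symm).resolve_right hij
      rw [Finsupp.sub_apply]
      linear_combination h2
    -- The definition gives no condition at an index outside the flavor, but there both sides are
    -- zero, because `A` and `α` are supported inside.
    · have h1 := mem_of_entry_ne_zero hA.1 hij
      have hz : ∀ i ∈ (natIdx x k : Set (Idx m)), wt i r = 0 := by
        rintro (u | u | _) hi
        · have : u ≠ r := fun h => hr (h ▸ hi)
          simp [wt, eps, this]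
        · have : u ≠ r := fun h => hr (h ▸ hi.2)
          simp [wt, eps, this]
        · simp [wt]
      have h2 : α r = 0 := by
        by_contra h
        exact hr (hα r h)
      rw [Finsupp.sub_apply, hz i h1.1, hz j h1.2, h2, sub_zero]
  · intro h r hr
    rw [← sub_eq_zero]
    refine entry_ext fun i j => ?_
    rw [key, entry_zero]
    by_cases hij : entry A i j = 0
    · rw [hij, mul_zero]
    · rw [← h i j hij, Finsupp.sub_apply, sub_self, zero_mul]

theorem wt_dual (i : Idx m) : wt i.dual = -wt i := by cases i <;> simp [wt, Idx.dual]

theorem wt_injective : Function.Injective (wt : Idx m → RootWt m) := by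
  classical
  rintro (r | r | _) (s | s | _) h
  all_goals
    simp only [wt, eps] at h
    first
    | rfl
    | (have h1 := DFunLike.congr_fun h r
       by_cases hrs : s = r
       · simp [hrs] at h1
         try (first | (subst hrs; rfl) | norm_num at h1)
       · simp [hrs] at h1)
    | (have h1 := DFunLike.congr_fun h r
       simp at h1)
    | (have h1 := DFunLike.congr_fun h s
       simp at h1)

end Entries

end SuperKZ

namespace SuperKZ

/-! ### Root spaces, and the classification of the roots. -/

section RootSpaces

variable {m : ℕ} {x : LieType} {k : Flavor}

open Classical in
/-- The coordinates of the weight of a basis vector, as integers. -/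
noncomputable def wtInt (r : IPlus m) : Idx m → ℤ
  | .pos s => if s = r then 1 else 0
  | .bar s => if s = r then -1 else 0
  | .zero => 0

theorem wt_apply (i : Idx m) (r : IPlus m) : wt i r = (wtInt r i : ℂ) := by
  cases i with
  | pos s => by_cases h : s = r <;> simp [wt, eps, wtInt, h]
  | bar s => by_cases h : s = r <;> simp [wt, eps, wtInt, h]
  | zero => simp [wt, wtInt]

theorem wtInt_bounds (i : Idx m) (r : IPlus m) : -1 ≤ wtInt r i ∧ wtInt r i ≤ 1 ∧
    (wtInt r i = 1 ↔ i = .pos r) ∧ (wtInt r i = -1 ↔ i = .bar r) := by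
  cases i with
  | pos s => by_cases h : s = r <;> simp [wtInt, h]
  | bar s => by_cases h : s = r <;> simp [wtInt, h]
  | zero => simp [wtInt]

/-- Weights of basis vectors have coordinates in `{-1, 0, 1}`. At the index of `i` no cancellation
with `j` occurs, as `j` is not dual to `i`, so one of `i'`, `j'` must have the same extreme
coordinate there, which identifies it. -/
theorem eq_or_eq_of_wt_add {i j i' j' : Idx m} (hi : i ≠ .zero) (h0 : wt i + wt j ≠ 0)
    (h : wt i + wt j = wt i' + wt j') : i = i' ∨ i = j' := by
  have hj : j ≠ i.dual := by
    rintro rfl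
    exact h0 (by rw [wt_dual, add_neg_cancel])
  have key : ∀ r, wtInt r i + wtInt r j = wtInt r i' + wtInt r j' := by
    intro r
    have h1 := DFunLike.congr_fun h r
    simp only [Finsupp.add_apply, wt_apply] at h1
    exact_mod_cast h1
  cases i with
  | pos r =>
    have h1 := key r
    have e1 := wtInt_bounds j r
    have e2 := wtInt_bounds i' r
    have e3 := wtInt_bounds j' r
    have e4 : wtInt r (.pos r) = 1 := (wtInt_bounds _ r).2.2.1.2 rfl
    have e5 : wtInt r j ≠ -1 := fun h => hj (e1.2.2.2.1 h)
    rcases (by omega : wtInt r i' = 1 ∨ wtInt r j' = 1) with h | h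
    exacts [Or.inl (e2.2.2.1.1 h).symm, Or.inr (e3.2.2.1.1 h).symm]
  | bar r =>
    have h1 := key r
    have e1 := wtInt_bounds j r
    have e2 := wtInt_bounds i' r
    have e3 := wtInt_bounds j' r
    have e4 : wtInt r (.bar r) = -1 := (wtInt_bounds _ r).2.2.2.2 rfl
    have e5 : wtInt r j ≠ 1 := fun h => hj (e1.2.2.1.1 h)
    rcases (by omega : wtInt r i' = -1 ∨ wtInt r j' = -1) with h | h
    exacts [Or.inl (e2.2.2.2.1 h).symm, Or.inr (e3.2.2.2.1 h).symm]
  | zero => exact absurd rfl hi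

/-- Dualising `j` turns a difference of weights into a sum, and a nonzero sum of two such weights
determines the pair up to order. Thus a root vector has at most two nonzero entries, at mutually
dual places. -/
theorem eq_or_eq_dual_of_wt_sub {i j i' j' : Idx m} (h0 : wt i - wt j ≠ 0)
    (h : wt i - wt j = wt i' - wt j') : (i' = i ∧ j' = j) ∨ (i' = j.dual ∧ j' = i.dual) := by
  have h0' : wt i + wt j.dual ≠ 0 := by rwa [wt_dual, ← sub_eq_add_neg]
  have h' : wt i + wt j.dual = wt i' + wt j'.dual := by
    rwa [wt_dual, wt_dual, ← sub_eq_add_neg, ← sub_eq_add_neg]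
  have hdual : ∀ {a b : Idx m}, a.dual = b.dual → a = b := fun {a b} h => by
    rw [← a.dual_dual, h, Idx.dual_dual]
  have hdual' : ∀ {a b : Idx m}, a = b.dual → b = a.dual := fun {a b} h => by
    rw [h, Idx.dual_dual]
  by_cases hi : i = .zero
  · have hj : j.dual ≠ .zero := by
      intro hj
      rw [hi, hj] at h0'
      simp [wt] at h0'
    rw [add_comm] at h0'
    have h'' : wt j.dual + wt i = wt i' + wt j'.dual := by rw [add_comm]; exact h'
    rcases eq_or_eq_of_wt_add hj h0' h'' with e | e
    · right
      refine ⟨e.symm, ?_⟩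
      rw [← e] at h''
      exact hdual' (wt_injective (add_left_cancel h''))
    · left
      refine ⟨?_, (hdual e).symm⟩
      rw [← e] at h'
      exact (wt_injective (add_right_cancel h')).symm
  · rcases eq_or_eq_of_wt_add hi h0' h' with e | e
    · left
      refine ⟨e.symm, ?_⟩
      rw [← e] at h'
      exact (hdual (wt_injective (add_left_cancel h'))).symm
    · right
      refine ⟨?_, hdual' e⟩
      rw [← e, add_comm] at h'
      exact (wt_injective (add_right_cancel h')).symm

theorem exists_entry_ne_zero {A : Module.End ℂ (V m)} (h : A ≠ 0) : ∃ i j, entry A i j ≠ 0 := by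
  by_contra! hn
  exact h (entry_ext fun i j => by rw [hn, entry_zero])

/-- Root spaces have dimension at most one. -/
theorem exists_eq_smul_of_inRootSpace {α : RootWt m} (hα : SuppIn k α) (h0 : α ≠ 0)
    {A B : Module.End ℂ (V m)} (hA : InRootSpace x k α A) (hB : InRootSpace x k α B)
    (hA0 : A ≠ 0) : ∃ c : ℂ, B = c • A := by
  rw [inRootSpace_iff hα] at hA hB
  obtain ⟨i, j, hij⟩ := exists_entry_ne_zero hA0
  refine ⟨entry B i j / entry A i j, ?_⟩
  set c := entry B i j / entry A i j
  -- The multiple `c` cancels the entry at `(i, j)`. The only other admissible place is the dual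
  -- one; its entry vanishes together with that at `(i, j)` when a form is preserved, and in type
  -- `a` that place lies outside the natural module.
  set C := B - c • A with hCdef
  have hC : C ∈ algG m x k := Submodule.sub_mem _ hB.1 (Submodule.smul_mem _ _ hA.1)
  have hCij : entry C i j = 0 := by
    rw [hCdef, entry_sub, entry_smul, div_mul_cancel₀ _ hij, sub_self]
  have hwt : ∀ i j, entry C i j ≠ 0 → wt i - wt j = α := by
    intro i j h
    rw [hCdef, entry_sub, entry_smul] at h
    by_cases h1 : entry A i j = 0
    · refine hB.2 i j fun h2 => h (by rw [h1, h2]; ring)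
    · exact hA.2 i j h1
  rw [← sub_eq_zero]
  by_contra hne
  obtain ⟨i', j', hij'⟩ := exists_entry_ne_zero hne
  have e1 := hA.2 i j hij
  have e2 := hwt i' j' hij'
  rcases eq_or_eq_dual_of_wt_sub (by rwa [e1]) (e1.trans e2.symm) with ⟨rfl, rfl⟩ | ⟨rfl, rfl⟩
  · exact hij' hCij
  · by_cases hx : x = .a
    · subst hx
      have h1 := mem_of_entry_ne_zero hC.1 hij'
      have h2 := mem_of_entry_ne_zero hA.1.1 hij
      cases j with
      | pos s => exact h1.1.1 rfl
      | bar s => exact h2.2.1 rfl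
      | zero => rcases h2.2 with h | h <;> cases h
    · have := entry_dual_ne_zero (hC.2 hx) hij'
      rw [Idx.dual_dual, Idx.dual_dual] at this
      exact this hCij

theorem suppIn_tilde (α : RootWt m) : SuppIn .tilde α := fun _ _ => trivial

theorem suppIn_neg {α : RootWt m} (h : SuppIn k α) : SuppIn k (-α) :=
  fun r hr => h r fun h0 => hr (by rw [Finsupp.neg_apply, h0, neg_zero])

/-- An element of the big algebra in a root space for a root of the subalgebra is in the
subalgebra. -/
theorem inRootSpace_iff_tilde {α : RootWt m} (hα : SuppIn k α) (h0 : α ≠ 0)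
    {A : Module.End ℂ (V m)} : InRootSpace x k α A ↔ InRootSpace x .tilde α A := by
  rw [inRootSpace_iff hα, inRootSpace_iff (suppIn_tilde α)]
  refine ⟨fun h => ⟨algG_le x k h.1, h.2⟩, fun h => ⟨⟨mem_gl_of_entry h.1.1 fun i j hij => ?_,
    h.1.2⟩, h.2⟩⟩
  have hm := mem_of_entry_ne_zero h.1.1 hij
  have hwt := h.2 i j hij
  have hne : i ≠ j := by
    rintro rfl
    exact h0 (by rw [← hwt, sub_self])
  -- The entry is off the diagonal because `α` is nonzero, so the index of `i` survives in `wt i -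
  -- wt j` and belongs to the support of `α`; likewise for `j`.
  have key : ∀ r, wtInt r i ≠ wtInt r j → r ∈ k.idx := by
    intro r hr
    refine hα r ?_
    rw [← hwt, Finsupp.sub_apply, wt_apply, wt_apply, sub_ne_zero]
    exact_mod_cast hr
  constructor
  · cases i with
    | pos r =>
      refine key r fun h => hne ?_
      rw [(wtInt_bounds (.pos r) r).2.2.1.2 rfl] at h
      exact ((wtInt_bounds j r).2.2.1.1 h.symm).symm
    | bar r =>
      refine ⟨hm.1.1, key r fun h => hne ?_⟩
      rw [(wtInt_bounds (.bar r) r).2.2.2.2 rfl] at h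
      exact ((wtInt_bounds j r).2.2.2.1 h.symm).symm
    | zero => exact hm.1
  · cases j with
    | pos r =>
      refine key r fun h => hne ?_
      rw [(wtInt_bounds (.pos r) r).2.2.1.2 rfl] at h
      exact (wtInt_bounds i r).2.2.1.1 h
    | bar r =>
      refine ⟨hm.2.1, key r fun h => hne ?_⟩
      rw [(wtInt_bounds (.bar r) r).2.2.2.2 rfl] at h
      exact (wtInt_bounds i r).2.2.2.1 h
    | zero => exact hm.2

theorem mem_roots_iff_tilde {α : RootWt m} :
    α ∈ roots m x k ↔ α ∈ roots m x .tilde ∧ SuppIn k α := by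
  constructor
  · rintro ⟨h0, hα, A, hA0, hA⟩
    exact ⟨⟨h0, suppIn_tilde α, A, hA0, (inRootSpace_iff_tilde hα h0).1 hA⟩, hα⟩
  · rintro ⟨⟨h0, -, A, hA0, hA⟩, hα⟩
    exact ⟨h0, hα, A, hA0, (inRootSpace_iff_tilde hα h0).2 hA⟩

theorem exists_wt_sub_of_mem_roots {α : RootWt m} (h : α ∈ roots m x k) :
    ∃ i j : Idx m, wt i - wt j = α := by
  obtain ⟨-, hα, A, hA0, hA⟩ := h
  obtain ⟨i, j, hij⟩ := exists_entry_ne_zero hA0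
  exact ⟨i, j, ((inRootSpace_iff hα).1 hA).2 i j hij⟩

/-- The classification of the roots. -/
theorem root_cases {α : RootWt m} (h : α ∈ roots m x k) :
    (∃ r ∈ k.idx, ∃ s ∈ k.idx, r ≠ s ∧ α = eps r - eps s) ∨
    ((x = .b ∨ x = .bBullet) ∧ ∃ r ∈ k.idx, α = eps r ∨ α = -eps r) ∨
    (x ≠ .a ∧ ∃ r ∈ k.idx, ∃ s ∈ k.idx, r ≠ s ∧ (α = eps r + eps s ∨ α = - eps r - eps s)) ∨
    (x ≠ .a ∧ ∃ r ∈ k.idx, (x = .c → ipar r = 0) ∧ (x = .d → ipar r = 1) ∧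
      (α = eps r + eps r ∨ α = - eps r - eps r)) := by
  obtain ⟨h0, hα, A, hA0, hA⟩ := h
  obtain ⟨i, j, hij⟩ := exists_entry_ne_zero hA0
  rw [inRootSpace_iff hα] at hA
  have hwt := hA.2 i j hij
  have hm := mem_of_entry_ne_zero hA.1.1 hij
  -- A place joining `v_r` to its dual is itself self-dual, so the form relates the entry to itself.
  -- A nonzero entry forces `formSign x * sgn (ipar r) = -1`, which is the parity restriction on the
  -- roots `±2ε_r` in types `c` and `d`.
  have hd : ∀ r, x ≠ .a → entry A (.pos r) (.bar r) ≠ 0 ∨ entry A (.bar r) (.pos r) ≠ 0 →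
      (x = .c → ipar r = 0) ∧ (x = .d → ipar r = 1) := by
    intro r hx hr
    have hp := preservesForm_iff_entry.1 (hA.1.2 hx)
    have hs : formSign x * sgn (ipar r) = -1 := by
      have hmul : ipar r * ipar r = ipar r := by
        rcases parity_cases (ipar r) with h | h <;> simp [h]
      rcases hr with hr | hr
      · have h1 := hp (.bar r) (.bar r)
        simp only [Idx.dual, formBasis, if_true, CharTwo.add_self_eq_zero, zero_mul, sgn_zero,
          one_mul, hmul] at h1
        refine mul_right_cancel₀ hr ?_
        linear_combination h1
      · have h1 := hp (.pos r) (.pos r)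
        simp only [Idx.dual, formBasis, if_true, CharTwo.add_self_eq_zero, zero_mul, sgn_zero,
          one_mul, hmul] at h1
        refine mul_right_cancel₀ hr ?_
        linear_combination h1
    constructor
    · rintro rfl
      rcases parity_cases (ipar r) with h | h
      · exact h
      · rw [h, formSign, sgn_one] at hs; norm_num at hs
    · rintro rfl
      rcases parity_cases (ipar r) with h | h
      · rw [h, formSign, sgn_zero] at hs; norm_num at hs
        all_goals simp
      · exact h
  rcases i with r | r | _ <;> rcases j with s | s | _ <;> simp only [wt] at hwt
  · left
    refine ⟨r, hm.1, s, hm.2, ?_, hwt.symm⟩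
    rintro rfl
    exact h0 (by rw [← hwt, sub_self])
  · right; right
    by_cases hrs : r = s
    · subst hrs
      right
      obtain ⟨d1, d2⟩ := hd r hm.2.1 (Or.inl hij)
      exact ⟨hm.2.1, r, hm.1, d1, d2, Or.inl (by rw [← hwt, sub_neg_eq_add])⟩
    · left
      exact ⟨hm.2.1, r, hm.1, s, hm.2.2, hrs, Or.inl (by rw [← hwt, sub_neg_eq_add])⟩
  · right; left
    exact ⟨hm.2, r, hm.1, Or.inl (by rw [← hwt, sub_zero])⟩
  · right; right
    by_cases hrs : r = s
    · subst hrs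
      right
      obtain ⟨d1, d2⟩ := hd r hm.1.1 (Or.inr hij)
      exact ⟨hm.1.1, r, hm.2, d1, d2, Or.inr hwt.symm⟩
    · left
      exact ⟨hm.1.1, r, hm.1.2, s, hm.2, hrs, Or.inr hwt.symm⟩
  · left
    refine ⟨s, hm.2.2, r, hm.1.2, ?_, ?_⟩
    · rintro rfl
      exact h0 (by rw [← hwt, sub_self])
    · rw [← hwt]; abel
  · right; left
    exact ⟨hm.2, r, hm.1.2, Or.inr (by rw [← hwt, sub_zero])⟩
  · right; left
    exact ⟨hm.1, s, hm.2, Or.inr (by rw [← hwt, zero_sub])⟩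
  · right; left
    exact ⟨hm.1, s, hm.2.2, Or.inl (by rw [← hwt]; simp)⟩
  · exact absurd hwt.symm (by simpa using h0)

end RootSpaces

end SuperKZ

namespace SuperKZ

/-! ### Positive roots of the subalgebras and of the big algebra. -/

section PositiveRoots

variable {m : ℕ} {x : LieType} {k : Flavor}

theorem exists_isLeast {S : Set (IPlus m)} (hS : S.Nonempty) : ∃ r, IsLeast S r := by
  obtain ⟨r, hr, hmin⟩ := (measure fun t : IPlus m => (t.1 + 2 * m).toNat).wf.has_min S hS
  refine ⟨r, hr, fun s hs => ?_⟩
  have h := hmin s hs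
  have h1 := r.2
  have h2 := s.2
  change ¬ ((s.1 + 2 * m).toNat < (r.1 + 2 * m).toNat) at h
  change r.1 ≤ s.1
  omega

theorem exists_gt_mem_idx (k : Flavor) (n : ℕ) : ∃ s : IPlus m, s ∈ k.idx ∧ (n : ℤ) < s.1 := by
  cases k with
  | tilde => exact ⟨⟨2 * n + 2, Or.inr (by omega)⟩, trivial, by simp; omega⟩
  | plain => exact ⟨⟨2 * n + 2, Or.inr (by omega)⟩, ⟨n + 1, by simp; ring⟩, by simp; omega⟩
  | bar => exact ⟨⟨2 * n + 1, Or.inr (by omega)⟩, Or.inr ⟨n, by simp⟩, by simp; omega⟩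

theorem exists_consec {r : IPlus m} (hr : r ∈ k.idx) : ∃ s, Consec k r s := by
  obtain ⟨s, hs⟩ := exists_isLeast (S := {s | s ∈ k.idx ∧ r < s}) (by
    obtain ⟨s, hs, h⟩ := exists_gt_mem_idx (m := m) k r.1.natAbs
    refine ⟨s, hs, ?_⟩
    change r.1 < s.1
    omega)
  exact ⟨s, hr, hs.1.1, hs.1.2, fun t ht h => absurd (hs.2 ⟨ht, h.1⟩) (not_le.2 h.2)⟩

theorem exists_least_consec (m : ℕ) (k : Flavor) :
    ∃ r s : IPlus m, IsLeast k.idx r ∧ Consec k r s := by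
  obtain ⟨t, ht, -⟩ := exists_gt_mem_idx (m := m) k 0
  obtain ⟨r, hr⟩ := exists_isLeast ⟨t, ht⟩
  obtain ⟨s, hs⟩ := exists_consec hr.1
  exact ⟨r, s, hr, hs⟩

/-- Telescoping along the chain between `r` and `s`. The upward closed predicate `P` lets one
induction serve both the full chain and the tail. -/
theorem eps_sub_eps_mem_of_consec {S : AddSubmonoid (RootWt m)} {P : IPlus m → Prop}
    (hP : ∀ r s, P r → r < s → P s) (hS : ∀ r s, P r → Consec k r s → eps r - eps s ∈ S)
    {r s : IPlus m} (hr : r ∈ k.idx) (hs : s ∈ k.idx) (hPr : P r) (hrs : r < s) :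
    eps r - eps s ∈ S := by
  have key : ∀ n : ℕ, ∀ r s : IPlus m, r ∈ k.idx → s ∈ k.idx → P r → r < s →
      (s.1 - r.1).toNat = n → eps r - eps s ∈ S := by
    intro n
    induction n using Nat.strong_induction_on with
    | _ n ih =>
      intro r s hr hs hPr hrs hn
      by_cases h : ∀ t ∈ k.idx, ¬ (r < t ∧ t < s)
      · exact hS r s hPr ⟨hr, hs, hrs, h⟩
      · push Not at h
        obtain ⟨t, ht, hrt, hts⟩ := h
        have h1 : r.1 < t.1 := hrt
        have h2 : t.1 < s.1 := hts
        have e1 := ih _ (by omega) r t hr ht hPr hrt rfl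
        have e2 := ih _ (by omega) t s ht hs (hP r t hPr hrt) hts rfl
        rw [← sub_add_sub_cancel (eps r) (eps t) (eps s)]
        exact S.add_mem e1 e2
  exact key _ r s hr hs hPr hrs rfl

theorem eps_sub_eps_mem_simple {r s : IPlus m} (hr : r ∈ k.idx) (hs : s ∈ k.idx) (h : r ≤ s) :
    eps r - eps s ∈ AddSubmonoid.closure (simpleRoots m x k) := by
  rcases h.eq_or_lt with rfl | h
  · rw [sub_self]; exact AddSubmonoid.zero_mem _
  · exact eps_sub_eps_mem_of_consec (P := fun _ => True) (fun _ _ _ _ => trivial)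
      (fun r s _ h => AddSubmonoid.subset_closure (Or.inl ⟨r, s, h, rfl⟩)) hr hs trivial h

theorem eps_sub_eps_mem_tail {r s : IPlus m} (hr : r ∈ k.idx) (hs : s ∈ k.idx) (h0 : 0 < r.1)
    (h : r < s) : eps r - eps s ∈ AddSubgroup.closure (tailRoots m k) :=
  eps_sub_eps_mem_of_consec (S := (AddSubgroup.closure (tailRoots m k)).toAddSubmonoid)
    (P := fun r => 0 < r.1) (fun _ _ h1 h2 => lt_trans h1 h2)
    (fun r s h1 h => AddSubgroup.subset_closure ⟨r, s, h1, h, rfl⟩) hr hs h0 h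

theorem neg_eps_mem_simple (hx : x = .b ∨ x = .bBullet) {r : IPlus m} (hr : r ∈ k.idx) :
    -eps r ∈ AddSubmonoid.closure (simpleRoots m x k) := by
  obtain ⟨r₀, s₀, h0, hc⟩ := exists_least_consec m k
  have h1 : -eps r₀ ∈ AddSubmonoid.closure (simpleRoots m x k) :=
    AddSubmonoid.subset_closure (Or.inr ⟨r₀, s₀, h0, hc, by rcases hx with rfl | rfl <;> rfl⟩)
  rw [show -eps r = -eps r₀ + (eps r₀ - eps r) by abel]
  exact AddSubmonoid.add_mem _ h1 (eps_sub_eps_mem_simple h0.1 hr (h0.2 hr))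

/-- In types `c` and `d` the additional simple root depends on the parity of the least
index. -/
theorem extra_simple_root (hx : x = .c ∨ x = .d) {r₀ s₀ : IPlus m} (h0 : IsLeast k.idx r₀)
    (hc : Consec k r₀ s₀) :
    (-eps r₀ - eps r₀ ∈ AddSubmonoid.closure (simpleRoots m x k)) ∨
    (-eps r₀ - eps s₀ ∈ AddSubmonoid.closure (simpleRoots m x k) ∧
      ¬ ((x = .c → ipar r₀ = 0) ∧ (x = .d → ipar r₀ = 1))) := by
  rcases hx with rfl | rfl
  · by_cases h : ipar r₀ = 0
    · left
      refine AddSubmonoid.subset_closure (Or.inr ⟨r₀, s₀, h0, hc, ?_⟩)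
      simp [h]
    · right
      refine ⟨AddSubmonoid.subset_closure (Or.inr ⟨r₀, s₀, h0, hc, ?_⟩), fun h' => h (h'.1 rfl)⟩
      simp [h]
  · by_cases h : ipar r₀ = 0
    · right
      refine ⟨AddSubmonoid.subset_closure (Or.inr ⟨r₀, s₀, h0, hc, ?_⟩), fun h' => ?_⟩
      · simp [h]
      · exact zero_ne_one (h.symm.trans (h'.2 rfl))
    · left
      refine AddSubmonoid.subset_closure (Or.inr ⟨r₀, s₀, h0, hc, ?_⟩)
      simp [h]

theorem lieType_cases (hx : x ≠ .a) : (x = .b ∨ x = .bBullet) ∨ (x = .c ∨ x = .d) := by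
  cases x <;> simp at hx ⊢

theorem neg_eps_sub_eps_mem_simple (hx : x ≠ .a) {r s : IPlus m} (hr : r ∈ k.idx) (hs : s ∈ k.idx)
    (hrs : r ≠ s) : -eps r - eps s ∈ AddSubmonoid.closure (simpleRoots m x k) := by
  wlog hlt : r < s generalizing r s
  · rw [show -eps r - eps s = -eps s - eps r by abel]
    exact this hs hr hrs.symm (lt_of_le_of_ne (not_lt.1 hlt) hrs.symm)
  rcases lieType_cases hx with hx | hx
  · rw [sub_eq_add_neg]
    exact AddSubmonoid.add_mem _ (neg_eps_mem_simple hx hr) (neg_eps_mem_simple hx hs)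
  · obtain ⟨r₀, s₀, h0, hc⟩ := exists_least_consec m k
    -- Since `s` is above `r`, it is not the least index and so is at least the successor `s₀`; this
    -- covers the form `-ε_{r₀} - ε_{s₀}` of the extra simple root.
    have hs0 : s₀ ≤ s := not_lt.1 fun h => hc.2.2.2 s hs ⟨lt_of_le_of_lt (h0.2 hr) hlt, h⟩
    have e1 := eps_sub_eps_mem_simple (x := x) h0.1 hr (h0.2 hr)
    rcases extra_simple_root hx h0 hc with h | ⟨h, -⟩
    · rw [show -eps r - eps s = -eps r₀ - eps r₀ + (eps r₀ - eps r) + (eps r₀ - eps s) by abel]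
      exact AddSubmonoid.add_mem _ (AddSubmonoid.add_mem _ h e1)
        (eps_sub_eps_mem_simple h0.1 hs (h0.2 hs))
    · rw [show -eps r - eps s = -eps r₀ - eps s₀ + (eps r₀ - eps r) + (eps s₀ - eps s) by abel]
      exact AddSubmonoid.add_mem _ (AddSubmonoid.add_mem _ h e1)
        (eps_sub_eps_mem_simple hc.2.1 hs hs0)

theorem neg_two_eps_mem_simple (hx : x ≠ .a) {r : IPlus m} (hr : r ∈ k.idx)
    (hpar : (x = .c → ipar r = 0) ∧ (x = .d → ipar r = 1)) :
    -eps r - eps r ∈ AddSubmonoid.closure (simpleRoots m x k) := by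
  rcases lieType_cases hx with hx | hx
  · rw [sub_eq_add_neg]
    exact AddSubmonoid.add_mem _ (neg_eps_mem_simple hx hr) (neg_eps_mem_simple hx hr)
  · obtain ⟨r₀, s₀, h0, hc⟩ := exists_least_consec m k
    have e1 := eps_sub_eps_mem_simple (x := x) h0.1 hr (h0.2 hr)
    rcases extra_simple_root hx h0 hc with h | ⟨h, h'⟩
    · rw [show -eps r - eps r = -eps r₀ - eps r₀ + (eps r₀ - eps r) + (eps r₀ - eps r) by abel]
      exact AddSubmonoid.add_mem _ (AddSubmonoid.add_mem _ h e1) e1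
    -- When the extra simple root is `-ε_{r₀} - ε_{s₀}`, the parity condition fails at `r₀`, so `r`
    -- is at least `s₀`.
    · have hne : r₀ ≠ r := by
        rintro rfl
        exact h' hpar
      have hs0 : s₀ ≤ r := not_lt.1 fun h => hc.2.2.2 r hr ⟨lt_of_le_of_ne (h0.2 hr) hne, h⟩
      rw [show -eps r - eps r = -eps r₀ - eps s₀ + (eps r₀ - eps r) + (eps s₀ - eps r) by abel]
      exact AddSubmonoid.add_mem _ (AddSubmonoid.add_mem _ h e1)
        (eps_sub_eps_mem_simple hc.2.1 hr hs0)

/-- Neighbours in a smaller index set need not be neighbours in the full one, so its simple roots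
are in general only sums of simple roots of the big algebra. -/
theorem closure_simpleRoots_le_tilde : AddSubmonoid.closure (simpleRoots m x k) ≤
    AddSubmonoid.closure (simpleRoots m x .tilde) := by
  rw [AddSubmonoid.closure_le]
  rintro α (⟨r, s, h, rfl⟩ | ⟨r, s, h0, hc, h⟩)
  · exact eps_sub_eps_mem_simple trivial trivial h.2.2.1.le
  · cases x with
    | a => exact h.elim
    | b => subst h; exact neg_eps_mem_simple (Or.inl rfl) trivial
    | bBullet => subst h; exact neg_eps_mem_simple (Or.inr rfl) trivial
    | c =>
      simp only at h
      split_ifs at h with hp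
      · subst h; exact neg_two_eps_mem_simple (by simp) trivial (by simp [hp])
      · subst h; exact neg_eps_sub_eps_mem_simple (by simp) trivial trivial hc.2.2.1.ne
    | d =>
      simp only at h
      split_ifs at h with hp
      · subst h; exact neg_eps_sub_eps_mem_simple (by simp) trivial trivial hc.2.2.1.ne
      · subst h
        exact neg_two_eps_mem_simple (by simp) trivial
          (by simpa using (parity_cases _).resolve_left hp)

theorem mem_or_neg_mem_of_mem_roots {α : RootWt m} (h : α ∈ roots m x k) :
    α ∈ AddSubmonoid.closure (simpleRoots m x k) ∨
      -α ∈ AddSubmonoid.closure (simpleRoots m x k) := by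
  rcases root_cases h with ⟨r, hr, s, hs, hrs, rfl⟩ | ⟨hx, r, hr, rfl | rfl⟩ |
    ⟨hx, r, hr, s, hs, hrs, rfl | rfl⟩ | ⟨hx, r, hr, h1, h2, rfl | rfl⟩
  · rcases hrs.lt_or_gt with h | h
    · exact Or.inl (eps_sub_eps_mem_simple hr hs h.le)
    · right
      rw [neg_sub]
      exact eps_sub_eps_mem_simple hs hr h.le
  · exact Or.inr (neg_eps_mem_simple hx hr)
  · exact Or.inl (neg_eps_mem_simple hx hr)
  · right
    rw [neg_add, ← sub_eq_add_neg]
    exact neg_eps_sub_eps_mem_simple hx hr hs hrs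
  · exact Or.inl (neg_eps_sub_eps_mem_simple hx hr hs hrs)
  · right
    rw [neg_add, ← sub_eq_add_neg]
    exact neg_two_eps_mem_simple hx hr ⟨h1, h2⟩
  · exact Or.inl (neg_two_eps_mem_simple hx hr ⟨h1, h2⟩)

open Classical in
/-- The sum of the coefficients at the indices from `r` on. -/
noncomputable def suffixSum (r : IPlus m) : RootWt m →ₗ[ℂ] ℂ :=
  Finsupp.linearCombination ℂ fun s => if r ≤ s then 1 else 0

theorem suffixSum_eps (r s : IPlus m) : suffixSum r (eps s) = if r ≤ s then 1 else 0 := by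
  simp [suffixSum, eps]

/-- A root `ε_r - ε_s` with `r < s` shifts weight to a later index with a minus sign, and the extra
simple roots have only negative coefficients, so every suffix sum of a simple root is a nonpositive
integer. -/
theorem suffixSum_of_mem {α : RootWt m} (h : α ∈ AddSubmonoid.closure (simpleRoots m x k))
    (t : IPlus m) : ∃ n : ℕ, suffixSum t α = -n := by
  have hneg : ∀ r s : IPlus m, ∃ n : ℕ, suffixSum t (-eps r - eps s) = -n := by
    intro r s
    rw [map_sub, map_neg, suffixSum_eps, suffixSum_eps]
    by_cases h1 : t ≤ r <;> by_cases h2 : t ≤ s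
    · exact ⟨2, by simp [h1, h2]; norm_num⟩
    · exact ⟨1, by simp [h1, h2]⟩
    · exact ⟨1, by simp [h1, h2]⟩
    · exact ⟨0, by simp [h1, h2]⟩
  have hneg1 : ∀ r : IPlus m, ∃ n : ℕ, suffixSum t (-eps r) = -n := by
    intro r
    rw [map_neg, suffixSum_eps]
    by_cases h1 : t ≤ r
    · exact ⟨1, by simp [h1]⟩
    · exact ⟨0, by simp [h1]⟩
  refine AddSubmonoid.closure_induction (motive := fun α _ => ∃ n : ℕ, suffixSum t α = -n) ?_ ?_ ?_ h
  · rintro α (⟨r, s, h, rfl⟩ | ⟨r, s, -, -, h⟩)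
    · rw [map_sub, suffixSum_eps, suffixSum_eps]
      by_cases h1 : t ≤ r
      · exact ⟨0, by simp [h1, h1.trans h.2.2.1.le]⟩
      · by_cases h2 : t ≤ s
        · exact ⟨1, by simp [h1, h2]⟩
        · exact ⟨0, by simp [h1, h2]⟩
    · cases x with
      | a => exact h.elim
      | b => subst h; exact hneg1 r
      | bBullet => subst h; exact hneg1 r
      | c =>
        simp only at h
        split_ifs at h <;> subst h <;> exact hneg _ _
      | d =>
        simp only at h
        split_ifs at h <;> subst h <;> exact hneg _ _
  · exact ⟨0, by simp⟩
  · rintro α β - - ⟨n, hn⟩ ⟨n', hn'⟩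
    exact ⟨n + n', by rw [map_add, hn, hn']; push_cast; ring⟩

/-- At the last index of the support the suffix sum is the coefficient itself. It would have to be
both nonpositive and nonnegative, hence zero. -/
theorem eq_zero_of_mem_of_neg_mem {α : RootWt m}
    (h : α ∈ AddSubmonoid.closure (simpleRoots m x k))
    (h' : -α ∈ AddSubmonoid.closure (simpleRoots m x k)) : α = 0 := by
  classical
  by_contra hne
  have hsupp : α.support.Nonempty := Finsupp.support_nonempty_iff.2 hne
  set t := α.support.max' hsupp
  have ht : α t ≠ 0 := Finsupp.mem_support_iff.1 (α.support.max'_mem hsupp)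
  have h1 : suffixSum t α = α t := by
    rw [suffixSum, Finsupp.linearCombination_apply, Finsupp.sum, Finset.sum_eq_single t]
    · simp
    · intro s hs hst
      have hlt : s < t := lt_of_le_of_ne (α.support.le_max' s hs) hst
      simp [not_le.2 hlt]
    · intro h; simp [Finsupp.notMem_support_iff.1 h]
  obtain ⟨n, hn⟩ := suffixSum_of_mem h t
  obtain ⟨n', hn'⟩ := suffixSum_of_mem h' t
  rw [map_neg, hn, neg_neg] at hn'
  have h2 : ((n + n' : ℕ) : ℂ) = 0 := by push_cast; rw [hn']; ring
  have h3 : n = 0 := by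
    have : n + n' = 0 := by exact_mod_cast h2
    omega
  exact ht (by rw [← h1, hn, h3]; simp)

/-- The positive roots of the subalgebra are the positive roots of the big algebra which are
in the dual of its Cartan subalgebra. -/
theorem mem_posRoots_iff_tilde {α : RootWt m} :
    α ∈ posRoots m x k ↔ α ∈ posRoots m x .tilde ∧ SuppIn k α := by
  constructor
  · rintro ⟨h, h'⟩
    have h1 := mem_roots_iff_tilde.1 h
    exact ⟨⟨h1.1, closure_simpleRoots_le_tilde h'⟩, h1.2⟩
  · rintro ⟨⟨h, h'⟩, hα⟩
    have h1 : α ∈ roots m x k := mem_roots_iff_tilde.2 ⟨h, hα⟩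
    -- If the opposite root were positive for the subalgebra, then both signs would be positive in
    -- the big algebra.
    refine ⟨h1, (mem_or_neg_mem_of_mem_roots h1).resolve_right fun h2 => ?_⟩
    exact h1.1 (eq_zero_of_mem_of_neg_mem h' (closure_simpleRoots_le_tilde h2))

end PositiveRoots

end SuperKZ

namespace SuperKZ

/-! ### Matrix units of the tail -/

section Tail

variable {m : ℕ} {x : LieType}

open Classical in
theorem matUnit_mul (i j l n : Idx m) :
    matUnit i j * matUnit l n = if j = l then matUnit i n else 0 := by
  refine ext_vec fun s => ?_
  by_cases hs : s = n
  · by_cases h : j = l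
    · simp [matUnit_vec, hs, h]
    · simp [matUnit_vec, hs, h, Ne.symm h]
  · by_cases h : j = l <;> simp [matUnit_vec, hs, h]

open Classical in
/-- The coefficient of the barred part of `tailMat`. -/
noncomputable def tailCoeff (x : LieType) (r s : IPlus m) : ℂ :=
  if x = .a then 0 else -(sgn (ipar r * ipar s) * sgn (ipar s))

/-- The element of the Lie superalgebra whose unbarred part is `E_{rs}`. -/
noncomputable def tailMat (x : LieType) (r s : IPlus m) : Module.End ℂ (V m) :=
  matUnit (.pos r) (.pos s) + tailCoeff x r s • matUnit (.bar s) (.bar r)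

open Classical in
theorem entry_tailMat (r s : IPlus m) (i j : Idx m) : entry (tailMat x r s) i j =
    (if i = .pos r ∧ j = .pos s then 1 else 0)
      + tailCoeff x r s * (if i = .bar s ∧ j = .bar r then 1 else 0) := by
  rw [tailMat, entry_add, entry_smul, entry_matUnit, entry_matUnit]

/-- The form condition determines the barred entry from the unbarred one; `tailCoeff` is the
resulting sign, and it is zero in type `a`, where barred vectors are absent. -/
theorem tailMat_mem (r s : IPlus m) : tailMat x r s ∈ algG m x .tilde := by
  classical
  refine ⟨Submodule.add_mem _ (Submodule.subset_span ⟨.pos r, trivial, .pos s, trivial, rfl⟩) ?_,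
    fun hx => ?_⟩
  · by_cases hx : x = .a
    · rw [tailCoeff, if_pos hx, zero_smul]; exact Submodule.zero_mem _
    · exact Submodule.smul_mem _ _ (Submodule.subset_span
        ⟨.bar s, ⟨hx, trivial⟩, .bar r, ⟨hx, trivial⟩, rfl⟩)
  · rw [preservesForm_iff_entry]
    have hsq : ∀ p : ZMod 2, p * p = p := by decide
    have h2 : sgn ((ipar r + ipar s) * ipar r) = sgn (ipar r) * sgn (ipar r * ipar s) := by
      rw [← sgn_add, add_mul, hsq, mul_comm (ipar s)]
    have h3 : sgn ((ipar s + ipar r) * ipar s) = sgn (ipar s) * sgn (ipar r * ipar s) := by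
      rw [← sgn_add, add_mul, hsq]
    have s1 := sgn_sq (ipar s)
    have s2 := sgn_sq (ipar r * ipar s)
    have s3 := sgn_sq (ipar r)
    rintro (i | i | _) (j | j | _) <;>
      simp only [Idx.dual, entry_tailMat, formBasis, reduceCtorEq, and_false, false_and,
        Idx.pos.injEq, Idx.bar.injEq, if_true, if_false, mul_zero, add_zero, zero_add,
        one_mul, par]
    · by_cases hi : i = s <;> by_cases hj : j = r <;> simp [hi, hj]
      simp only [tailCoeff, hx, if_false, h3]
      linear_combination -s1 * sgn (ipar r * ipar s) * sgn (ipar r * ipar s) - s2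
    · by_cases hi : i = r <;> by_cases hj : j = s <;> simp [hi, hj]
      simp only [tailCoeff, hx, if_false, h2, hsq]
      linear_combination formSign x * sgn (ipar r * ipar s) * (s3 - s1)

theorem tailMat_self (r : IPlus m) : tailMat x r r = cartanE x r := by
  have h : sgn (ipar r * ipar r) * sgn (ipar r) = 1 := by
    have hsq : ∀ p : ZMod 2, p * p = p := by decide
    rw [hsq, sgn_sq]
  cases x <;> simp [tailMat, tailCoeff, cartanE, h, sub_eq_add_neg]

theorem tailMat_homog (r s : IPlus m) :
    parOp x * tailMat x r s * parOp x = sgn (ipar r + ipar s) • tailMat x r s := by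
  refine entry_ext fun i j => ?_
  rw [parOp, entry_mul_diag, entry_diag_mul, entry_smul, entry_tailMat]
  by_cases h1 : i = .pos r ∧ j = .pos s
  · obtain ⟨rfl, rfl⟩ := h1
    simp [par, sgn_add, mul_comm]
  · by_cases h2 : i = .bar s ∧ j = .bar r
    · obtain ⟨rfl, rfl⟩ := h2
      simp [par, sgn_add, mul_assoc]
    · simp [h1, h2]

-- The unbarred parts multiply as matrix units, and the barred parts, up to sign, as matrix units in
-- the opposite order. That the signs `tailCoeff` fit together is checked over all parities.
open Classical in
theorem tailMat_bracket (a b c d : IPlus m) :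
    superBracket (parOp x) (tailMat x a b) (tailMat x c d) =
      (if b = c then tailMat x a d else 0) - (if a = d then
        sgn ((ipar a + ipar b) * (ipar c + ipar d)) • tailMat x c b else 0) := by
  rw [superBracket_of_homog (tailMat_homog a b) (tailMat_homog c d)]
  have hmul : ∀ a b c d : IPlus m, tailMat x a b * tailMat x c d =
      (if b = c then matUnit (.pos a) (.pos d) else 0) +
      (if a = d then (tailCoeff x a b * tailCoeff x c d) • matUnit (.bar b) (.bar c) else 0) := by
    intro a b c d
    simp only [tailMat, add_mul, mul_add, smul_mul_assoc, mul_smul_comm, matUnit_mul, reduceCtorEq,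
      if_false, smul_zero, zero_add, add_zero, Idx.pos.injEq, Idx.bar.injEq, smul_smul]
    split_ifs <;> simp [mul_comm]
  have hsq : ∀ p : ZMod 2, p * p = p := by decide
  rw [hmul, hmul, smul_add, smul_ite, smul_ite, smul_zero, smul_smul]
  have h1 : a = d → tailCoeff x a b * tailCoeff x c d =
      -(sgn ((ipar a + ipar b) * (ipar c + ipar d)) * tailCoeff x c b) := by
    rintro rfl
    simp only [tailCoeff]
    split_ifs
    · simp
    · generalize ipar a = p
      generalize ipar b = q
      generalize ipar c = r
      rcases parity_cases p with rfl | rfl <;> rcases parity_cases q with rfl | rfl <;>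
        rcases parity_cases r with rfl | rfl <;> simp [sgn_zero, sgn_one, CharTwo.add_self_eq_zero]
  have h2 : b = c → sgn ((ipar a + ipar b) * (ipar c + ipar d)) *
      (tailCoeff x c d * tailCoeff x a b) = - tailCoeff x a d := by
    rintro rfl
    simp only [tailCoeff]
    split_ifs
    · simp
    · generalize ipar a = p
      generalize ipar b = q
      generalize ipar d = r
      rcases parity_cases p with rfl | rfl <;> rcases parity_cases q with rfl | rfl <;>
        rcases parity_cases r with rfl | rfl <;> simp [sgn_zero, sgn_one, CharTwo.add_self_eq_zero]
  by_cases hbc : b = c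
  · have h2' := h2 hbc
    by_cases had : a = d
    · have h1' := h1 had
      subst hbc had
      simp only [if_true]
      rw [h1', h2', tailMat, tailMat]
      simp only [smul_add, neg_smul, smul_smul]
      abel
    · subst hbc
      simp only [if_true, if_neg had, if_neg (Ne.symm had)]
      rw [h2', tailMat]
      simp
  · by_cases had : a = d
    · have h1' := h1 had
      subst had
      simp only [if_true, if_neg hbc, if_neg (Ne.symm hbc)]
      rw [h1', tailMat]
      simp [smul_smul, sub_eq_add_neg, add_comm]
    · simp [hbc, had, Ne.symm hbc, Ne.symm had]

theorem J_even : parOp x * J m * parOp x = sgn 0 • J m := by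
  have : parOp x * J m = J m * parOp x := by
    refine ext_vec fun i => ?_
    simp [J, parOp, diag_vec, smul_smul, mul_comm]
  rw [this, mul_assoc, parOp_sq, mul_one, sgn_zero, one_smul]

/-- The operator `J` is `-1` on all unbarred tail vectors and `0` on barred ones, so it commutes
with `tailMat x a b`. The tail therefore acts without a central term. -/
theorem cocycle_tailMat {a b : IPlus m} (ha : 0 < a.1) (hb : 0 < b.1)
    (A : Module.End ℂ (V m)) : cocycle x (tailMat x a b) A = 0 := by
  have h : superBracket (parOp x) (J m) (tailMat x a b) = 0 := by
    rw [superBracket_of_homog J_even (tailMat_homog a b), zero_mul, sgn_zero, one_smul, J, tailMat,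
      mul_add, add_mul, mul_smul_comm, smul_mul_assoc, diag_mul_matUnit, diag_mul_matUnit,
      matUnit_mul_diag, matUnit_mul_diag]
    simp [delta, ha, hb]
  rw [cocycle, h]
  simp [str]

/-- The element `tailMat` of the central extension. -/
noncomputable def tailElt (x : LieType) (r s : IPlus m) : algg m x .tilde :=
  toAlgg ⟨tailMat x r s, tailMat_mem r s⟩

theorem tailElt_self (r : IPlus m) : tailElt x r r = Eelt (k := .tilde) r trivial :=
  Subtype.ext (Prod.ext (tailMat_self r) rfl)

theorem isHomog_tailElt (r s : IPlus m) : IsHomog x (ipar r + ipar s) (tailElt x r s).1 :=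
  ⟨tailMat_homog r s, by simp [tailElt, toAlgg]⟩

open Classical in
theorem bracket_tailElt {a b : IPlus m} (ha : 0 < a.1) (hb : 0 < b.1) (c d : IPlus m) :
    (⟨bracket x (tailElt x a b).1 (tailElt x c d).1, bracket_mem (tailElt x a b).2
      (tailElt x c d).2⟩ : algg m x .tilde) =
      (if b = c then tailElt x a d else 0) - (if a = d then
        sgn ((ipar a + ipar b) * (ipar c + ipar d)) • tailElt x c b else 0) := by
  refine Subtype.ext (Prod.ext ?_ ?_)
  · change superBracket (parOp x) (tailMat x a b) (tailMat x c d) = _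
    rw [tailMat_bracket]
    by_cases h1 : b = c <;> by_cases h2 : a = d <;> simp [h1, h2, tailElt, toAlgg]
  · change cocycle x (tailMat x a b) (tailMat x c d) = _
    rw [cocycle_tailMat ha hb]
    by_cases h1 : b = c <;> by_cases h2 : a = d <;> simp [h1, h2, tailElt, toAlgg]

/-- The action of the matrix units of the tail. -/
noncomputable def SuperRep.tailAction {M : Type*} [AddCommGroup M] [Module ℂ M]
    (R : SuperRep m x .tilde M) {T : Type*} [DecidableEq T] (f : T → IPlus m)
    (hf : Function.Injective f) (hpos : ∀ t, 0 < (f t).1) : GLAction T M where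
  par t := ipar (f t)
  e a b := R.act (tailElt x (f a) (f b))
  comm a b c d u := by
    classical
    have h := R.act_bracket _ _ (tailElt x (f a) (f b)) (tailElt x (f c) (f d))
      (isHomog_tailElt _ _) (isHomog_tailElt _ _)
    rw [bracket_tailElt (hpos a) (hpos b)] at h
    have h1 := congrArg (fun F : Module.End ℂ M => F u) h
    simp only [hf.eq_iff, map_sub, LinearMap.sub_apply, Module.End.mul_apply,
      LinearMap.smul_apply] at h1
    rw [sub_eq_iff_eq_add'.1 h1.symm, add_sub_assoc]
    by_cases h1 : b = c <;> by_cases h2 : a = d <;> simp [h1, h2]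

end Tail

end SuperKZ

namespace SuperKZ

/-! ### Weights of the modules in the parabolic category -/

section Levi

variable {m : ℕ} {x : LieType}

/-- These two invariants separate the Levi roots from all others: the coefficient sum rules out
`±ε_r`, `±(ε_r + ε_s)` and `±2ε_r`, and the support condition makes both indices of `ε_r - ε_s`
positive. -/
theorem tail_closure_cases {α : RootWt m} (h : α ∈ AddSubgroup.closure (tailRoots m .tilde)) :
    Finsupp.linearCombination ℂ (fun _ : IPlus m => (1 : ℂ)) α = 0 ∧
      ∀ r : IPlus m, ¬ 0 < r.1 → α r = 0 := by
  refine AddSubgroup.closure_induction (p := fun α _ =>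
    Finsupp.linearCombination ℂ (fun _ : IPlus m => (1 : ℂ)) α = 0 ∧
      ∀ r : IPlus m, ¬ 0 < r.1 → α r = 0) ?_ ?_ ?_ ?_ h
  · rintro α ⟨r, s, hr, hrs, rfl⟩
    refine ⟨by simp [eps], fun t ht => ?_⟩
    have h1 : r ≠ t := by rintro rfl; exact ht hr
    have h2 : s ≠ t := by rintro rfl; exact ht (lt_trans hr hrs.2.2.1)
    simp [eps, h1, h2]
  · simp
  · rintro α β - - ⟨h1, h2⟩ ⟨h3, h4⟩
    exact ⟨by rw [map_add, h1, h3, add_zero], fun r hr => by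
      rw [Finsupp.add_apply, h2 r hr, h4 r hr, add_zero]⟩
  · rintro α - ⟨h1, h2⟩
    exact ⟨by rw [map_neg, h1, neg_zero], fun r hr => by rw [Finsupp.neg_apply, h2 r hr, neg_zero]⟩

theorem leviRoots_cases {α : RootWt m} (h : α ∈ leviRoots m x .tilde) :
    ∃ r s : IPlus m, 0 < r.1 ∧ 0 < s.1 ∧ r ≠ s ∧ α = eps r - eps s := by
  obtain ⟨h1, h2⟩ := tail_closure_cases h.2
  rcases root_cases h.1 with ⟨r, -, s, -, hrs, rfl⟩ | ⟨-, r, -, rfl | rfl⟩ |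
    ⟨-, r, -, s, -, -, rfl | rfl⟩ | ⟨-, r, -, -, -, rfl | rfl⟩
  · refine ⟨r, s, ?_, ?_, hrs, rfl⟩
    · by_contra hr
      have := h2 r hr
      simp [eps, hrs.symm] at this
    · by_contra hs
      have := h2 s hs
      simp [eps, hrs] at this
  all_goals
    exfalso
    simp [eps] at h1
    try norm_num at h1

theorem tailMat_ne_zero (r s : IPlus m) : tailMat x r s ≠ 0 := by
  classical
  intro h
  have h1 := entry_tailMat (x := x) r s (.pos r) (.pos s)
  rw [h, entry_zero] at h1
  simp at h1

theorem eps_sub_eps_ne_zero {r s : IPlus m} (h : r ≠ s) : eps r - eps s ≠ (0 : RootWt m) := by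
  intro h0
  have := DFunLike.congr_fun h0 r
  simp [eps, h.symm] at this

theorem inRootSpace_tailMat (r s : IPlus m) :
    InRootSpace x .tilde (eps r - eps s) (tailMat x r s) := by
  classical
  rw [inRootSpace_iff (suppIn_tilde _)]
  refine ⟨tailMat_mem r s, fun i j h => ?_⟩
  rw [entry_tailMat] at h
  by_cases h1 : i = .pos r ∧ j = .pos s
  · rw [h1.1, h1.2]; rfl
  · by_cases h2 : i = .bar s ∧ j = .bar r
    · rw [h2.1, h2.2]; simp only [wt]; abel
    · simp [h1, h2] at h

theorem eps_sub_eps_mem_leviRoots {r s : IPlus m} (hr : 0 < r.1) (hs : 0 < s.1) (h : r ≠ s) :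
    eps r - eps s ∈ leviRoots m x .tilde := by
  refine ⟨⟨eps_sub_eps_ne_zero h, suppIn_tilde _, _, tailMat_ne_zero r s,
    inRootSpace_tailMat r s⟩, ?_⟩
  rcases h.lt_or_gt with h | h
  · exact eps_sub_eps_mem_tail trivial trivial hr h
  · rw [← neg_sub]
    exact AddSubgroup.neg_mem _ (eps_sub_eps_mem_tail trivial trivial hs h)

theorem eps_sub_eps_mem_posRoots {r s : IPlus m} (h : r < s) :
    eps r - eps s ∈ posRoots m x .tilde :=
  ⟨⟨eps_sub_eps_ne_zero h.ne, suppIn_tilde _, _, tailMat_ne_zero r s, inRootSpace_tailMat r s⟩,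
    eps_sub_eps_mem_simple trivial trivial h.le⟩

theorem tailElt_mem_levi {r s : IPlus m} (hr : 0 < r.1) (hs : 0 < s.1) :
    tailElt x r s ∈ levi m x .tilde := by
  refine Submodule.subset_span ?_
  by_cases h : r = s
  · subst h
    exact Or.inr (Or.inl ⟨r, trivial, tailElt_self r⟩)
  · exact Or.inr (Or.inr ⟨_, eps_sub_eps_mem_leviRoots hr hs h, inRootSpace_tailMat r s, rfl⟩)

theorem wt_apply_of_neg {r s t : IPlus m} (hr : 0 < r.1) (hs : 0 < s.1) (ht : ¬ 0 < t.1) :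
    (eps r - eps s) t = 0 := by
  have h1 : r ≠ t := by rintro rfl; exact ht hr
  have h2 : s ≠ t := by rintro rfl; exact ht hs
  simp [eps, h1, h2]

theorem cartanE_mul_tailMat {r s t : IPlus m} (hr : 0 < r.1) (hs : 0 < s.1) (ht : ¬ 0 < t.1) :
    cartanE x t * tailMat x r s = tailMat x r s * cartanE x t := by
  have h := (inRootSpace_tailMat (x := x) r s).2 t trivial
  rw [superBracket_cartanE, wt_apply_of_neg hr hs ht, zero_smul] at h
  exact sub_eq_zero.1 h

end Levi

/-! ### Irreducible Levi modules as irreducible modules over the matrix units of the tail. -/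

namespace SuperRep

variable {m : ℕ} {x : LieType} {M : Type*} [AddCommGroup M] [Module ℂ M]

theorem act_Kelt_comm (R : SuperRep m x .tilde M) {p : ZMod 2} {X : algg m x .tilde}
    (hX : IsHomog x p X.1) : R.act Kelt * R.act X = R.act X * R.act Kelt := by
  have h := R.act_bracket 0 p Kelt X ⟨by simp [Kelt], by simp [sgn_zero]⟩ hX
  have h0 : (⟨bracket x (Kelt (k := .tilde) (x := x) (m := m)).1 X.1,
      bracket_mem Kelt.2 X.2⟩ : algg m x .tilde) = 0 := by
    refine Subtype.ext (Prod.ext ?_ ?_)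
    · change superBracket (parOp x) 0 X.1.1 = 0
      simp [superBracket, opPart]
    · change cocycle x 0 X.1.1 = 0
      simp [cocycle, superBracket, opPart, str]
  rw [h0, map_zero, zero_mul, sgn_zero, one_smul] at h
  exact sub_eq_zero.1 h.symm

/-- The subspace on which the central element and the Cartan elements outside the tail act
by the scalars given by `μ`. -/
def outerSpace (R : SuperRep m x .tilde M) (μ : Wt m) : Submodule ℂ M where
  carrier := {v | R.act Kelt v = μ.1 • v ∧
    ∀ r : IPlus m, ¬ 0 < r.1 → R.act (Eelt r trivial) v = μ.2 r • v}
  zero_mem' := by simp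
  add_mem' := by
    rintro v w ⟨h1, h2⟩ ⟨h3, h4⟩
    exact ⟨by rw [map_add, h1, h3, smul_add], fun r hr => by
      rw [map_add, h2 r hr, h4 r hr, smul_add]⟩
  smul_mem' := by
    rintro c v ⟨h1, h2⟩
    exact ⟨by rw [map_smul, h1, smul_comm], fun r hr => by rw [map_smul, h2 r hr, smul_comm]⟩

theorem tailElt_mem_outerSpace (R : SuperRep m x .tilde M) (μ : Wt m) {r s : IPlus m}
    (hr : 0 < r.1) (hs : 0 < s.1) {v : M} (hv : v ∈ R.outerSpace μ) :
    R.act (tailElt x r s) v ∈ R.outerSpace μ := by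
  refine ⟨?_, fun t ht => ?_⟩
  · have h := congrArg (fun F : Module.End ℂ M => F v) (R.act_Kelt_comm (isHomog_tailElt r s))
    simp only [Module.End.mul_apply] at h
    rw [h, hv.1, map_smul]
  · have h := congrArg (fun F : Module.End ℂ M => F v)
      (R.act_comm t trivial (tailElt x r s) (cartanE_mul_tailMat hr hs ht))
    simp only [Module.End.mul_apply] at h
    rw [h, hv.2 t ht, map_smul]

/-- On `outerSpace` the remaining Cartan generators act by scalars, and each Levi root space is a
line spanned by a matrix of the tail, so only the tail units have to be tested. -/
theorem leviStable_of_le_outerSpace (R : SuperRep m x .tilde M) {μ : Wt m} {D : Submodule ℂ M}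
    (hD : D ≤ R.outerSpace μ)
    (h : ∀ r s : IPlus m, 0 < r.1 → 0 < s.1 → ∀ v ∈ D, R.act (tailElt x r s) v ∈ D) :
    R.LeviStable D := by
  intro X hX v hv
  refine Submodule.span_induction (p := fun X _ => R.act X v ∈ D) ?_ ?_ ?_ ?_ hX
  · rintro X (rfl | ⟨r, hr, rfl⟩ | ⟨α, hα, hX, h0⟩)
    · rw [(hD hv).1]; exact D.smul_mem _ hv
    · by_cases h0 : 0 < r.1
      · have := h r r h0 h0 v hv
        rwa [tailElt_self] at this
      · rw [(hD hv).2 r h0]; exact D.smul_mem _ hv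
    · obtain ⟨r, s, hr, hs, hrs, rfl⟩ := leviRoots_cases hα
      obtain ⟨c, hc⟩ := exists_eq_smul_of_inRootSpace (suppIn_tilde _) (eps_sub_eps_ne_zero hrs)
        (inRootSpace_tailMat r s) hX (tailMat_ne_zero r s)
      have : X = c • tailElt x r s := by
        refine Subtype.ext (Prod.ext hc ?_)
        rw [h0]
        exact (mul_zero c).symm
      rw [this, map_smul]
      exact D.smul_mem _ (h r s hr hs v hv)
  · simp
  · intro X Y _ _ h1 h2
    rw [map_add]; exact D.add_mem h1 h2
  · intro c X _ h1
    rw [map_smul]; exact D.smul_mem _ h1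

/-- The scalars at the highest weight vector persist: the tail commutes with `K` and with the outer
Cartan elements, so intersecting with `outerSpace` gives a nonzero stable subspace, which must be
all of `N`. -/
theorem IsLeviIrreducible.le_outerSpace {R : SuperRep m x .tilde M} {μ : Wt m} {N : Submodule ℂ M}
    (hN : R.IsLeviIrreducible μ N) : N ≤ R.outerSpace μ := by
  obtain ⟨hst, hirr, v, hvN, hv0, hv, -⟩ := hN
  have h := hirr (N ⊓ R.outerSpace μ) inf_le_left
    (R.leviStable_of_le_outerSpace (μ := μ) inf_le_right fun r s hr hs u hu =>
      ⟨hst _ (tailElt_mem_levi hr hs) u hu.1, R.tailElt_mem_outerSpace μ hr hs hu.2⟩)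
  rcases h with h | h
  · refine absurd ?_ hv0
    have : v ∈ N ⊓ R.outerSpace μ := ⟨hvN, hv.1, fun r _ => hv.2 r trivial⟩
    rwa [h, Submodule.mem_bot] at this
  · exact inf_eq_left.1 h

theorem IsLeviIrreducible.irred {R : SuperRep m x .tilde M} {μ : Wt m} {N : Submodule ℂ M}
    (hN : R.IsLeviIrreducible μ N) {T : Type*} [DecidableEq T] {f : T → IPlus m}
    (hf : Function.Injective f) (hpos : ∀ t, 0 < (f t).1)
    (hsurj : ∀ r : IPlus m, 0 < r.1 → ∃ t, f t = r) : (R.tailAction f hf hpos).Irred N := by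
  refine ⟨fun a b u hu => hN.1 _ (tailElt_mem_levi (hpos a) (hpos b)) u hu, fun D hD hst => ?_⟩
  refine hN.2.1 D hD (R.leviStable_of_le_outerSpace (hD.trans hN.le_outerSpace)
    fun r s hr hs v hv => ?_)
  obtain ⟨a, rfl⟩ := hsurj r hr
  obtain ⟨b, rfl⟩ := hsurj s hs
  exact hst a b v hv

/-- The enumeration of the indices of the tail in which `inl a` is an integer. -/
def intFirst (m : ℕ) : ℕ ⊕ ℕ → IPlus m
  | .inl a => ⟨2 * a + 2, Or.inr (by omega)⟩
  | .inr b => ⟨2 * b + 1, Or.inr (by omega)⟩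

/-- The enumeration of the indices of the tail in which `inl a` is a proper half-integer. -/
def halfFirst (m : ℕ) : ℕ ⊕ ℕ → IPlus m
  | .inl a => ⟨2 * a + 1, Or.inr (by omega)⟩
  | .inr b => ⟨2 * b + 2, Or.inr (by omega)⟩

/-- If the tail is enumerated in a way compatible with the highest weight, then the Cartan elements
of the first family have natural eigenvalues on irreducible modules of the Levi
subalgebra. -/
theorem IsLeviIrreducible.le_iSup_eigenspace {R : SuperRep m x .tilde M} {μ : Wt m}
    {N : Submodule ℂ M} (hN : R.IsLeviIrreducible μ N) {f : ℕ ⊕ ℕ → IPlus m}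
    (hf : Function.Injective f) (hpos : ∀ t, 0 < (f t).1)
    (hsurj : ∀ r : IPlus m, 0 < r.1 → ∃ t, f t = r)
    (hpar : ∀ a b, ipar (f (.inl a)) ≠ ipar (f (.inr b))) {al be p q : ℕ → ℕ}
    (hpart : ∀ a b, b < al a ↔ a < be b) (hpq : ∀ a b, p b ≤ a ↔ b < q a)
    (hlt : ∀ s t, GLAction.shuffle p s t → f s < f t)
    (hwt : ∀ t, μ.2 (f t) = GLAction.shuffleWt al be p q t) (a : ℕ) :
    N ≤ ⨆ k : ℕ, (R.act (Eelt (f (.inl a)) trivial)).eigenspace (k : ℂ) := by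
  obtain ⟨v, hvN, hv0, hv, hpv⟩ := hN.2.2
  have h := GLAction.le_iSup_eigenspace_of_partition (hN.irred hf hpos hsurj) hpar hpart hpq hvN hv0
    ⟨fun s t hst => ?_, fun t => ?_⟩ a
  · change N ≤ ⨆ k : ℕ, (R.act (tailElt x (f (.inl a)) (f (.inl a)))).eigenspace (k : ℂ) at h
    rwa [tailElt_self] at h
  · exact hpv _ (eps_sub_eps_mem_leviRoots (hpos s) (hpos t) (hlt s t hst).ne)
      (eps_sub_eps_mem_posRoots (hlt s t hst)) ⟨_, tailMat_mem _ _⟩ (inRootSpace_tailMat _ _)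
  · change R.act (tailElt x (f t) (f t)) v = _
    rw [tailElt_self, hv.2 (f t) trivial, hwt]

end SuperRep

theorem domCoeff_even (Y : YoungDiagram) (a : ℕ) :
    domCoeff .tilde Y (2 * (a + 1)) = Y.rowLen a - (a + 1) := by
  simp only [domCoeff]
  rw [if_pos (even_two_mul _), Nat.mul_div_cancel_left _ two_pos, Nat.add_sub_cancel]

theorem domCoeff_odd (Y : YoungDiagram) (a : ℕ) :
    domCoeff .tilde Y (2 * a + 1) = Y.colLen a - a := by
  simp only [domCoeff]
  rw [if_neg (Nat.not_even_two_mul_add_one a), Nat.add_sub_cancel,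
    Nat.mul_div_cancel_left _ two_pos]

/-! ### Natural eigenvalues of the Cartan elements of the tail. -/

namespace ModO

variable {m : ℕ} {x : LieType} {M : Type*} [AddCommGroup M] [Module ℂ M]

/-- The Cartan elements of the tail act diagonalizably with natural eigenvalues on the
modules of the parabolic category. -/
theorem iSup_eigenspace_eq_top (R : ModO m x .tilde M) {r : IPlus m} (hr : 0 < r.1) :
    ⨆ k : ℕ, (R.act (Eelt r trivial)).eigenspace (k : ℂ) = ⊤ := by
  obtain ⟨S, -, hS, hirr⟩ := R.levi_decomp
  rw [← top_le_iff, ← hS]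
  refine sSup_le fun N hN => ?_
  obtain ⟨μ, hμ, hNμ⟩ := hirr N hN
  obtain ⟨-, -, Y, hY⟩ := hμ
  have key : ∀ a b, b < Y.rowLen a ↔ a < Y.colLen b := fun a b => by
    rw [← YoungDiagram.mem_iff_lt_rowLen, YoungDiagram.mem_iff_lt_colLen]
  have h2 : (2 : ZMod 2) = 0 := by decide
  -- The family containing `r` is always taken as `inl`, with the rows of the diagram for integers
  -- and the columns for proper half-integers.
  rcases Int.even_or_odd r.1 with he | he
  · obtain ⟨c, hc⟩ := he
    have hf : r = SuperRep.intFirst m (.inl (c - 1).toNat) := by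
      refine Subtype.ext ?_
      simp only [SuperRep.intFirst]
      omega
    rw [hf]
    -- In the natural order the integers `1, …, b` precede `b + 1/2`, and the half-integers `1/2, …,
    -- a + 1/2` precede `a + 1`; this gives `p` and `q`.
    refine hNμ.le_iSup_eigenspace (f := SuperRep.intFirst m) (al := Y.rowLen) (be := Y.colLen)
      (p := fun b => b) (q := fun a => a + 1) ?_ ?_ ?_ ?_ key ?_ ?_ ?_ _
    · rintro (a | a) (b | b) h <;> have h := congrArg Subtype.val h <;>
        simp only [SuperRep.intFirst] at h <;> first | omega | (congr 1; omega)
    · rintro (a | a) <;> simp only [SuperRep.intFirst] <;> omega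
    · intro s hs
      rcases Int.even_or_odd' s.1 with ⟨d, hd | hd⟩
      · exact ⟨.inl (d - 1).toNat, Subtype.ext (by simp only [SuperRep.intFirst]; omega)⟩
      · exact ⟨.inr d.toNat, Subtype.ext (by simp only [SuperRep.intFirst]; omega)⟩
    · intro a b
      simp [ipar, SuperRep.intFirst, h2]
    · intro a b; omega
    · rintro (a | a) (b | b) h <;> simp only [GLAction.shuffle] at h <;>
        change (SuperRep.intFirst m _).1 < (SuperRep.intFirst m _).1 <;>
        simp only [SuperRep.intFirst] <;> omega
    · rintro (a | a)
      · rw [hY _ trivial (by simp only [SuperRep.intFirst]; omega)]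
        rw [show (SuperRep.intFirst m _).1.toNat = 2 * (a + 1) by
          simp only [SuperRep.intFirst]; omega, domCoeff_even]
        rfl
      · rw [hY _ trivial (by simp only [SuperRep.intFirst]; omega)]
        rw [show (SuperRep.intFirst m _).1.toNat = 2 * a + 1 by
          simp only [SuperRep.intFirst]; omega, domCoeff_odd]
        rfl
  · obtain ⟨c, hc⟩ := he
    have hf : r = SuperRep.halfFirst m (.inl c.toNat) := by
      refine Subtype.ext ?_
      simp only [SuperRep.halfFirst]
      omega
    rw [hf]
    -- With the roles exchanged, `b + 1` half-integers precede the integer `b + 1`, and `a` integers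
    -- precede `a + 1/2`.
    refine hNμ.le_iSup_eigenspace (f := SuperRep.halfFirst m) (al := Y.colLen) (be := Y.rowLen)
      (p := fun b => b + 1) (q := fun a => a) ?_ ?_ ?_ ?_ (fun a b => (key b a).symm) ?_ ?_ ?_ _
    · rintro (a | a) (b | b) h <;> have h := congrArg Subtype.val h <;>
        simp only [SuperRep.halfFirst] at h <;> first | omega | (congr 1; omega)
    · rintro (a | a) <;> simp only [SuperRep.halfFirst] <;> omega
    · intro s hs
      rcases Int.even_or_odd' s.1 with ⟨d, hd | hd⟩
      · exact ⟨.inr (d - 1).toNat, Subtype.ext (by simp only [SuperRep.halfFirst]; omega)⟩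
      · exact ⟨.inl d.toNat, Subtype.ext (by simp only [SuperRep.halfFirst]; omega)⟩
    · intro a b
      simp [ipar, SuperRep.halfFirst, h2]
    · intro a b; omega
    · rintro (a | a) (b | b) h <;> simp only [GLAction.shuffle] at h <;>
        change (SuperRep.halfFirst m _).1 < (SuperRep.halfFirst m _).1 <;>
        simp only [SuperRep.halfFirst] <;> omega
    · rintro (a | a)
      · rw [hY _ trivial (by simp only [SuperRep.halfFirst]; omega)]
        rw [show (SuperRep.halfFirst m _).1.toNat = 2 * a + 1 by
          simp only [SuperRep.halfFirst]; omega, domCoeff_odd]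
        rfl
      · rw [hY _ trivial (by simp only [SuperRep.halfFirst]; omega)]
        rw [show (SuperRep.halfFirst m _).1.toNat = 2 * (a + 1) by
          simp only [SuperRep.halfFirst]; omega, domCoeff_even]
        rfl

end ModO

end SuperKZ

namespace SuperKZ

/-- All flavors contain the negative indices, so a missing index is in the tail and positivity
applies to it. -/
theorem pos_of_notMem_idx {m : ℕ} {k : Flavor} {r : IPlus m} (hr : r ∉ k.idx) : 0 < r.1 := by
  rcases r.2 with h | h
  · exfalso
    cases k with
    | tilde => exact hr trivial
    | plain => exact hr h.2.2
    | bar => exact hr (Or.inl h.2.1)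
  · exact h

/-- No finiteness is needed: the two supports correspond under `e`, so for infinite support both
sums take the default value zero. -/
theorem finsum_eq_finsum_comp {α β N : Type*} [AddCommMonoid N] {e : α → β}
    (he : Function.Injective e) {f : β → N} (hf : ∀ b, b ∉ Set.range e → f b = 0) :
    ∑ᶠ b, f b = ∑ᶠ a, f (e a) := by
  rw [← finsum_mem_univ, ← finsum_mem_range he]
  refine finsum_mem_inter_support_eq f _ _ ?_
  ext b
  simp only [Set.mem_inter_iff, Set.mem_univ, true_and, Function.mem_support]
  exact ⟨fun h => ⟨by_contra fun hb => h (hf b hb), h⟩, fun h => h.2⟩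

/-! ### Root vectors that annihilate the truncated module -/

section Root

variable {m : ℕ} {x : LieType} {k : Flavor}

/-- The nonzero entries of a root vector sit at one place or at two mutually dual places, and dual
indices have equal parity. -/
theorem exists_homog_of_inRootSpace {α : RootWt m} (hα : SuppIn k α) (h0 : α ≠ 0)
    {A : Module.End ℂ (V m)} (hA : InRootSpace x k α A) :
    ∃ p, parOp x * A * parOp x = sgn p • A := by
  by_cases hA0 : A = 0
  · exact ⟨0, by simp [hA0]⟩
  · obtain ⟨i, j, hij⟩ := exists_entry_ne_zero hA0
    rw [inRootSpace_iff hα] at hA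
    have hwt := hA.2 i j hij
    refine ⟨par x i + par x j, entry_ext fun i' j' => ?_⟩
    rw [parOp, entry_mul_diag, entry_diag_mul, entry_smul]
    by_cases h : entry A i' j' = 0
    · simp [h]
    · have hwt' := hA.2 i' j' h
      rcases eq_or_eq_dual_of_wt_sub (by rwa [hwt]) (hwt.trans hwt'.symm) with
        ⟨rfl, rfl⟩ | ⟨rfl, rfl⟩
      · rw [sgn_add]; ring
      · rw [sgn_add, par_dual, par_dual]; ring

theorem bracket_Eelt {α : RootWt m} {r : IPlus m} {A : algG m x .tilde}
    (hA : InRootSpace x .tilde α A.1) :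
    (⟨bracket x (Eelt (k := .tilde) (x := x) r trivial).1 (toAlgg A).1,
      bracket_mem (Eelt (k := .tilde) (x := x) r trivial).2 (toAlgg A).2⟩ : algg m x .tilde) = α r • toAlgg A := by
  refine Subtype.ext (Prod.ext ?_ ?_)
  · exact hA.2 r trivial
  · change cocycle x (cartanE x r) A.1 = α r * 0
    rw [mul_zero, cocycle, superBracket_of_homog J_even (cartanE_even x r), J, diag_mul_cartanE]
    simp [sgn_zero, str]

/-- A root vector lowering the coefficient of `ε_r`, with `r` not in the index set of the
subalgebra, annihilates the truncated module. -/
theorem ModO.act_tPart_eq_zero {M : Type*} [AddCommGroup M] [Module ℂ M] (R : ModO m x .tilde M)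
    {α : RootWt m} (h0 : α ≠ 0) {A : algG m x .tilde} (hA : InRootSpace x .tilde α A.1)
    {r : IPlus m} (hr : r ∉ k.idx) {z : ℤ} (hz : α r = z) (hneg : z < 0) {v : M}
    (hv : v ∈ R.tPart k) : R.act (toAlgg A) v = 0 := by
  obtain ⟨p, hp⟩ := exists_homog_of_inRootSpace (suppIn_tilde α) h0 hA
  have hE := (R.mem_tPart_iff k v).1 hv r hr
  have h := R.act_bracket 0 p (Eelt r trivial) (toAlgg A)
    ⟨cartanE_even x r, by simp [sgn_zero]⟩ ⟨hp, by simp [toAlgg]⟩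
  rw [bracket_Eelt hA, map_smul] at h
  have h1 := congrArg (fun F : Module.End ℂ M => F v) h
  simp only [LinearMap.smul_apply, LinearMap.sub_apply, Module.End.mul_apply, hE, map_zero,
    smul_zero, sub_zero] at h1
  -- Since `E_r` annihilates `v`, the image of `v` is an eigenvector of `E_r` for the negative
  -- integer `z`, or zero; only natural eigenvalues occur.
  refine GLAction.eq_zero_of_mem_iSup_eigenspace (f := fun n : ℕ => (n : ℂ)) (h := α r)
    (H := R.act (Eelt r trivial)) ?_ h1.symm ?_
  · rw [R.iSup_eigenspace_eq_top (pos_of_notMem_idx hr)]; trivial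
  · intro n hn
    rw [hz] at hn
    have : (n : ℤ) = z := by exact_mod_cast hn
    omega

end Root

/-! ### Operators on tensor products -/

theorem linearMap_sum_comp {ι N₁ N₂ N₃ : Type*} [AddCommGroup N₁] [AddCommGroup N₂]
    [AddCommGroup N₃] [Module ℂ N₁] [Module ℂ N₂] [Module ℂ N₃] (s : Finset ι)
    (f : ι → N₂ →ₗ[ℂ] N₃) (g : N₁ →ₗ[ℂ] N₂) : (∑ i ∈ s, f i) ∘ₗ g = ∑ i ∈ s, f i ∘ₗ g :=
  LinearMap.ext fun v => by simp

theorem linearMap_comp_sum {ι N₁ N₂ N₃ : Type*} [AddCommGroup N₁] [AddCommGroup N₂]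
    [AddCommGroup N₃] [Module ℂ N₁] [Module ℂ N₂] [Module ℂ N₃] (s : Finset ι)
    (f : N₂ →ₗ[ℂ] N₃) (g : ι → N₁ →ₗ[ℂ] N₂) : f ∘ₗ (∑ i ∈ s, g i) = ∑ i ∈ s, f ∘ₗ g i :=
  LinearMap.ext fun v => by simp

section FactorOp

variable {ℓ : ℕ} {M N : Fin ℓ → Type*} [∀ i, AddCommGroup (M i)] [∀ i, Module ℂ (M i)]
  [∀ i, AddCommGroup (N i)] [∀ i, Module ℂ (N i)]

theorem map_eq_zero {g : ∀ i, N i →ₗ[ℂ] M i} {i : Fin ℓ} (h : g i = 0) :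
    PiTensorProduct.map g = 0 := by
  refine PiTensorProduct.ext (MultilinearMap.ext fun v => ?_)
  simp only [LinearMap.compMultilinearMap_apply, PiTensorProduct.map_tprod, LinearMap.zero_apply]
  exact (PiTensorProduct.tprod ℂ).map_coord_zero i (by rw [h, LinearMap.zero_apply])

theorem factorOp_comp_map (σ : ∀ i, Module.End ℂ (M i)) (σ' : ∀ i, Module.End ℂ (N i))
    (g : ∀ i, N i →ₗ[ℂ] M i) (hσ : ∀ i, σ i ∘ₗ g i = g i ∘ₗ σ' i) (i : Fin ℓ)
    {A : Module.End ℂ (M i)} {A' : Module.End ℂ (N i)} (hA : A ∘ₗ g i = g i ∘ₗ A') :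
    factorOp σ i A ∘ₗ PiTensorProduct.map g = PiTensorProduct.map g ∘ₗ factorOp σ' i A' := by
  rw [factorOp, factorOp, linearMap_sum_comp, linearMap_comp_sum]
  refine Finset.sum_congr rfl fun p _ => ?_
  rw [← PiTensorProduct.map_comp, ← PiTensorProduct.map_comp]
  congr 1
  funext j
  have hσ' : ∀ j v, σ j (g j v) = g j (σ' j v) := fun j v => LinearMap.congr_fun (hσ j) v
  by_cases hj : j = i
  · subst hj
    have hA' : ∀ v, A (g j v) = g j (A' v) := LinearMap.congr_fun hA
    refine LinearMap.ext fun v => ?_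
    simp [opPart, hσ', hA']
  · rw [Function.update_of_ne hj, Function.update_of_ne hj]
    by_cases hji : j < i
    · simp only [if_pos hji]
      refine LinearMap.ext fun v => ?_
      have : ∀ n : ℕ, ∀ v, (σ j ^ n) (g j v) = g j ((σ' j ^ n) v) := by
        intro n
        induction n with
        | zero => simp
        | succ n ih => intro v; simp [pow_succ, ih, hσ']
      exact this _ v
    · simp only [if_neg hji]
      rfl

/-- The second hypothesis is needed because the homogeneous parts of `A` involve `σ A σ`. -/
theorem factorOp_comp_map_eq_zero (σ : ∀ i, Module.End ℂ (M i)) (g : ∀ i, N i →ₗ[ℂ] M i)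
    (i : Fin ℓ) {A : Module.End ℂ (M i)} (h1 : A ∘ₗ g i = 0) (h2 : A ∘ₗ σ i ∘ₗ g i = 0) :
    factorOp σ i A ∘ₗ PiTensorProduct.map g = 0 := by
  rw [factorOp, linearMap_sum_comp]
  refine Finset.sum_eq_zero fun p _ => ?_
  rw [← PiTensorProduct.map_comp]
  refine map_eq_zero (i := i) (LinearMap.ext fun v => ?_)
  have h1' := LinearMap.congr_fun h1 v
  have h2' := LinearMap.congr_fun h2 v
  simp only [LinearMap.comp_apply, LinearMap.zero_apply] at h1' h2'
  simp [opPart, h1', h2']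

/-- An operator in another factor changes factor `i` only through the sign rule, that is by a power
of `σ i`. The conditions on `A` are stable under this, so `A` still gives zero when it is applied
last. -/
theorem factorOp_comp_factorOp_comp_map_eq_zero (σ : ∀ i, Module.End ℂ (M i))
    (hσ : ∀ i, σ i * σ i = 1) (g : ∀ i, N i →ₗ[ℂ] M i) {i j : Fin ℓ} (hij : i ≠ j)
    {A : Module.End ℂ (M i)} (B : Module.End ℂ (M j)) (h1 : A ∘ₗ g i = 0)
    (h2 : A ∘ₗ σ i ∘ₗ g i = 0) :
    factorOp σ i A ∘ₗ factorOp σ j B ∘ₗ PiTensorProduct.map g = 0 := by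
  rw [factorOp.eq_def σ j, linearMap_sum_comp, linearMap_comp_sum]
  refine Finset.sum_eq_zero fun p _ => ?_
  rw [← PiTensorProduct.map_comp]
  have hσ' : ∀ v, σ i (σ i v) = v := LinearMap.congr_fun (hσ i)
  have h1' := LinearMap.congr_fun h1
  have h2' := LinearMap.congr_fun h2
  simp only [LinearMap.comp_apply, LinearMap.zero_apply] at h1' h2'
  have hp : (σ i) ^ p.val = 1 ∨ (σ i) ^ p.val = σ i := by
    rcases parity_cases p with rfl | rfl
    · left; simp
    · right; simp [ZMod.val_one]
  refine factorOp_comp_map_eq_zero σ _ i ?_ ?_ <;>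
  · refine LinearMap.ext fun v => ?_
    simp only [LinearMap.comp_apply, Function.update_of_ne hij, LinearMap.zero_apply]
    split_ifs
    · rcases hp with hp | hp <;> simp [hp, h1', h2', hσ']
    · simp [h1', h2']

theorem factorOp_even (σ : ∀ i, Module.End ℂ (M i)) (i : Fin ℓ) {A : Module.End ℂ (M i)}
    (hA : σ i * A * σ i = A) :
    factorOp σ i A = PiTensorProduct.map (Function.update (fun _ => 1) i A) := by
  have h := opPart_of_homog (σ := σ i) (r := 0) (C := A) (by rw [hA, sgn_zero, one_smul])
  rw [factorOp, Finset.sum_eq_single 0]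
  · rw [h, if_pos rfl]
    congr 2
    funext j
    simp
  · intro p _ hp
    rw [h, if_neg hp]
    exact map_eq_zero (i := i) (by rw [Function.update_self])
  · simp

theorem factorOp_tprod_of_eigen (σ : ∀ i, Module.End ℂ (M i)) (i : Fin ℓ) {A : Module.End ℂ (M i)}
    (hA : σ i * A * σ i = A) {w : ∀ i, M i} {c : ℂ} (hw : A (w i) = c • w i) :
    factorOp σ i A (PiTensorProduct.tprod ℂ w) = c • PiTensorProduct.tprod ℂ w := by
  rw [factorOp_even σ i hA, PiTensorProduct.map_tprod]
  have : (fun j => (Function.update (fun _ => 1) i A : ∀ j, Module.End ℂ (M j)) j (w j))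
      = Function.update w i (c • w i) := by
    funext j
    by_cases hj : j = i
    · subst hj; simp [hw]
    · simp [hj]
  rw [this, MultilinearMap.map_update_smul, Function.update_eq_self]

end FactorOp

/-! ### The truncation of a tensor product -/

section Truncation

variable {m : ℕ} {x : LieType} {k : Flavor}

/-- A basis of weight vectors. -/
theorem ModO.exists_weight_basis.{u} {M : Type u} [AddCommGroup M] [Module ℂ M]
    (R : ModO m x .tilde M) :
    ∃ (κ : Wt m → Type u) (b : Module.Basis (Σ γ, κ γ) ℂ M), ∀ a, b a ∈ R.weightSpace a.1 := by
  classical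
  have h := DirectSum.isInternal_submodule_of_iSupIndep_of_iSup_eq_top R.weightSpace_indep
    R.iSup_weightSpace
  exact ⟨_, h.collectedBasis fun γ => Module.Free.chooseBasis ℂ (R.weightSpace γ),
    fun a => h.collectedBasis_mem _ a⟩

theorem ModO.exists_nat_of_weightSpace {M : Type*} [AddCommGroup M] [Module ℂ M]
    (R : ModO m x .tilde M) {γ : Wt m} {v : M} (hv : v ∈ R.weightSpace γ) (h0 : v ≠ 0)
    {r : IPlus m} (hr : 0 < r.1) : ∃ n : ℕ, γ.2 r = n := by
  by_contra! hn
  refine h0 (GLAction.eq_zero_of_mem_iSup_eigenspace (f := fun n : ℕ => (n : ℂ)) (h := γ.2 r)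
    (H := R.act (Eelt r trivial)) ?_ (hv.2 r trivial) fun n h => hn n h.symm)
  rw [R.iSup_eigenspace_eq_top hr]; trivial

variable {ℓ : ℕ} {M : Fin ℓ → Type*} [∀ i, AddCommGroup (M i)] [∀ i, Module ℂ (M i)]
  (R : ∀ i, ModO m x .tilde (M i))

theorem tensorT_tensorIncl (w : ⨂[ℂ] i, (R i).tPart k) : tensorT k R (tensorIncl k R w) = w := by
  have h : tensorT k R ∘ₗ tensorIncl k R = LinearMap.id := by
    rw [tensorT, tensorIncl, ← PiTensorProduct.map_comp, ← PiTensorProduct.map_id]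
    congr 1
    funext i
    exact Submodule.projectionOnto_comp_subtype ((R i).isCompl_tPart k)
  exact LinearMap.congr_fun h w

theorem tensorIncl_injective : Function.Injective (tensorIncl k R) :=
  Function.LeftInverse.injective (tensorT_tensorIncl R)

theorem σ_act_Eelt (i : Fin ℓ) (r : IPlus m) :
    ((reps R i).σ * (reps R i).act (Eelt r trivial) * (reps R i).σ)
      = (reps R i).act (Eelt r trivial) := by
  have h := (reps R i).act_parity 0 (Eelt r trivial) ⟨cartanE_even x r, by simp [sgn_zero]⟩
  rwa [sgn_zero, one_smul] at h

/-- A tensor whose weight is in the dual of the Cartan subalgebra of flavor `k` is in the tensor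
product of the truncated modules. -/
theorem tensorIncl_tensorT {μ : Wt m} (hμ : SuppIn k μ.2) {v : ⨂[ℂ] i, M i}
    (hv : v ∈ tensorWeightSpace (reps R) μ) : tensorIncl k R (tensorT k R v) = v := by
  classical
  choose κ b hb using fun i => (R i).exists_weight_basis
  set B := Basis.piTensorProduct b with hB
  -- The basis consists of tensors of weight vectors, so a basis tensor occurring in `v` has the
  -- total weight of `v`; at `r` this weight is zero.
  have key : ∀ r, r ∉ k.idx → ∀ f, B.repr v f ≠ 0 → ∑ i, (f i).1.2 r = 0 := by
    intro r hr f hf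
    have h1 := hv.2 r trivial
    have h0 : μ.2 r = 0 := by
      by_contra h
      exact hr (hμ r h)
    have h2 : B.coord f ∘ₗ (∑ i, actAt (reps R) i (Eelt r trivial))
        = (∑ i, (f i).1.2 r) • B.coord f := by
      refine B.ext fun f' => ?_
      have h3 : (∑ i, actAt (reps R) i (Eelt r trivial)) (B f') = (∑ i, (f' i).1.2 r) • B f' := by
        rw [LinearMap.sum_apply, Finset.sum_smul]
        refine Finset.sum_congr rfl fun i _ => ?_
        rw [hB, Basis.piTensorProduct_apply]
        exact factorOp_tprod_of_eigen _ i (σ_act_Eelt R i r) ((hb i (f' i)).2 r trivial)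
      rw [LinearMap.comp_apply, h3, map_smul, LinearMap.smul_apply, Module.Basis.coord_apply,
        Module.Basis.repr_self]
      by_cases hff : f' = f
      · rw [hff]
      · simp [hff]
    have h4 := LinearMap.congr_fun h2 v
    rw [LinearMap.comp_apply, LinearMap.sum_apply, h1, h0, zero_smul, map_zero,
      LinearMap.smul_apply, Module.Basis.coord_apply, smul_eq_mul] at h4
    exact (mul_eq_zero.1 h4.symm).resolve_right hf
  have hfix : ∀ f, B.repr v f ≠ 0 → tensorIncl k R (tensorT k R (B f)) = B f := by
    intro f hf
    have hmem : ∀ i, b i (f i) ∈ (R i).tPart k := by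
      intro i
      rw [ModO.mem_tPart_iff]
      intro r hr
      choose n hn using fun i => (R i).exists_nat_of_weightSpace (hb i (f i)) ((b i).ne_zero _)
        (pos_of_notMem_idx hr)
      have h1 := key r hr f hf
      simp only [hn] at h1
      -- Positivity enters here: natural numbers with sum zero are all zero.
      have h2 : ∑ i, n i = 0 := by exact_mod_cast h1
      have h3 := (Finset.sum_eq_zero_iff.1 h2) i (Finset.mem_univ i)
      rw [(hb i (f i)).2 r trivial, hn, h3, Nat.cast_zero, zero_smul]
    rw [hB, Basis.piTensorProduct_apply, tensorT, tensorIncl, PiTensorProduct.map_tprod,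
      PiTensorProduct.map_tprod]
    congr 1
    funext i
    have := Submodule.projectionOnto_apply_left ((R i).isCompl_tPart k) ⟨_, hmem i⟩
    exact congrArg Subtype.val this
  rw [← B.linearCombination_repr v, Finsupp.linearCombination_apply, Finsupp.sum, map_sum, map_sum]
  refine Finset.sum_congr rfl fun f hf => ?_
  rw [map_smul, map_smul, hfix f (Finsupp.mem_support_iff.1 hf)]

/-- Action and grading on the truncation are restrictions, so inclusion intertwines both
definitionally. The signs of the sign rule therefore match as well. -/
theorem actAt_tensorIncl (i : Fin ℓ) (X : algg m x k) (w : ⨂[ℂ] i, (R i).tPart k) :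
    actAt (reps R) i (inclTilde k X) (tensorIncl k R w)
      = tensorIncl k R (actAt (repsT k R) i X w) :=
  LinearMap.congr_fun (factorOp_comp_map (fun j => (reps R j).σ) (fun j => (repsT k R j).σ)
    (fun j => ((R j).tPart k).subtype) (fun _ => rfl) i
    (A := (reps R i).act (inclTilde k X)) (A' := (repsT k R i).act X) rfl) w

theorem mem_tensorWeightSpace_of_tensorIncl {μ : Wt m} {w : ⨂[ℂ] i, (R i).tPart k}
    (h : tensorIncl k R w ∈ tensorWeightSpace (reps R) μ) :
    w ∈ tensorWeightSpace (repsT k R) μ := by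
  refine ⟨tensorIncl_injective R ?_, fun r hr => tensorIncl_injective R ?_⟩
  · rw [map_sum, map_smul, ← h.1]
    refine Finset.sum_congr rfl fun i _ => ?_
    rw [← actAt_tensorIncl]; rfl
  · rw [map_sum, map_smul, ← h.2 r trivial]
    refine Finset.sum_congr rfl fun i _ => ?_
    rw [← actAt_tensorIncl]; rfl

/-- The element `X` annihilates all the truncated modules. -/
def KillsTrunc (k : Flavor) (X : algg m x .tilde) : Prop :=
  ∀ i, ∀ v ∈ (R i).tPart k, (R i).act X v = 0

variable {R}

theorem KillsTrunc.actAt {X : algg m x .tilde} (hX : KillsTrunc R k X) (i : Fin ℓ)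
    (w : ⨂[ℂ] i, (R i).tPart k) : actAt (reps R) i X (tensorIncl k R w) = 0 :=
  LinearMap.congr_fun (factorOp_comp_map_eq_zero (fun j => (reps R j).σ)
    (fun j => ((R j).tPart k).subtype) i (A := (reps R i).act X)
    (LinearMap.ext fun v => hX i v v.2)
    (LinearMap.ext fun v => hX i _ ((R i).σ_mem_tPart k v v.2))) w

theorem KillsTrunc.actAt_actAt {X : algg m x .tilde} (hX : KillsTrunc R k X) {i j : Fin ℓ}
    (hij : i ≠ j) (Y : algg m x .tilde) (w : ⨂[ℂ] i, (R i).tPart k) :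
    SuperKZ.actAt (reps R) i X (SuperKZ.actAt (reps R) j Y (tensorIncl k R w)) = 0 :=
  LinearMap.congr_fun (factorOp_comp_factorOp_comp_map_eq_zero (fun j => (reps R j).σ)
    (fun j => (reps R j).σ_sq)
    (fun j => ((R j).tPart k).subtype) hij (A := (reps R i).act X) ((reps R j).act Y)
    (LinearMap.ext fun v => hX i v v.2)
    (LinearMap.ext fun v => hX i _ ((R i).σ_mem_tPart k v v.2))) w

end Truncation

end SuperKZ

namespace SuperKZ

/-! ### Truncation of the Casimir tensor -/

section Casimir

variable {m : ℕ} {x : LieType} {k : Flavor}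

theorem str_smul (c : ℂ) (A : Module.End ℂ (V m)) : str x (c • A) = c * str x A := by
  rw [str, str, ← smul_eq_mul, smul_finsum]
  refine finsum_congr fun i => ?_
  simp only [LinearMap.smul_apply, map_smul, Finsupp.smul_apply, smul_eq_mul]
  ring

theorem pairing_smul (c d : ℂ) (A B : Module.End ℂ (V m)) :
    pairing x (c • A) (d • B) = c * d * pairing x A B := by
  have h : (c • A) * (d • B) = (c * d) • (A * B) := by
    rw [smul_mul_assoc, mul_smul_comm, smul_smul]
  cases x <;> simp only [pairing, h, str_smul] <;> ring

theorem parityOf_smul {c : ℂ} (hc : c ≠ 0) (A : Module.End ℂ (V m)) :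
    parityOf x (c • A) = parityOf x A := by
  have h : parOp x * c • A * parOp x = c • A ↔ parOp x * A * parOp x = A := by
    rw [mul_smul_comm, smul_mul_assoc]
    exact (smul_right_injective _ hc).eq_iff
  rw [parityOf, parityOf]
  by_cases h' : parOp x * A * parOp x = A
  · rw [if_pos h', if_pos (h.2 h')]
  · rw [if_neg h', if_neg fun h'' => h' (h.1 h'')]

theorem toAlgg_eq_smul_inclTilde {c : ℂ} {A : algG m x .tilde} {A' : algG m x k}
    (h : A.1 = c • A'.1) : toAlgg A = c • inclTilde k (toAlgg A') :=
  Subtype.ext (Prod.ext h (mul_zero c).symm)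

/-- Root vectors of the big algebra and of the subalgebra agree up to inverse scalars. -/
theorem RootVectors.exists_smul (B : RootVectors m x .tilde) (B' : RootVectors m x k)
    (β : posRoots m x k) : ∃ c d : ℂ, c * d = 1 ∧
      (B.up ⟨β.1, (mem_posRoots_iff_tilde.1 β.2).1⟩).1 = c • (B'.up β).1 ∧
      (B.down ⟨β.1, (mem_posRoots_iff_tilde.1 β.2).1⟩).1 = d • (B'.down β).1 := by
  have hs : SuppIn k β.1 := β.2.1.2.1
  have h0 : β.1 ≠ 0 := β.2.1.1
  have hpair := B'.pairing_eq β
  obtain ⟨c, hc⟩ := exists_eq_smul_of_inRootSpace (suppIn_tilde _) h0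
    ((inRootSpace_iff_tilde hs h0).1 (B'.up_mem β))
    -- The reference vector is nonzero because its pairing with its partner is one.
    (B.up_mem ⟨β.1, (mem_posRoots_iff_tilde.1 β.2).1⟩) (by
      intro h
      have h1 := pairing_smul (x := x) 0 1 (B'.up β).1 (B'.down β).1
      rw [zero_smul, one_smul, zero_mul, zero_mul, ← h, hpair] at h1
      exact one_ne_zero h1)
  obtain ⟨d, hd⟩ := exists_eq_smul_of_inRootSpace (suppIn_tilde _) (neg_ne_zero.2 h0)
    ((inRootSpace_iff_tilde (suppIn_neg hs) (neg_ne_zero.2 h0)).1 (B'.down_mem β))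
    (B.down_mem ⟨β.1, (mem_posRoots_iff_tilde.1 β.2).1⟩) (by
      intro h
      have h1 := pairing_smul (x := x) 1 0 (B'.up β).1 (B'.down β).1
      rw [zero_smul, one_smul, mul_zero, zero_mul, ← h, hpair] at h1
      exact one_ne_zero h1)
  refine ⟨c, d, ?_, hc, hd⟩
  have h1 := B.pairing_eq ⟨β.1, (mem_posRoots_iff_tilde.1 β.2).1⟩
  -- Both pairs are normalised, so bilinearity leaves `c * d = 1`.
  rwa [hc, hd, pairing_smul, hpair, mul_one] at h1

variable {ℓ : ℕ} {M : Fin ℓ → Type*} [∀ i, AddCommGroup (M i)] [∀ i, Module ℂ (M i)]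

theorem factorOp_smul (σ : ∀ i, Module.End ℂ (M i)) (i : Fin ℓ) (c : ℂ) (A : Module.End ℂ (M i)) :
    factorOp σ i (c • A) = c • factorOp σ i A := by
  rw [factorOp, factorOp, Finset.smul_sum]
  refine Finset.sum_congr rfl fun p _ => ?_
  rw [opPart_smul, PiTensorProduct.map_update_smul]

theorem actAt_smul (R : ∀ i, SuperRep m x k (M i)) (i : Fin ℓ) (c : ℂ) (X : algg m x k) :
    actAt R i (c • X) = c • actAt R i X := by
  rw [actAt, actAt, map_smul, factorOp_smul]

variable (R : ∀ i, ModO m x .tilde (M i))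

/-- At a missing index where `β` is nonzero, its coefficient is an integer, negative for one of `β`
and `-β`; the root vector of that weight lowers the coefficient below zero. -/
theorem killsTrunc_up_or_down (B : RootVectors m x .tilde) (β : posRoots m x .tilde)
    (hβ : ¬ SuppIn k β.1) :
    KillsTrunc R k (toAlgg (B.up β)) ∨ KillsTrunc R k (toAlgg (B.down β)) := by
  simp only [SuppIn, not_forall] at hβ
  obtain ⟨r, hr0, hr⟩ := hβ
  obtain ⟨i, j, hij⟩ := exists_wt_sub_of_mem_roots β.2.1
  have h0 : β.1 ≠ 0 := β.2.1.1
  have hz : β.1 r = ((wtInt r i - wtInt r j : ℤ) : ℂ) := by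
    rw [← hij, Finsupp.sub_apply, wt_apply, wt_apply]; push_cast; rfl
  generalize wtInt r i - wtInt r j = z at hz
  have hz0 : z ≠ 0 := by
    rintro rfl
    exact hr0 (by rw [hz, Int.cast_zero])
  rcases lt_or_gt_of_ne hz0 with h | h
  · exact Or.inl fun i v hv => (R i).act_tPart_eq_zero h0 (B.up_mem β) hr hz h hv
  · exact Or.inr fun i v hv => (R i).act_tPart_eq_zero (neg_ne_zero.2 h0) (B.down_mem β) hr
      (z := -z) (by rw [Finsupp.neg_apply, hz, Int.cast_neg]) (by omega) hv

theorem killsTrunc_Eelt {r : IPlus m} (hr : r ∉ k.idx) : KillsTrunc R k (Eelt r trivial) :=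
  fun i v hv => ((R i).mem_tPart_iff k v).1 hv r hr

/-- Terms at missing roots and indices vanish on the truncation, and the others agree one by one.
Distinct factors are essential: an annihilating root vector may be applied second, after its partner
has acted in the other factor. -/
theorem casimir_tensorIncl (B : RootVectors m x .tilde) (B' : RootVectors m x k) {i j : Fin ℓ}
    (hij : i ≠ j) (w : ⨂[ℂ] i, (R i).tPart k) :
    casimir B (reps R) i j (tensorIncl k R w)
      = tensorIncl k R (casimir B' (repsT k R) i j w) := by
  have hinj := tensorIncl_injective R (k := k)
  -- Injectivity of the inclusion preserves supports, so it commutes with `finsum` without a local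
  -- finiteness argument.
  have hmap : ∀ {ι : Sort _} (f : ι → ⨂[ℂ] i, (R i).tPart k),
      tensorIncl k R (∑ᶠ a, f a) = ∑ᶠ a, tensorIncl k R (f a) := fun f =>
    (tensorIncl k R).toAddMonoidHom.map_finsum_of_injective hinj f
  rw [casimir, casimir, map_add]
  congr 1
  · rw [hmap, finsum_eq_finsum_comp
      (e := fun β : posRoots m x k => (⟨β.1, (mem_posRoots_iff_tilde.1 β.2).1⟩ :
        posRoots m x .tilde))
      (fun β β' h => Subtype.ext (congrArg (fun b : posRoots m x .tilde => b.1) h))]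
    · refine finsum_congr fun β => ?_
      obtain ⟨c, d, hcd, hc, hd⟩ := B.exists_smul B' β
      have hc0 : c ≠ 0 := left_ne_zero_of_mul_eq_one hcd
      rw [hc, parityOf_smul hc0, toAlgg_eq_smul_inclTilde hc, toAlgg_eq_smul_inclTilde hd,
        map_add, map_smul, ← actAt_tensorIncl, ← actAt_tensorIncl, ← actAt_tensorIncl,
        ← actAt_tensorIncl]
      simp only [actAt_smul, LinearMap.smul_apply, map_smul, smul_smul]
      -- Each summand contains one `E_β` and one `E^β`, so the scalars enter only through `c * d =
      -- 1`.
      rw [hcd, mul_comm d c, hcd, one_smul, mul_one]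
    · intro β hβ
      have hs : ¬ SuppIn k β.1 := fun hs => hβ ⟨⟨β.1, mem_posRoots_iff_tilde.2 ⟨β.2, hs⟩⟩, rfl⟩
      -- In either case one of the two summands has the annihilating vector applied first and the
      -- other has it applied last.
      rcases killsTrunc_up_or_down R B β hs with h | h
      · rw [h.actAt, h.actAt_actAt hij, map_zero, smul_zero, add_zero]
      · rw [h.actAt, h.actAt_actAt hij, map_zero, smul_zero, add_zero]
  · rw [hmap, finsum_eq_finsum_comp
      (e := fun r : (k.idx : Set (IPlus m)) => (⟨r.1, trivial⟩ :
        (Flavor.tilde.idx : Set (IPlus m))))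
      (fun r s h => Subtype.ext (congrArg (fun b : (Flavor.tilde.idx : Set (IPlus m)) => b.1) h))]
    · refine finsum_congr fun r => ?_
      rw [map_smul, map_sub, map_smul, map_add]
      simp only [← actAt_tensorIncl]
      rfl
    · intro r hr
      have hs : r.1 ∉ k.idx := fun hs => hr ⟨⟨r.1, hs⟩, rfl⟩
      have h := killsTrunc_Eelt R hs
      rw [h.actAt, h.actAt_actAt hij]
      simp only [map_zero, add_zero, smul_zero, sub_zero]

/-! ### Truncation of the KZ equations -/

theorem gaudin_tensorIncl (B : RootVectors m x .tilde) (B' : RootVectors m x k) (i : Fin ℓ)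
    (z : Fin ℓ → ℂ) (w : ⨂[ℂ] i, (R i).tPart k) :
    gaudin B (reps R) i z (tensorIncl k R w) = tensorIncl k R (gaudin B' (repsT k R) i z w) := by
  rw [gaudin, gaudin, map_sum]
  refine Finset.sum_congr rfl fun j hj => ?_
  rw [map_smul, casimir_tensorIncl R B B' (Finset.ne_of_mem_erase hj).symm]

theorem IsPartialDeriv.comp_linearMap {N N' : Type*} [AddCommGroup N] [Module ℂ N] [AddCommGroup N']
    [Module ℂ N'] {ψ : (Fin ℓ → ℂ) → N} {i : Fin ℓ} {z : Fin ℓ → ℂ} {w : N}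
    (h : IsPartialDeriv ψ i z w) (F : N →ₗ[ℂ] N') : IsPartialDeriv (fun z => F (ψ z)) i z (F w) :=
  fun φ => h (φ ∘ₗ F)

/-- Openness of `U` keeps nearby points of the coordinate line inside `U`, so values outside `U` do
not affect the derivative. -/
theorem IsPartialDeriv.congr_of_eqOn {N : Type*} [AddCommGroup N] [Module ℂ N]
    {ψ ψ' : (Fin ℓ → ℂ) → N} {i : Fin ℓ} {z : Fin ℓ → ℂ} {w : N} {U : Set (Fin ℓ → ℂ)}
    (hU : IsOpen U) (hz : z ∈ U) (h : IsPartialDeriv ψ i z w) (heq : ∀ z ∈ U, ψ z = ψ' z) :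
    IsPartialDeriv ψ' i z w := by
  intro φ
  refine (h φ).congr_of_eventuallyEq ?_
  have hc : Continuous fun t : ℂ => Function.update z i t := continuous_const.update i continuous_id
  have hmem : ∀ᶠ t in nhds (z i), Function.update z i t ∈ U :=
    hc.continuousAt.preimage_mem_nhds (by
      rw [Function.update_eq_self]
      exact hU.mem_nhds hz)
  filter_upwards [hmem] with t ht
  rw [heq _ ht]

theorem mem_KZ_iff_funT_mem (B : RootVectors m x .tilde) (B' : RootVectors m x k) {κ : ℂ}
    {U : Set (Fin ℓ → ℂ)} (hU : IsOpen U) {μ : Wt m} (hμ : SuppIn k μ.2)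
    {ψ : (Fin ℓ → ℂ) → ⨂[ℂ] i, M i} (hψ : ψ ∈ diffFun U (tensorWeightSpace (reps R) μ)) :
    ψ ∈ KZ κ U B (reps R) μ ↔ funT k R ψ ∈ KZ κ U B' (repsT k R) μ := by
  have hincl : ∀ z ∈ U, tensorIncl k R (funT k R ψ z) = ψ z := fun z hz =>
    tensorIncl_tensorT R hμ (hψ.1 z hz)
  constructor
  · rintro ⟨-, h⟩
    refine ⟨⟨fun z hz => mem_tensorWeightSpace_of_tensorIncl R ?_,
      fun φ => hψ.2 (φ ∘ₗ tensorT k R)⟩, fun i z hz => ?_⟩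
    · rw [hincl z hz]; exact hψ.1 z hz
    · obtain ⟨w, hw, hκ⟩ := h i z hz
      -- The derivative `w` is not known to lie in the truncation, but `κ • w` equals a value of the
      -- Gaudin operator, which is in the image of `tensorIncl`; there `tensorT` loses nothing.
      refine ⟨tensorT k R w, hw.comp_linearMap _, tensorIncl_injective R ?_⟩
      rw [← gaudin_tensorIncl R B B', hincl z hz, ← hκ, ← map_smul, hκ, ← hincl z hz,
        gaudin_tensorIncl R B B', tensorT_tensorIncl]
  · rintro ⟨-, h⟩
    refine ⟨hψ, fun i z hz => ?_⟩
    obtain ⟨w, hw, hκ⟩ := h i z hz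
    refine ⟨tensorIncl k R w, (hw.comp_linearMap (tensorIncl k R)).congr_of_eqOn hU hz hincl, ?_⟩
    rw [← map_smul, hκ, ← gaudin_tensorIncl R B B', hincl z hz]

/-- The argument depends on the weight only through its support, so a single statement in `k` covers
both truncations. -/
theorem truncation_KZ (B : RootVectors m x .tilde) (B' : RootVectors m x k) (κ : ℂ)
    {U : Set (Fin ℓ → ℂ)} (hU : IsOpen U) {μ : Wt m} (hμ : SuppIn k μ.2) :
    (∀ v ∈ tensorWeightSpace (reps R) μ,
        tensorIncl k R (tensorT k R v) = v ∧
        ∀ i j, i ≠ j → casimir B (reps R) i j v =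
          tensorIncl k R (casimir B' (repsT k R) i j (tensorT k R v))) ∧
      ∀ ψ ∈ diffFun U (tensorWeightSpace (reps R) μ),
        (ψ ∈ KZ κ U B (reps R) μ ↔ funT k R ψ ∈ KZ κ U B' (repsT k R) μ) := by
  refine ⟨fun v hv => ?_, fun ψ hψ => mem_KZ_iff_funT_mem R B B' hU hμ hψ⟩
  have h := tensorIncl_tensorT R hμ hv
  refine ⟨h, fun i j hij => ?_⟩
  rw [← casimir_tensorIncl R B B' hij, h]

end Casimir

end SuperKZ

theorem mainTheorem5 (m : ℕ) (x : LieType) (ℓ : ℕ) (M : Fin ℓ → Type*)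
    [∀ i, AddCommGroup (M i)] [∀ i, Module ℂ (M i)] (R : ∀ i, ModO m x .tilde (M i))
    (B : RootVectors m x .tilde) (B₀ : RootVectors m x .plain) (B₁ : RootVectors m x .bar)
    (κ : ℂ) (hκ : κ ≠ 0) (U : Set (Fin ℓ → ℂ)) (hU : IsOpen U) (hne : U.Nonempty)
    (hconf : U ⊆ config ℓ) :
    (∀ μ ∈ Xi m x .plain,
      (∀ v ∈ tensorWeightSpace (reps R) μ,
        tensorIncl .plain R (tensorT .plain R v) = v ∧
        ∀ i j, i ≠ j → casimir B (reps R) i j v =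
          tensorIncl .plain R (casimir B₀ (repsT .plain R) i j (tensorT .plain R v))) ∧
      ∀ ψ ∈ diffFun U (tensorWeightSpace (reps R) μ),
        (ψ ∈ KZ κ U B (reps R) μ ↔ funT .plain R ψ ∈ KZ κ U B₀ (repsT .plain R) μ)) ∧
    (∀ μ ∈ Xi m x .bar,
      (∀ v ∈ tensorWeightSpace (reps R) μ,
        tensorIncl .bar R (tensorT .bar R v) = v ∧
        ∀ i j, i ≠ j → casimir B (reps R) i j v =
          tensorIncl .bar R (casimir B₁ (repsT .bar R) i j (tensorT .bar R v))) ∧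
      ∀ ψ ∈ diffFun U (tensorWeightSpace (reps R) μ),
        (ψ ∈ KZ κ U B (reps R) μ ↔ funT .bar R ψ ∈ KZ κ U B₁ (repsT .bar R) μ)) := by
  exact ⟨fun μ hμ => truncation_KZ R B B₀ κ hU hμ.1, fun μ hμ => truncation_KZ R B B₁ κ hU hμ.1⟩
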